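/- Let $\omega$ be a primitive cubic root of unity. For a polynomial $P(x,y,z)$ with $P(\lambda x,\lambda^2y,\lambda^3z)=\lambda^4P(x,y,z)$, the equation $x'''=P(x,x',x'')$ is given by the vector field $W=y\,\partial_x+z\,\partial_y+P\,\partial_z$ on $\mathbb C^3$, which induces a singular foliation $\mathcal G_P$ on the weighted projective plane $\mathbb P(1,2,3)$, the quotient of $\mathbb C^3\setminus\{0\}$ by $(x,y,z)\mapsto(\lambda x,\lambda^2y,\lambda^3z)$, $\lambda\in\mathbb C^*$. Let $\mathcal G_{\mathrm{IV}},\mathcal G_{\mathrm V},\mathcal G_{\mathrm{VI}}$ be the foliations induced by the reduced Chazy equations $$x'''=3xx''+3(x')^2-3x^2x',\qquad x'''=2xx''+4(x')^2-2x^2x',\qquad x'''=xx''+5(x')^2-x^2x'.$$ Let $(S_n,\mathcal E_n,T_n)$, for $n=3,4,6$, be the following surface, foliation and automorphism of order $n$: * $S_3=\mathbb P^2$, $\mathcal E_3$ is given by $\omega^2YZ\,dX+\omega XZ\,dY+XY\,dZ=0$, and $T_3(X:Y:Z)=(Z:X:Y)$; * $S_4=\mathbb P^1\times\mathbb P^1$,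 $\mathcal E_4$ is given by $Y\,dX-\mathrm iX\,dY=0$ in the chart $(X:1,Y:1)$, and $T_4(X:1,Y:1)=(Y:1,1:X)$; * $S_6$ is the blow-up of $\mathbb P^2$ at the vertices of the coordinate triangle, $\mathcal E_6$ is the strict transform of $\mathcal E_3$, and $T_6$ is the automorphism induced by $T_3\circ Q$, where $Q(X:Y:Z)=(YZ:ZX:XY)$. Let $\mathcal F_n$ be the foliation induced by $\mathcal E_n$ on the quotient $S_n/T_n$ and on its birational models, in particular on its minimal desingularization ($\mathcal F_3$ is Brunella's very special foliation, $\mathcal F_4$ and $\mathcal F_6$ are Santos's foliations). Then $\mathcal G_{\mathrm{IV}}$, $\mathcal G_{\mathrm V}$ and $\mathcal G_{\mathrm{VI}}$ are birationally equivalent to $\mathcal F_3$, $\mathcal F_4$ and $\mathcal F_6$, respectively. Moreover, for $n=3,4,6$ let $B_n$ be, respectively, the first integral $$x^3-3xy+z,\qquad x^4-4x^2y+2zx-y^2,\qquad x^6-6x^4y+6zx^3-15x^2y^2+6xyz+8y^3-3z^2$$ of the corresponding vector field $W$, and let $\Sigma_n=B_n^{-1}(1)$. There is a birational map $\Phi_n:S_n\dashrightarrow\Sigma_n$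 that maps $\mathcal E_n$ to the foliation induced by $W$ on $\Sigma_n$; that is equivariant with respect to the actions of $\mathbb Z_n$, in the sense that $\Phi_n\circ T_n=\zeta_n\cdot\Phi_n$, where $\zeta\cdot(x,y,z)=(\zeta x,\zeta^2y,\zeta^3z)$ and $\zeta_3=\omega^2$, $\zeta_4=\mathrm i$, $\zeta_6=-\omega^2$; and that induces, through the quotient map $S_n\to S_n/T_n$ and the projection $\Sigma_n\to\mathbb P(1,2,3)$, a birational map $S_n/T_n\dashrightarrow\mathbb P(1,2,3)$ mapping $\mathcal F_n$ to the Chazy foliation. Explicitly, $\Phi_n=(f_n,D_nf_n,D_n^2f_n)$ where, in the charts $(X:Y:1)$ of $\mathbb P^2$ and $(X:1,Y:1)$ of $\mathbb P^1\times\mathbb P^1$, $$f_3=-\frac{(\omega+1)(\omega^2Y+\omega X+1)}{\omega^2Y+X+\omega},\qquad f_4=\frac{(X-1)(Y-1)}{XY+\mathrm iX-\mathrm iY-1},$$ $$f_6=\frac{X(1-Y^2)-\omega^2Y(1-X^2)+\omega(Y^2-X^2)}{X+Y+X^2+Y^2+X^2Y+XY^2-6XY},$$ $$D_3=(\omega-1)(X\partial_X-\omega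 Y\partial_Y),\qquad D_4=(\mathrm i-1)(\mathrm iX\partial_X+Y\partial_Y),\qquad D_6=-\omega^2(X\partial_X-\omega Y\partial_Y).$$ -/

import Mathlib

namespace ChazyLinks

open MvPolynomial

/-! ### Spaces with functions -/

/-- A complex space with functions: a topological space with a sheaf of `ℂ`-valued functions
which are closed under the ring operations and under inversion where they do not vanish.
`RegularOn U f` says that the restriction of `f` to the open set `U` is a regular function on `U`
(the values of `f` outside `U` are irrelevant). -/
structure FunSpace where
  carrier : Type
  top : TopologicalSpace carrier
  RegularOn : Set carrier → (carrier → ℂ) → Prop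
  const : ∀ (U : Set carrier) (c : ℂ), IsOpen U → RegularOn U (fun _ => c)
  add : ∀ (U : Set carrier) (f g : carrier → ℂ), IsOpen U → RegularOn U f → RegularOn U g →
    RegularOn U (fun x => f x + g x)
  mul : ∀ (U : Set carrier) (f g : carrier → ℂ), IsOpen U → RegularOn U f → RegularOn U g →
    RegularOn U (fun x => f x * g x)
  congr : ∀ (U : Set carrier) (f g : carrier → ℂ), IsOpen U → RegularOn U f →
    (∀ x ∈ U, f x = g x) → RegularOn U g
  mono : ∀ (U V : Set carrier) (f : carrier → ℂ), IsOpen U → IsOpen V → V ⊆ U →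
    RegularOn U f → RegularOn V f
  glue : ∀ (U : Set carrier) (f : carrier → ℂ), IsOpen U →
    (∀ x ∈ U, ∃ V, IsOpen V ∧ x ∈ V ∧ V ⊆ U ∧ RegularOn V f) → RegularOn U f
  isOpen_ne_zero : ∀ (U : Set carrier) (f : carrier → ℂ), IsOpen U → RegularOn U f →
    IsOpen (U ∩ {x | f x ≠ 0})
  inv : ∀ (U : Set carrier) (f : carrier → ℂ), IsOpen U → RegularOn U f →
    (∀ x ∈ U, f x ≠ 0) → RegularOn U (fun x => (f x)⁻¹)

instance (X : FunSpace) : TopologicalSpace X.carrier := X.top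

/-- The quotient of a space with functions by (the equivalence relation generated by) `r`: quotient
topology, and a function is regular when its composition with the quotient map is. -/
def FunSpace.quot (X : FunSpace) (r : X.carrier → X.carrier → Prop) : FunSpace where
  carrier := Quot r
  top := TopologicalSpace.coinduced (Quot.mk r) X.top
  RegularOn U f := X.RegularOn (Quot.mk r ⁻¹' U) (fun x => f (Quot.mk r x))
  const U c hU := X.const _ c hU
  add U f g hU hf hg := X.add _ _ _ hU hf hg
  mul U f g hU hf hg := X.mul _ _ _ hU hf hg
  congr U f g hU hf h := X.congr _ _ _ hU hf (fun x hx => h _ hx)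
  mono U V f hU hV h hf := X.mono _ _ _ hU hV (fun x hx => h hx) hf
  glue U f hU h := X.glue _ _ hU (fun x hx => by
    obtain ⟨V, hV, hxV, hVU, hf⟩ := h (Quot.mk r x) hx
    exact ⟨Quot.mk r ⁻¹' V, hV, hxV, fun y hy => hVU hy, hf⟩)
  isOpen_ne_zero U f hU hf := X.isOpen_ne_zero _ _ hU hf
  inv U f hU hf h := X.inv _ _ hU hf (fun x hx => h _ hx)

/-- The basic Zariski open subset `P ≠ 0` of a subset `C` of affine space. -/
def basicOpen {ι : Type} (C : Set (ι → ℂ)) (P : MvPolynomial ι ℂ) : Set C :=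
  {v | eval v.1 P ≠ 0}

/-- The Zariski topology of a subset `C` of affine space. -/
@[reducible] def zariski {ι : Type} (C : Set (ι → ℂ)) : TopologicalSpace C :=
  TopologicalSpace.generateFrom (Set.range (basicOpen C))

theorem zariski_basis {ι : Type} (C : Set (ι → ℂ)) :
    @TopologicalSpace.IsTopologicalBasis C (zariski C) (Set.range (basicOpen C)) := by
  let _ := zariski C
  refine ⟨?_, ?_, rfl⟩
  · rintro _ ⟨P, rfl⟩ _ ⟨Q, rfl⟩ x hx
    refine ⟨_, ⟨P * Q, rfl⟩, ?_, ?_⟩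
    · simpa [basicOpen] using hx
    · intro y hy
      simpa [basicOpen] using hy
  · refine Set.eq_univ_of_forall fun x => ?_
    exact ⟨_, ⟨1, rfl⟩, by simp [basicOpen]⟩

theorem exists_basicOpen {ι : Type} {C : Set (ι → ℂ)} {U : Set C} (hU : @IsOpen C (zariski C) U)
    {x : C} (hx : x ∈ U) : ∃ H : MvPolynomial ι ℂ, x ∈ basicOpen C H ∧ basicOpen C H ⊆ U := by
  let _ := zariski C
  obtain ⟨_, ⟨H, rfl⟩, h1, h2⟩ := (zariski_basis C).exists_subset_of_mem_open hx hU
  exact ⟨H, h1, h2⟩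

theorem isOpen_basicOpen {ι : Type} (C : Set (ι → ℂ)) (P : MvPolynomial ι ℂ) :
    @IsOpen C (zariski C) (basicOpen C P) := by
  let _ := zariski C
  exact TopologicalSpace.isOpen_generateFrom_of_mem ⟨P, rfl⟩

/-- A subset `C` of affine space as a space with functions (used for locally closed `C` only):
Zariski topology, and regular functions are those which are locally quotients of polynomials. -/
def affine {ι : Type} (C : Set (ι → ℂ)) : FunSpace where
  carrier := C
  top := zariski C
  RegularOn U f := ∀ x ∈ U, ∃ P Q : MvPolynomial ι ℂ, eval x.1 Q ≠ 0 ∧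
    ∀ y ∈ U, eval y.1 Q ≠ 0 → f y = eval y.1 P / eval y.1 Q
  const U c _ x _ := ⟨MvPolynomial.C c, 1, by simp, by simp⟩
  add U f g _ hf hg x hx := by
    obtain ⟨P, Q, hQ, h⟩ := hf x hx
    obtain ⟨P', Q', hQ', h'⟩ := hg x hx
    refine ⟨P * Q' + Q * P', Q * Q', by simp [hQ, hQ'], fun y hy hne => ?_⟩
    rw [map_mul] at hne
    have h1 := left_ne_zero_of_mul hne
    have h2 := right_ne_zero_of_mul hne
    simp only [map_add, map_mul]
    rw [h y hy h1, h' y hy h2, div_add_div _ _ h1 h2]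
  mul U f g _ hf hg x hx := by
    obtain ⟨P, Q, hQ, h⟩ := hf x hx
    obtain ⟨P', Q', hQ', h'⟩ := hg x hx
    refine ⟨P * P', Q * Q', by simp [hQ, hQ'], fun y hy hne => ?_⟩
    rw [map_mul] at hne
    have h1 := left_ne_zero_of_mul hne
    have h2 := right_ne_zero_of_mul hne
    simp only [map_mul]
    rw [h y hy h1, h' y hy h2, div_mul_div_comm]
  congr U f g _ hf hfg x hx := by
    obtain ⟨P, Q, hQ, h⟩ := hf x hx
    exact ⟨P, Q, hQ, fun y hy hne => (hfg y hy).symm.trans (h y hy hne)⟩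
  mono U V f _ _ hVU hf x hx := by
    obtain ⟨P, Q, hQ, h⟩ := hf x (hVU hx)
    exact ⟨P, Q, hQ, fun y hy hne => h y (hVU hy) hne⟩
  glue U f _ h x hx := by
    obtain ⟨V, hV, hxV, _, hf⟩ := h x hx
    obtain ⟨P, Q, hQ, h'⟩ := hf x hxV
    obtain ⟨H, hxH, hHV⟩ := exists_basicOpen hV hxV
    have hxH' : eval x.1 H ≠ 0 := hxH
    refine ⟨P * H, Q * H, by simp [hQ, hxH'], fun y _ hne => ?_⟩
    rw [map_mul] at hne
    have h1 := left_ne_zero_of_mul hne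
    have h2 := right_ne_zero_of_mul hne
    rw [h' y (hHV h2) h1, map_mul, map_mul, mul_div_mul_right _ _ h2]
  isOpen_ne_zero U f hU hf := by
    let _ := zariski C
    rw [isOpen_iff_forall_mem_open]
    rintro x ⟨hx, hfx⟩
    obtain ⟨P, Q, hQ, h⟩ := hf x hx
    refine ⟨U ∩ basicOpen C (P * Q), ?_, hU.inter (isOpen_basicOpen C _), hx, ?_⟩
    · rintro y ⟨hy, hne⟩
      have hne' : eval y.1 P * eval y.1 Q ≠ 0 := by simpa [basicOpen] using hne
      refine ⟨hy, ?_⟩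
      change f y ≠ 0
      rw [h y hy (right_ne_zero_of_mul hne')]
      exact div_ne_zero (left_ne_zero_of_mul hne') (right_ne_zero_of_mul hne')
    · have hfx' : f x ≠ 0 := hfx
      rw [h x hx hQ] at hfx'
      have : eval x.1 P ≠ 0 := fun h0 => hfx' (by simp [h0])
      simpa [basicOpen] using ⟨this, hQ⟩
  inv U f _ hf hne x hx := by
    obtain ⟨P, Q, hQ, h⟩ := hf x hx
    have hfx := hne x hx
    rw [h x hx hQ] at hfx
    have hP : eval x.1 P ≠ 0 := fun h0 => hfx (by simp [h0])
    refine ⟨Q * Q, P * Q, by simp [hP, hQ], fun y hy hy' => ?_⟩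
    rw [map_mul] at hy'
    have h1 := left_ne_zero_of_mul hy'
    have h2 := right_ne_zero_of_mul hy'
    simp only [map_mul]
    rw [h y hy h2, inv_div, mul_div_mul_right _ _ h2]

/-! ### Rational functions, rational maps and foliations -/

/-- The filter generated by the dense open subsets. -/
def FunSpace.generic (X : FunSpace) : Filter X.carrier where
  sets := {s | ∃ U : Set X.carrier, IsOpen U ∧ Dense U ∧ U ⊆ s}
  univ_sets := ⟨Set.univ, isOpen_univ, dense_univ, fun _ h => h⟩
  sets_of_superset := fun ⟨U, h1, h2, h3⟩ h => ⟨U, h1, h2, h3.trans h⟩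
  inter_sets := fun ⟨U, h1, h2, h3⟩ ⟨V, k1, k2, k3⟩ =>
    ⟨U ∩ V, h1.inter k1, h2.inter_of_isOpen_left k2 h1, Set.inter_subset_inter h3 k3⟩

noncomputable instance (X : FunSpace) : Algebra ℂ (X.generic.Germ ℂ) :=
  Algebra.ofModule
    (fun r x y => by
      induction x using Filter.Germ.inductionOn with | _ f =>
      induction y using Filter.Germ.inductionOn with | _ g =>
      exact congrArg _ (_root_.funext fun a => by simp [mul_assoc]))
    (fun r x y => by
      induction x using Filter.Germ.inductionOn with | _ f =>
      induction y using Filter.Germ.inductionOn with | _ g =>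
      exact congrArg _ (_root_.funext fun a => by simp [mul_left_comm]))

/-- The algebra of rational functions of `X`: germs, along the dense open sets, of functions which
are regular on some dense open set. -/
noncomputable def FunSpace.ratFun (X : FunSpace) : Subalgebra ℂ (X.generic.Germ ℂ) where
  carrier := {g | ∃ (U : Set X.carrier) (f : X.carrier → ℂ), IsOpen U ∧ Dense U ∧
    X.RegularOn U f ∧ g = (f : X.generic.Germ ℂ)}
  mul_mem' := by
    rintro _ _ ⟨U, f, h1, h2, h3, rfl⟩ ⟨V, g, k1, k2, k3, rfl⟩
    have hUV := h1.inter k1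
    exact ⟨U ∩ V, _, hUV, h2.inter_of_isOpen_left k2 h1,
      X.mul _ f g hUV (X.mono U _ f h1 hUV Set.inter_subset_left h3)
        (X.mono V _ g k1 hUV Set.inter_subset_right k3), rfl⟩
  add_mem' := by
    rintro _ _ ⟨U, f, h1, h2, h3, rfl⟩ ⟨V, g, k1, k2, k3, rfl⟩
    have hUV := h1.inter k1
    exact ⟨U ∩ V, _, hUV, h2.inter_of_isOpen_left k2 h1,
      X.add _ f g hUV (X.mono U _ f h1 hUV Set.inter_subset_left h3)
        (X.mono V _ g k1 hUV Set.inter_subset_right k3), rfl⟩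
  algebraMap_mem' := fun c => ⟨Set.univ, fun _ => c, isOpen_univ, dense_univ,
    X.const _ c isOpen_univ, congrArg _ (_root_.funext fun a => by simp)⟩

/-- The function given by a polynomial in the coordinates. -/
noncomputable def polyVal {ι : Type} (C : Set (ι → ℂ)) (P : MvPolynomial ι ℂ) :
    (affine C).carrier → ℂ := fun v => eval v.1 P

/-- The rational function given by a polynomial in the coordinates. -/
noncomputable def polyFun {ι : Type} (C : Set (ι → ℂ)) (P : MvPolynomial ι ℂ) :
    (affine C).ratFun :=
  ⟨(polyVal C P : (affine C).generic.Germ ℂ), Set.univ, polyVal C P, isOpen_univ, dense_univ,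
    fun _ _ => ⟨P, 1, by simp, fun _ _ _ => by simp [polyVal]⟩, rfl⟩

/-- Rational vector fields. -/
abbrev VectorField (X : FunSpace) : Type := Derivation ℂ X.ratFun X.ratFun

/-- `F` is a (singular) foliation by curves on `X`: it is given by a nonzero rational vector field,
up to multiplication by rational functions. We represent a foliation by the set of all the rational
vector fields which are tangent to it. -/
def IsFoliation {X : FunSpace} (F : Set (VectorField X)) : Prop :=
  ∃ δ : VectorField X, δ ≠ 0 ∧ F = {δ' | ∃ h : X.ratFun, δ' = h • δ}

/-- A dominant rational map: a map which is regular on the dense open set `dom` (its values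
elsewhere are irrelevant), and for which the preimage of a dense open set is dense. -/
structure DominantMap (X Y : FunSpace) where
  toFun : X.carrier → Y.carrier
  dom : Set X.carrier
  isOpen_dom : IsOpen dom
  dense_dom : Dense dom
  isOpen_preimage : ∀ V : Set Y.carrier, IsOpen V → IsOpen (dom ∩ toFun ⁻¹' V)
  regular : ∀ (V : Set Y.carrier) (f : Y.carrier → ℂ), IsOpen V → Y.RegularOn V f →
    X.RegularOn (dom ∩ toFun ⁻¹' V) (fun x => f (toFun x))
  dominant : ∀ V : Set Y.carrier, IsOpen V → Dense V → Dense (dom ∩ toFun ⁻¹' V)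

/-- A birational map, with its inverse. -/
structure BirationalMap (X Y : FunSpace) extends DominantMap X Y where
  inverse : DominantMap Y X
  left_inv : ∀ᶠ x in X.generic, inverse.toFun (toFun x) = x
  right_inv : ∀ᶠ y in Y.generic, toFun (inverse.toFun y) = y

/-- `g'` is the pull-back of the rational function `g` by `φ`. -/
def IsPullback {X Y : FunSpace} (φ : X.carrier → Y.carrier) (g : Y.ratFun) (g' : X.ratFun) : Prop :=
  ∃ f : Y.carrier → ℂ, (g : Y.generic.Germ ℂ) = (f : Y.generic.Germ ℂ) ∧
    (g' : X.generic.Germ ℂ) = ((fun x => f (φ x) : X.carrier → ℂ) : X.generic.Germ ℂ)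

/-- The vector fields `δ'` on `X` and `δ` on `Y` are related by `φ`, that is, `φ_* δ' = δ`. -/
def Related {X Y : FunSpace} (φ : X.carrier → Y.carrier) (δ' : VectorField X)
    (δ : VectorField Y) : Prop :=
  ∀ (g : Y.ratFun) (g' : X.ratFun), IsPullback φ g g' → IsPullback φ (δ g) (δ' g')

/-- The vector fields on `Y` which are images under `φ` of vector fields in `F`. This gives the
foliation induced by `F` on a quotient, and the image of a foliation by a birational map. -/
def push {X Y : FunSpace} (φ : X.carrier → Y.carrier) (F : Set (VectorField X)) :
    Set (VectorField Y) :=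
  {δ | ∃ δ' ∈ F, Related φ δ' δ}

/-- The foliation induced by `G` on `X` through a birational `φ` (strict transform). -/
def pull {X Y : FunSpace} (φ : X.carrier → Y.carrier) (G : Set (VectorField Y)) :
    Set (VectorField X) :=
  {δ' | ∃ δ ∈ G, Related φ δ' δ}

/-- Birational equivalence of foliations. -/
def BirationallyEquivalent {X Y : FunSpace} (F : Set (VectorField X)) (G : Set (VectorField Y)) :
    Prop :=
  IsFoliation F ∧ IsFoliation G ∧ ∃ φ : BirationalMap X Y, push φ.toFun F = G

/-- The rational vector fields on `C` that are multiples of the field `∑ Vᵢ ∂/∂xᵢ`, tangent to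
`C`. -/
def lineField {ι : Type} (C : Set (ι → ℂ)) (V : ι → MvPolynomial ι ℂ) :
    Set (VectorField (affine C)) :=
  {δ | ∃ h : (affine C).ratFun, ∀ i, δ (polyFun C (MvPolynomial.X i)) = h * polyFun C (V i)}

/-- The rational vector fields on `C` annihilated by the form `∑ Aᵢ dxᵢ`. -/
def kerForm {ι : Type} [Fintype ι] (C : Set (ι → ℂ)) (A : ι → MvPolynomial ι ℂ) :
    Set (VectorField (affine C)) :=
  {δ | ∑ i, polyFun C (A i) * δ (polyFun C (MvPolynomial.X i)) = 0}

/-! ### Weighted projective planes and the Chazy foliations -/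

/-- Weighted homotheties. -/
def wscale {n : ℕ} (w : Fin n → ℕ) (t : ℂ) (v : Fin n → ℂ) : Fin n → ℂ := fun i => t ^ w i * v i

/-- The punctured affine space. -/
def punctured (n : ℕ) : Set (Fin n → ℂ) := {v | v ≠ 0}

/-- Weighted projective space. -/
def wproj {n : ℕ} (w : Fin n → ℕ) : FunSpace :=
  (affine (punctured n)).quot (fun a b => ∃ t : ℂ, t ≠ 0 ∧ b.1 = wscale w t a.1)

/-- The point of weighted projective space with given homogeneous coordinates. -/
def wproj.mk {n : ℕ} (w : Fin n → ℕ) (v : (affine (punctured n)).carrier) : (wproj w).carrier :=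
  Quot.mk _ v

/-- The weighted projective plane `ℙ(1,2,3)`. -/
abbrev P123 : FunSpace := wproj ![1, 2, 3]

/-- The projective plane `ℙ²`. -/
abbrev P2 : FunSpace := wproj ![1, 1, 1]

/-- The right-hand side `P(x,y,z)` of the Chazy IV equation `x''' = P(x,x',x'')`. -/
noncomputable def chazyIV : MvPolynomial (Fin 3) ℂ :=
  3 * X 0 * X 2 + 3 * X 1 ^ 2 - 3 * X 0 ^ 2 * X 1

/-- The right-hand side of the Chazy V equation. -/
noncomputable def chazyV : MvPolynomial (Fin 3) ℂ :=
  2 * X 0 * X 2 + 4 * X 1 ^ 2 - 2 * X 0 ^ 2 * X 1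

/-- The right-hand side of the Chazy VI equation. -/
noncomputable def chazyVI : MvPolynomial (Fin 3) ℂ :=
  X 0 * X 2 + 5 * X 1 ^ 2 - X 0 ^ 2 * X 1

/-- The components of the vector field `W = y ∂/∂x + z ∂/∂y + P ∂/∂z` of `x''' = P(x,x',x'')`. -/
noncomputable def odeField (P : MvPolynomial (Fin 3) ℂ) : Fin 3 → MvPolynomial (Fin 3) ℂ :=
  ![X 1, X 2, P]

/-- The foliation on `ℙ(1,2,3)` induced by the equation `x''' = P(x,x',x'')`. -/
def chazyFoliation (P : MvPolynomial (Fin 3) ℂ) : Set (VectorField P123) :=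
  push (wproj.mk ![1, 2, 3]) (lineField (punctured 3) (odeField P))

/-- The first integral of the Chazy IV equation. -/
noncomputable def integralIV : MvPolynomial (Fin 3) ℂ := X 0 ^ 3 - 3 * X 0 * X 1 + X 2

/-- The first integral of the Chazy V equation. -/
noncomputable def integralV : MvPolynomial (Fin 3) ℂ :=
  X 0 ^ 4 - 4 * X 0 ^ 2 * X 1 + 2 * X 2 * X 0 - X 1 ^ 2

/-- The first integral of the Chazy VI equation. -/
noncomputable def integralVI : MvPolynomial (Fin 3) ℂ :=
  X 0 ^ 6 - 6 * X 0 ^ 4 * X 1 + 6 * X 2 * X 0 ^ 3 - 15 * X 0 ^ 2 * X 1 ^ 2 + 6 * X 0 * X 1 * X 2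
    + 8 * X 1 ^ 3 - 3 * X 2 ^ 2

/-- The level set `B = 1`. -/
def level (B : MvPolynomial (Fin 3) ℂ) : Set (Fin 3 → ℂ) := {v | eval v B = 1}

/-! ### The special quotient foliations -/

/-- The quotient of `S` by the group generated by the transformation `T` (of finite order). -/
def cyclicQuot (S : FunSpace) (T : S.carrier → S.carrier) : FunSpace := S.quot (fun a b => b = T a)

/-- The quotient map. -/
def cyclicQuot.mk (S : FunSpace) (T : S.carrier → S.carrier) (p : S.carrier) :
    (cyclicQuot S T).carrier :=
  Quot.mk _ p

/-- The foliation on `ℙ²` given by `ω² YZ dX + ω XZ dY + XY dZ = 0`. -/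
def E3 (ω : ℂ) : Set (VectorField P2) :=
  push (wproj.mk ![1, 1, 1])
    (kerForm (punctured 3) ![C (ω ^ 2) * X 1 * X 2, C ω * X 0 * X 2, X 0 * X 1])

/-- The transformation `(X : Y : Z) ↦ (Z : X : Y)`. -/
def T3 : P2.carrier → P2.carrier :=
  Quot.map
    (fun a => ⟨![a.1 2, a.1 0, a.1 1], fun h => a.2 (by
      funext i
      fin_cases i
      · simpa using congrFun h 1
      · simpa using congrFun h 2
      · simpa using congrFun h 0)⟩)
    (by
      rintro a b ⟨t, ht, h⟩
      refine ⟨t, ht, ?_⟩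
      funext i
      fin_cases i <;> simp [h, wscale])

/-- Brunella's very special foliation, on the quotient of `ℙ²`. -/
def F3 (ω : ℂ) : Set (VectorField (cyclicQuot P2 T3)) := push (cyclicQuot.mk P2 T3) (E3 ω)

/-- The pairs of nonzero vectors of `ℂᵏ`; the first one has coordinates indexed by `(0, i)`, and the
second one by `(1, i)`. -/
def pairs (k : ℕ) : Set (Fin 2 × Fin k → ℂ) := {v | ∀ j, ∃ i, v (j, i) ≠ 0}

/-- The quotient of a subset `C` of pairs of nonzero vectors of `ℂᵏ` by the independent homotheties
of the two vectors. -/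
def biproj {k : ℕ} (C : Set (Fin 2 × Fin k → ℂ)) : FunSpace :=
  (affine C).quot (fun a b => ∃ t : Fin 2 → ℂ, (∀ j, t j ≠ 0) ∧ ∀ j i, b.1 (j, i) = t j * a.1 (j, i))

/-- The point with given bihomogeneous coordinates. -/
def biproj.mk {k : ℕ} (C : Set (Fin 2 × Fin k → ℂ)) (v : (affine C).carrier) : (biproj C).carrier :=
  Quot.mk _ v

/-- The surface `ℙ¹ × ℙ¹`. -/
abbrev P1P1 : FunSpace := biproj (pairs 2)

/-- The foliation on `ℙ¹ × ℙ¹` given by `Y dX - i X dY = 0` in the affine coordinates `X = X₀/X₁`,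
`Y = Y₀/Y₁`, that is, by `Y₀ Y₁ (X₁ dX₀ - X₀ dX₁) - i X₀ X₁ (Y₁ dY₀ - Y₀ dY₁) = 0`. -/
def E4 : Set (VectorField P1P1) :=
  push (biproj.mk (pairs 2)) (kerForm (pairs 2) (fun a =>
    if a = (0, 0) then X (1, 0) * X (1, 1) * X (0, 1)
    else if a = (0, 1) then - (X (1, 0) * X (1, 1) * X (0, 0))
    else if a = (1, 0) then - (C Complex.I * X (0, 0) * X (0, 1) * X (1, 1))
    else C Complex.I * X (0, 0) * X (0, 1) * X (1, 0)))

/-- The transformation `(X₀ : X₁, Y₀ : Y₁) ↦ (Y₀ : Y₁, X₁ : X₀)`. -/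
def T4 : P1P1.carrier → P1P1.carrier :=
  Quot.map
    (fun v => ⟨fun a => if a.1 = 0 then v.1 (1, a.2) else v.1 (0, a.2.rev), fun j => by
      obtain ⟨i, hi⟩ := v.2 (1 - j)
      fin_cases j
      · exact ⟨i, by simpa using hi⟩
      · exact ⟨i.rev, by simpa using hi⟩⟩)
    (by
      rintro a b ⟨t, ht, h⟩
      refine ⟨fun j => t (1 - j), fun j => ht _, fun j i => ?_⟩
      fin_cases j <;> simp [h])

/-- Santos's foliation `F₄`, on the quotient of `ℙ¹ × ℙ¹`. -/
def F4 : Set (VectorField (cyclicQuot P1P1 T4)) := push (cyclicQuot.mk P1P1 T4) E4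

/-- The bihomogeneous coordinates of the points of the surface in `ℙ² × ℙ²` with equations
`X X' = Y Y' = Z Z'`. -/
def blCone : Set (Fin 2 × Fin 3 → ℂ) :=
  {v | v ∈ pairs 3 ∧ ∀ i i', v (0, i) * v (1, i) = v (0, i') * v (1, i')}

/-- The blow-up of `ℙ²` at the three vertices of the coordinate triangle, as the closure in
`ℙ² × ℙ²` of the graph of the standard Cremona involution. -/
abbrev Bl3 : FunSpace := biproj blCone

/-- The blow-down `Bl₃ → ℙ²`. -/
def blowDown : Bl3.carrier → P2.carrier :=
  Quot.map
    (fun v => ⟨fun i => v.1 (0, i), fun h => by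
      obtain ⟨i, hi⟩ := v.2.1 0
      exact hi (congrFun h i)⟩)
    (by
      rintro a b ⟨t, ht, h⟩
      refine ⟨t 0, ht 0, ?_⟩
      funext i
      fin_cases i <;> simp [h, wscale])

/-- The strict transform of `E3` in the blow-up. -/
def E6 (ω : ℂ) : Set (VectorField Bl3) := pull blowDown (E3 ω)

/-- The automorphism of `Bl₃` induced by the composition of `T3` with the standard Cremona
involution: `(p, q) ↦ (T3 q, T3 p)`. -/
def T6 : Bl3.carrier → Bl3.carrier :=
  Quot.map
    (fun v => ⟨fun a => v.1 (1 - a.1, a.2 - 1), fun j => by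
        obtain ⟨i, hi⟩ := v.2.1 (1 - j)
        exact ⟨i + 1, by simpa using hi⟩,
      fun i i' => by
        have h := v.2.2 (i - 1) (i' - 1)
        simpa [mul_comm] using h⟩)
    (by
      rintro a b ⟨t, ht, h⟩
      exact ⟨fun j => t (1 - j), fun j => ht _, fun j i => h _ _⟩)

/-- Santos's foliation `F₆`, on the quotient of `Bl₃`. -/
def F6 (ω : ℂ) : Set (VectorField (cyclicQuot Bl3 T6)) := push (cyclicQuot.mk Bl3 T6) (E6 ω)

/-! ### The equivariant maps -/

/-- The point `(x : y : 1)` of `ℙ²`. -/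
def ptP2 (x y : ℂ) : P2.carrier :=
  wproj.mk _ ⟨![x, y, 1], fun h => one_ne_zero (congrFun h 2)⟩

/-- The point `(x : 1, y : 1)` of `ℙ¹ × ℙ¹`. -/
def ptP1P1 (x y : ℂ) : P1P1.carrier :=
  biproj.mk _ ⟨fun a => if a.2 = 0 then ![x, y] a.1 else 1, fun j => ⟨1, by simp⟩⟩

/-- The point of `Bl₃` above the point `(x : y : 1)` of `ℙ²`, for nonzero `x` and `y`. -/
def ptBl3 (x y : ℂ) (hx : x ≠ 0) (hy : y ≠ 0) : Bl3.carrier :=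
  biproj.mk _ ⟨fun a => ![![x, y, 1], ![y, x, x * y]] a.1 a.2,
    fun j => by
      fin_cases j
      · exact ⟨0, by simpa using hx⟩
      · exact ⟨0, by simpa using hy⟩,
    fun i i' => by
      fin_cases i <;> fin_cases i' <;> simp [mul_comm]⟩

/-- The derivation `c (α x ∂/∂x + β y ∂/∂y)` on functions of two variables. -/
noncomputable def linD (c α β : ℂ) (f : ℂ → ℂ → ℂ) : ℂ → ℂ → ℂ := fun x y =>
  c * (α * x * deriv (fun s => f s y) x + β * y * deriv (fun s => f x s) y)

/-- The vector `(f, D f, D² f)` for `D = c (α x ∂/∂x + β y ∂/∂y)`. -/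
noncomputable def jet (c α β : ℂ) (f : ℂ → ℂ → ℂ) (x y : ℂ) : Fin 3 → ℂ :=
  ![f x y, linD c α β f x y, linD c α β (linD c α β f) x y]

/-- The function on `ℙ²` used for Chazy IV. -/
noncomputable def f3 (ω x y : ℂ) : ℂ :=
  -((ω + 1) * (ω ^ 2 * y + ω * x + 1)) / (ω ^ 2 * y + x + ω)

/-- The function on `ℙ¹ × ℙ¹` used for Chazy V. -/
noncomputable def f4 (x y : ℂ) : ℂ :=
  (x - 1) * (y - 1) / (x * y + Complex.I * x - Complex.I * y - 1)

/-- The function on `ℙ²` used for Chazy VI. -/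
noncomputable def f6 (ω x y : ℂ) : ℂ :=
  (x * (1 - y ^ 2) - ω ^ 2 * y * (1 - x ^ 2) + ω * (y ^ 2 - x ^ 2)) /
    (x + y + x ^ 2 + y ^ 2 + x ^ 2 * y + x * y ^ 2 - 6 * x * y)

/-- The birational map `Φ` from `S` to the level set `Σ : B = 1` maps the foliation `E` to the
foliation induced on `Σ` by the equation `x''' = P(x,x',x'')`; it is equivariant with respect to the
actions of the cyclic groups generated by `T` and by the weighted homothety of ratio `ζ`; and it
induces a birational map `Ψ` from the quotient of `S` to `ℙ(1,2,3)`, which maps the foliation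
induced by `E` to the one induced by the equation. -/
def InducesEquivalence {S : FunSpace} (T : S.carrier → S.carrier) (E : Set (VectorField S))
    (P B : MvPolynomial (Fin 3) ℂ) (ζ : ℂ) (Φ : BirationalMap S (affine (level B))) : Prop :=
  push Φ.toFun E = lineField (level B) (odeField P) ∧
  (∀ᶠ p in S.generic, (Φ.toFun (T p)).1 = wscale ![1, 2, 3] ζ (Φ.toFun p).1) ∧
  ∃ Ψ : BirationalMap (cyclicQuot S T) P123,
    (∀ᶠ p in S.generic, ∃ h : (Φ.toFun p).1 ≠ 0,
      Ψ.toFun (cyclicQuot.mk S T p) = wproj.mk ![1, 2, 3] ⟨(Φ.toFun p).1, h⟩) ∧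
    push Ψ.toFun (push (cyclicQuot.mk S T) E) = chazyFoliation P

end ChazyLinks

open ChazyLinks

/-! The three equations are members of one family. With q = y - x² and a = z - 3xy + x³ they become
x' = q + x², q' = a + xq, a' = κ(q² - ax), where κ = 0, 1, 2 for IV, V, VI, and the first integrals
become a, 2ax - q² and 8q³ - 12axq - 3a². In the coordinates x, q, a the level sets are therefore a
plane, a quadric and a cubic surface. The variables x, q, a have weights 1, 2, 3.

The map Φ is written as (Δ : N : Q : A) with x = N/Δ, q = Q/Δ, a = A/Δ. The entries are linear forms
on ℙ², forms of bidegree (1,1) on ℙ¹ × ℙ¹, and cubic forms through the vertices of the triangle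
(with A = Δ in the first case). All that concerns Φ reduces to polynomial identities. The
differential system and the first integral are `isSolution_shearJet`. The inverse of Φ is a pair of
quotients of affine forms in x, q, a (`exists_birationalMap`); for the quadric and the cubic these
are pencils of planes through lines of the surface. The automorphism T multiplies (Δ, N, Q, A) by
μ·(1, ζ, ζ², ζ³), which is the equivariance (`eval_shearJet_smul`).

To pass to the quotients, note that `W` raises weights by one, so that `x⁻¹ W` descends to ℙ(1,2,3)
and generates the Chazy foliation there (`chazyFoliation_eq_line`). The projection of Σ to ℙ(1,2,3)
has image B ≠ 0 and its fibres are the orbits of the n-th roots of unity, so Σ modulo these roots is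
birational to ℙ(1,2,3) (`exists_level_quot_birational`). An equivariant birational map descends to
the quotients (`exists_quot_birational`), and `inducesEquivalence` assembles these facts. Any other
model of S/T is reached by composing with a birational map.

Foliations are handled through function fields. On an irreducible space the rational functions form
a field, a vector field is a derivation of it, and a foliation is the line spanned by one
derivation. On a subset of affine space a derivation is determined by its values on the coordinates,
so equalities of foliations are checked on coordinates in an affine chart. This is why
irreducibility of the cones and of the level sets has to be proved. -/

namespace ChazyLinks

open MvPolynomial

/-! ### Morphisms of spaces with functions -/

/-- `φ` restricts to a morphism of spaces with functions on the open set `U`. -/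
structure IsMorphismOn {X Y : FunSpace} (U : Set X.carrier) (φ : X.carrier → Y.carrier) :
    Prop where
  isOpen : IsOpen U
  isOpen_preimage : ∀ V : Set Y.carrier, IsOpen V → IsOpen (U ∩ φ ⁻¹' V)
  regular : ∀ (V : Set Y.carrier) (f : Y.carrier → ℂ), IsOpen V → Y.RegularOn V f →
    X.RegularOn (U ∩ φ ⁻¹' V) (fun x => f (φ x))

namespace IsMorphismOn

variable {X Y Z : FunSpace} {U : Set X.carrier} {φ : X.carrier → Y.carrier}

theorem mono (h : IsMorphismOn U φ) {U' : Set X.carrier} (hU' : IsOpen U') (hsub : U' ⊆ U) :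
    IsMorphismOn U' φ where
  isOpen := hU'
  isOpen_preimage V hV := by
    have : U' ∩ φ ⁻¹' V = U' ∩ (U ∩ φ ⁻¹' V) := by
      rw [← Set.inter_assoc, Set.inter_eq_left.2 hsub]
    rw [this]
    exact hU'.inter (h.isOpen_preimage V hV)
  regular V f hV hf := by
    have e : U' ∩ φ ⁻¹' V = U' ∩ (U ∩ φ ⁻¹' V) := by
      rw [← Set.inter_assoc, Set.inter_eq_left.2 hsub]
    refine X.mono _ _ _ (h.isOpen_preimage V hV) ?_ ?_ (h.regular V f hV hf)
    · rw [e]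
      exact hU'.inter (h.isOpen_preimage V hV)
    · exact Set.inter_subset_inter_left _ hsub

theorem congr (h : IsMorphismOn U φ) {ψ : X.carrier → Y.carrier} (hψ : ∀ x ∈ U, φ x = ψ x) :
    IsMorphismOn U ψ := by
  have e : ∀ V : Set Y.carrier, U ∩ φ ⁻¹' V = U ∩ ψ ⁻¹' V := fun V => by
    ext x
    constructor
    · rintro ⟨hx, hV⟩
      exact ⟨hx, by simpa [← hψ x hx] using hV⟩
    · rintro ⟨hx, hV⟩
      exact ⟨hx, by simpa [hψ x hx] using hV⟩
  refine ⟨h.isOpen, fun V hV => e V ▸ h.isOpen_preimage V hV, fun V f hV hf => ?_⟩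
  refine X.congr _ _ _ (e V ▸ h.isOpen_preimage V hV) (e V ▸ h.regular V f hV hf) ?_
  rintro x ⟨hx, -⟩
  rw [hψ x hx]

theorem comp (h : IsMorphismOn U φ) {V : Set Y.carrier} {ψ : Y.carrier → Z.carrier}
    (hψ : IsMorphismOn V ψ) : IsMorphismOn (U ∩ φ ⁻¹' V) (fun x => ψ (φ x)) where
  isOpen := h.isOpen_preimage V hψ.isOpen
  isOpen_preimage W hW := by
    have := h.isOpen_preimage _ (hψ.isOpen_preimage W hW)
    rwa [Set.preimage_inter, ← Set.inter_assoc] at this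
  regular W f hW hf := by
    have := h.regular _ _ (hψ.isOpen_preimage W hW) (hψ.regular W f hW hf)
    rwa [Set.preimage_inter, ← Set.inter_assoc] at this

theorem comp_of_univ (h : IsMorphismOn U φ) {ψ : Y.carrier → Z.carrier}
    (hψ : IsMorphismOn Set.univ ψ) : IsMorphismOn U (fun x => ψ (φ x)) := by
  simpa using h.comp hψ

theorem continuous {φ : X.carrier → Y.carrier} (h : IsMorphismOn Set.univ φ) : Continuous φ :=
  ⟨fun V hV => by simpa using h.isOpen_preimage V hV⟩

end IsMorphismOn

theorem DominantMap.isMorphismOn {X Y : FunSpace} (φ : DominantMap X Y) :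
    IsMorphismOn φ.dom φ.toFun :=
  ⟨φ.isOpen_dom, φ.isOpen_preimage, φ.regular⟩

theorem isMorphismOn_quot_mk (X : FunSpace) (r : X.carrier → X.carrier → Prop) :
    IsMorphismOn (Y := X.quot r) Set.univ (Quot.mk r) where
  isOpen := isOpen_univ
  isOpen_preimage V hV := by
    rw [Set.univ_inter]
    exact hV
  regular V f _ hf := by
    rw [Set.univ_inter]
    exact hf

theorem isMorphismOn_quot_desc {X Y : FunSpace} {r : X.carrier → X.carrier → Prop}
    {U : Set (X.quot r).carrier} {φ : (X.quot r).carrier → Y.carrier}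
    (h : IsMorphismOn (X := X) (Quot.mk r ⁻¹' U) (fun x => φ (Quot.mk r x))) :
    IsMorphismOn U φ where
  isOpen := h.isOpen
  isOpen_preimage V hV := h.isOpen_preimage V hV
  regular V f hV hf := h.regular V f hV hf

/-- Polynomials in regular functions are regular, and so are their quotients where the denominator
does not vanish. Open sets and regular functions of an affine target are locally made of these, so
only the coordinates need checking. -/
theorem isMorphismOn_affine {X : FunSpace} {ι : Type} {C : Set (ι → ℂ)} {U : Set X.carrier}
    (hU : IsOpen U) {φ : X.carrier → (affine C).carrier}
    (h : ∀ i, X.RegularOn U (fun x => (φ x).1 i)) : IsMorphismOn U φ := by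
  have hP : ∀ P : MvPolynomial ι ℂ, X.RegularOn U (fun x => eval (φ x).1 P) := by
    intro P
    induction P using MvPolynomial.induction_on with
    | C a => simpa using X.const U a hU
    | add p q hp hq => simpa using X.add U _ _ hU hp hq
    | mul_X p i hp => simpa using X.mul U _ _ hU hp (h i)
  have hopen : ∀ V : Set (affine C).carrier, IsOpen V → IsOpen (U ∩ φ ⁻¹' V) := by
    intro V hV
    rw [isOpen_iff_forall_mem_open]
    rintro x ⟨hx, hxV⟩
    obtain ⟨H, h1, h2⟩ := exists_basicOpen hV hxV
    refine ⟨U ∩ {x | eval (φ x).1 H ≠ 0}, ?_, X.isOpen_ne_zero U _ hU (hP H), hx, h1⟩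
    rintro y ⟨hy, hyH⟩
    exact ⟨hy, h2 hyH⟩
  refine ⟨hU, hopen, fun V f hV hf => X.glue _ _ (hopen V hV) ?_⟩
  rintro x ⟨hx, hxV⟩
  obtain ⟨P, Q, hQ, hPQ⟩ := hf (φ x) hxV
  have hW : IsOpen (U ∩ {x | eval (φ x).1 Q ≠ 0}) := X.isOpen_ne_zero U _ hU (hP Q)
  have hW' : IsOpen ((U ∩ φ ⁻¹' V) ∩ (U ∩ {x | eval (φ x).1 Q ≠ 0})) := (hopen V hV).inter hW
  refine ⟨_, hW', ⟨⟨hx, hxV⟩, hx, hQ⟩, Set.inter_subset_left, ?_⟩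
  refine X.congr _ (fun x => eval (φ x).1 P * (eval (φ x).1 Q)⁻¹) _ hW' ?_ ?_
  · have hsub : ((U ∩ φ ⁻¹' V) ∩ (U ∩ {x | eval (φ x).1 Q ≠ 0})) ⊆ U :=
      fun y hy => hy.1.1
    refine X.mul _ _ _ hW' (X.mono U _ _ hU hW' hsub (hP P))
      (X.inv _ _ hW' (X.mono U _ _ hU hW' hsub (hP Q)) fun y hy => hy.2.2)
  · rintro y ⟨⟨_, hyV⟩, _, hyQ⟩
    rw [hPQ (φ y) hyV hyQ, div_eq_mul_inv]

theorem regularOn_div {ι : Type} {C : Set (ι → ℂ)} {U : Set (affine C).carrier}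
    {f : (affine C).carrier → ℂ} (P Q : MvPolynomial ι ℂ)
    (h : ∀ x ∈ U, eval x.1 Q ≠ 0 ∧ f x = eval x.1 P / eval x.1 Q) : (affine C).RegularOn U f :=
  fun x hx => ⟨P, Q, (h x hx).1, fun y hy _ => (h y hy).2⟩

theorem isOpen_polyVal_ne_zero {ι : Type} (C : Set (ι → ℂ)) (P : MvPolynomial ι ℂ) :
    IsOpen {x : (affine C).carrier | eval x.1 P ≠ 0} :=
  isOpen_basicOpen C P

/-! ### Irreducible spaces -/

instance quot_irreducibleSpace (X : FunSpace) [IrreducibleSpace X.carrier]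
    (r : X.carrier → X.carrier → Prop) : IrreducibleSpace (X.quot r).carrier := by
  have hc : Continuous (Quot.mk r : X.carrier → (X.quot r).carrier) :=
    (isMorphismOn_quot_mk X r).continuous
  have hs : Function.Surjective (Quot.mk r : X.carrier → (X.quot r).carrier) := Quot.mk_surjective
  have : PreirreducibleSpace (X.quot r).carrier := by
    constructor
    have := (PreirreducibleSpace.isPreirreducible_univ (X := X.carrier)).image _ hc.continuousOn
    rwa [Set.image_univ, hs.range_eq] at this
  exact ⟨(inferInstance : Nonempty X.carrier).map (Quot.mk r)⟩

/-- The closure of the image of an irreducible space is irreducible. -/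
theorem irreducibleSpace_affine {X : FunSpace} [IrreducibleSpace X.carrier] {ι : Type}
    {C : Set (ι → ℂ)} {U : Set X.carrier} {φ : X.carrier → (affine C).carrier}
    (hφ : IsMorphismOn U φ) (hU : U.Nonempty)
    (h : ∀ p ∈ C, ∀ P : MvPolynomial ι ℂ, eval p P ≠ 0 → ∃ u ∈ U, eval (φ u).1 P ≠ 0) :
    IrreducibleSpace (affine C).carrier := by
  have hpre : ∀ V : Set (affine C).carrier, IsOpen V → V.Nonempty → (U ∩ φ ⁻¹' V).Nonempty := by
    rintro V hV ⟨p, hp⟩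
    obtain ⟨H, h1, h2⟩ := exists_basicOpen hV hp
    obtain ⟨u, hu, hu'⟩ := h p.1 p.2 H h1
    exact ⟨u, hu, h2 hu'⟩
  have : PreirreducibleSpace (affine C).carrier := by
    constructor
    rintro V W hV hW ⟨p, -, hp⟩ ⟨q, -, hq⟩
    have hV' := hpre V hV ⟨p, hp⟩
    have hW' := hpre W hW ⟨q, hq⟩
    obtain ⟨u, ⟨-, hu⟩, -, hu'⟩ := nonempty_preirreducible_inter (hφ.isOpen_preimage V hV)
      (hφ.isOpen_preimage W hW) hV' hW'
    exact ⟨φ u, Set.mem_univ _, hu, hu'⟩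
  obtain ⟨u, -⟩ := hU
  exact ⟨⟨φ u⟩⟩

theorem mem_generic_of_isOpen {X : FunSpace} [IrreducibleSpace X.carrier] {U : Set X.carrier}
    (hU : IsOpen U) (hne : U.Nonempty) : U ∈ X.generic :=
  ⟨U, hU, hU.dense hne, subset_rfl⟩

instance generic_neBot (X : FunSpace) [Nonempty X.carrier] : X.generic.NeBot := by
  constructor
  intro h
  have : (∅ : Set X.carrier) ∈ X.generic := by
    rw [h]
    trivial
  obtain ⟨U, -, hd, hsub⟩ := this
  obtain ⟨x, hx⟩ := hd.nonempty
  exact hsub hx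

/-- A subset of affine space on which only the zero polynomial vanishes, and which is nonempty. -/
theorem irreducibleSpace_of_eval_eq_zero {ι : Type} {C : Set (ι → ℂ)} (hne : C.Nonempty)
    (h : ∀ P : MvPolynomial ι ℂ, (∀ v ∈ C, eval v P = 0) → P = 0) :
    IrreducibleSpace (affine C).carrier := by
  have : PreirreducibleSpace (affine C).carrier := by
    constructor
    rintro V W hV hW ⟨p, -, hp⟩ ⟨q, -, hq⟩
    obtain ⟨H, h1, h2⟩ := exists_basicOpen hV hp
    obtain ⟨H', h1', h2'⟩ := exists_basicOpen hW hq
    have hH : H ≠ 0 := by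
      rintro rfl
      exact h1 (by simp)
    have hH' : H' ≠ 0 := by
      rintro rfl
      exact h1' (by simp)
    by_contra hcon
    refine mul_ne_zero hH hH' (h _ fun v hv => ?_)
    by_contra hv'
    rw [map_mul] at hv'
    exact hcon ⟨⟨v, hv⟩, Set.mem_univ _, h2 (left_ne_zero_of_mul hv'),
      h2' (right_ne_zero_of_mul hv')⟩
  obtain ⟨v, hv⟩ := hne
  exact ⟨⟨⟨v, hv⟩⟩⟩

/-! ### The field of rational functions -/

noncomputable instance vectorFieldSMul (X : FunSpace) : SMul X.ratFun (VectorField X) :=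
  inferInstance

section Field

variable (X : FunSpace) [IrreducibleSpace X.carrier]

/-- The inverse is pointwise. Irreducibility gives a dichotomy: the locus where a regular function
is nonzero is either dense or empty, and in the second case the germ and its inverse are both zero.
-/
noncomputable instance ratFunInv : Inv X.ratFun :=
  ⟨fun g => ⟨(g : X.generic.Germ ℂ)⁻¹, by
    obtain ⟨g, U, f, h1, h2, h3, rfl⟩ := g
    by_cases hf : (U ∩ {x | f x ≠ 0}).Nonempty
    · have ho := X.isOpen_ne_zero U f h1 h3
      exact ⟨_, fun x => (f x)⁻¹, ho, ho.dense hf,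
        X.inv _ _ ho (X.mono _ _ f h1 ho Set.inter_subset_left h3) fun x hx => hx.2, rfl⟩
    · refine ⟨U, fun _ => 0, h1, h2, X.const U 0 h1, ?_⟩
      refine Filter.Germ.coe_eq.2 ?_
      filter_upwards [(⟨U, h1, h2, subset_rfl⟩ : U ∈ X.generic)] with x hx
      by_contra hne
      exact hf ⟨x, hx, fun h0 => hne (by simp [h0])⟩⟩⟩

noncomputable instance : Field X.ratFun :=
  { (inferInstance : CommRing X.ratFun), ratFunInv X with
    exists_pair_ne := ⟨0, 1, fun h => by
      have h' : ((fun _ => 0 : X.carrier → ℂ) : X.generic.Germ ℂ) = (fun _ => 1 : X.carrier → ℂ) :=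
        congrArg Subtype.val h
      rw [Filter.Germ.coe_eq] at h'
      obtain ⟨x, hx⟩ := h'.exists
      exact zero_ne_one hx⟩
    mul_inv_cancel := by
      rintro ⟨g, U, f, h1, h2, h3, rfl⟩ hg
      have ho := X.isOpen_ne_zero U f h1 h3
      have hne : (U ∩ {x | f x ≠ 0}).Nonempty := by
        by_contra hf
        refine hg (Subtype.ext (Filter.Germ.coe_eq.2 ?_))
        filter_upwards [(⟨U, h1, h2, subset_rfl⟩ : U ∈ X.generic)] with x hx
        by_contra hne
        exact hf ⟨x, hx, hne⟩
      refine Subtype.ext (Filter.Germ.coe_eq.2 ?_)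
      filter_upwards [mem_generic_of_isOpen ho hne] with x hx
      exact mul_inv_cancel₀ hx.2
    inv_zero := Subtype.ext (Filter.Germ.coe_eq.2 (Filter.Eventually.of_forall fun x => inv_zero))
    nnqsmul := _
    nnqsmul_def := fun _ _ => rfl
    qsmul := _
    qsmul_def := fun _ _ => rfl }

end Field

/-! ### Pull-back of rational functions -/

namespace DominantMap

variable {X Y Z : FunSpace}

/-- This is the role of dominance: germs along dense open sets can be composed with `φ`. -/
theorem tendsto (φ : DominantMap X Y) : Filter.Tendsto φ.toFun X.generic Y.generic := by
  rintro s ⟨U, h1, h2, h3⟩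
  exact ⟨_, φ.isOpen_preimage U h1, φ.dominant U h1 h2, fun x hx => h3 hx.2⟩

/-- The pull-back of rational functions by a dominant rational map. -/
noncomputable def pullback (φ : DominantMap X Y) : Y.ratFun →ₐ[ℂ] X.ratFun :=
  AlgHom.mk'
    { toFun := fun g => ⟨(g : Y.generic.Germ ℂ).compTendsto φ.toFun φ.tendsto, by
        obtain ⟨g, U, f, h1, h2, h3, rfl⟩ := g
        exact ⟨_, fun x => f (φ.toFun x), φ.isOpen_preimage U h1, φ.dominant U h1 h2,
          φ.regular U f h1 h3, rfl⟩⟩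
      map_one' := rfl
      map_zero' := rfl
      map_add' := by
        rintro ⟨_, U, f, h1, h2, h3, rfl⟩ ⟨_, U', f', h1', h2', h3', rfl⟩
        rfl
      map_mul' := by
        rintro ⟨_, U, f, h1, h2, h3, rfl⟩ ⟨_, U', f', h1', h2', h3', rfl⟩
        rfl }
    (by
      rintro c ⟨_, U, f, h1, h2, h3, rfl⟩
      rfl)

theorem coe_pullback (φ : DominantMap X Y) {g : Y.ratFun} {f : Y.carrier → ℂ}
    (h : (g : Y.generic.Germ ℂ) = (f : Y.generic.Germ ℂ)) :
    (φ.pullback g : X.generic.Germ ℂ) =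
      ((fun x => f (φ.toFun x) : X.carrier → ℂ) : X.generic.Germ ℂ) := by
  change (g : Y.generic.Germ ℂ).compTendsto φ.toFun φ.tendsto = _
  rw [h]
  rfl

theorem exists_rep (g : Y.ratFun) :
    ∃ f : Y.carrier → ℂ, (g : Y.generic.Germ ℂ) = (f : Y.generic.Germ ℂ) := by
  obtain ⟨_, U, f, h1, h2, h3, rfl⟩ := g
  exact ⟨f, rfl⟩

theorem isPullback_iff_of_eventuallyEq {φ : DominantMap X Y} {φ' : X.carrier → Y.carrier}
    (hφ : ∀ᶠ x in X.generic, φ' x = φ.toFun x) {g : Y.ratFun} {g' : X.ratFun} :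
    IsPullback φ' g g' ↔ g' = φ.pullback g := by
  have key : ∀ f : Y.carrier → ℂ, ((fun x => f (φ' x) : X.carrier → ℂ) : X.generic.Germ ℂ) =
      ((fun x => f (φ.toFun x) : X.carrier → ℂ) : X.generic.Germ ℂ) := fun f => by
    refine Filter.Germ.coe_eq.2 ?_
    filter_upwards [hφ] with x hx
    rw [hx]
  constructor
  · rintro ⟨f, h1, h2⟩
    exact Subtype.ext (by rw [h2, key, φ.coe_pullback h1])
  · rintro rfl
    obtain ⟨f, hf⟩ := exists_rep g
    exact ⟨f, hf, by rw [key, φ.coe_pullback hf]⟩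

/-- Turns `Related` into an intertwining identity between derivations of the function fields. The
version up to generic equality is needed for maps such as `blowDown`, which is only generically a
composition of charts. -/
theorem related_iff_of_eventuallyEq {φ : DominantMap X Y} {φ' : X.carrier → Y.carrier}
    (hφ : ∀ᶠ x in X.generic, φ' x = φ.toFun x) {δ' : VectorField X} {δ : VectorField Y} :
    Related φ' δ' δ ↔ ∀ g, φ.pullback (δ g) = δ' (φ.pullback g) := by
  constructor
  · intro h g
    exact ((isPullback_iff_of_eventuallyEq hφ).1
      (h g _ ((isPullback_iff_of_eventuallyEq hφ).2 rfl))).symm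
  · rintro h g g' hg
    rw [isPullback_iff_of_eventuallyEq hφ] at hg ⊢
    rw [h, hg]

theorem related_iff (φ : DominantMap X Y) {δ' : VectorField X} {δ : VectorField Y} :
    Related φ.toFun δ' δ ↔ ∀ g, φ.pullback (δ g) = δ' (φ.pullback g) :=
  related_iff_of_eventuallyEq (Filter.Eventually.of_forall fun _ => rfl)

theorem pull_congr {φ : DominantMap X Y} {φ' : X.carrier → Y.carrier}
    (hφ : ∀ᶠ x in X.generic, φ' x = φ.toFun x) (G : Set (VectorField Y)) :
    pull φ' G = pull φ.toFun G := by
  ext δ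
  simp only [pull, Set.mem_ofPred_eq, related_iff_of_eventuallyEq hφ, related_iff]

/-- The composition of dominant rational maps. -/
def comp (φ : DominantMap X Y) (ψ : DominantMap Y Z) : DominantMap X Z where
  toFun x := ψ.toFun (φ.toFun x)
  dom := φ.dom ∩ φ.toFun ⁻¹' ψ.dom
  isOpen_dom := φ.isOpen_preimage _ ψ.isOpen_dom
  dense_dom := φ.dominant _ ψ.isOpen_dom ψ.dense_dom
  isOpen_preimage := (φ.isMorphismOn.comp ψ.isMorphismOn).isOpen_preimage
  regular := (φ.isMorphismOn.comp ψ.isMorphismOn).regular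
  dominant V hV hd := by
    have := φ.dominant _ (ψ.isOpen_preimage V hV) (ψ.dominant V hV hd)
    rwa [Set.preimage_inter, ← Set.inter_assoc] at this

theorem pullback_comp (φ : DominantMap X Y) (ψ : DominantMap Y Z) (g : Z.ratFun) :
    (φ.comp ψ).pullback g = φ.pullback (ψ.pullback g) := by
  obtain ⟨f, hf⟩ := exists_rep g
  exact Subtype.ext (by
    rw [(φ.comp ψ).coe_pullback hf, φ.coe_pullback (ψ.coe_pullback hf)]
    rfl)

theorem pullback_congr (φ ψ : DominantMap X Y) (h : ∀ᶠ x in X.generic, φ.toFun x = ψ.toFun x) :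
    φ.pullback = ψ.pullback := by
  ext g : 1
  have hg := (isPullback_iff_of_eventuallyEq (φ := φ)
    (Filter.Eventually.of_forall fun _ => rfl)).2 (rfl : φ.pullback g = φ.pullback g)
  exact (isPullback_iff_of_eventuallyEq h).1 hg

theorem pullback_eq_self (φ : DominantMap X X) (h : ∀ᶠ x in X.generic, φ.toFun x = x)
    (g : X.ratFun) : φ.pullback g = g := by
  obtain ⟨f, hf⟩ := exists_rep g
  refine Subtype.ext ?_
  rw [φ.coe_pullback hf, hf, Filter.Germ.coe_eq]
  filter_upwards [h] with x hx
  rw [hx]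

/-- A morphism on a nonempty open subset of an irreducible space, with image meeting all the
nonempty open sets. -/
def ofMorphism [IrreducibleSpace X.carrier] {U : Set X.carrier} {φ : X.carrier → Y.carrier}
    (h : IsMorphismOn U φ) (hne : U.Nonempty)
    (hd : ∀ V : Set Y.carrier, IsOpen V → V.Nonempty → ∃ x ∈ U, φ x ∈ V) : DominantMap X Y where
  toFun := φ
  dom := U
  isOpen_dom := h.isOpen
  dense_dom := h.isOpen.dense hne
  isOpen_preimage := h.isOpen_preimage
  regular := h.regular
  dominant V hV hVd := by
    refine (h.isOpen_preimage V hV).dense ?_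
    obtain ⟨x, -⟩ := hne
    have : Nonempty Y.carrier := ⟨φ x⟩
    exact hd V hV hVd.nonempty

end DominantMap

namespace BirationalMap

variable {X Y Z : FunSpace}

/-- The inverse birational map. -/
def symm (φ : BirationalMap X Y) : BirationalMap Y X :=
  { φ.inverse with
    inverse := φ.toDominantMap
    left_inv := φ.right_inv
    right_inv := φ.left_inv }

/-- The composition of birational maps. -/
def trans (φ : BirationalMap X Y) (ψ : BirationalMap Y Z) : BirationalMap X Z :=
  { φ.toDominantMap.comp ψ.toDominantMap with
    inverse := ψ.inverse.comp φ.inverse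
    left_inv := by
      filter_upwards [φ.left_inv, φ.toDominantMap.tendsto.eventually ψ.left_inv] with x h1 h2
      exact (congrArg φ.inverse.toFun h2).trans h1
    right_inv := by
      filter_upwards [ψ.right_inv, ψ.inverse.tendsto.eventually φ.right_inv] with x h1 h2
      exact (congrArg ψ.toFun h2).trans h1 }

theorem pullback_inverse_pullback (φ : BirationalMap X Y) (g : Y.ratFun) :
    φ.inverse.pullback (φ.pullback g) = g := by
  rw [← DominantMap.pullback_comp]
  exact DominantMap.pullback_eq_self _ φ.right_inv g

theorem pullback_pullback_inverse (φ : BirationalMap X Y) (g : X.ratFun) :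
    φ.pullback (φ.inverse.pullback g) = g :=
  φ.symm.pullback_inverse_pullback g

/-- An isomorphism between nonempty open subsets of irreducible spaces. -/
def ofMorphisms [IrreducibleSpace X.carrier] [IrreducibleSpace Y.carrier] {U : Set X.carrier}
    {V : Set Y.carrier} {φ : X.carrier → Y.carrier} {ψ : Y.carrier → X.carrier}
    (hφ : IsMorphismOn U φ) (hψ : IsMorphismOn V ψ) (hl : ∀ x ∈ U, φ x ∈ V → ψ (φ x) = x)
    (hr : ∀ y ∈ V, ψ y ∈ U → φ (ψ y) = y) (hne : ∃ x ∈ U, φ x ∈ V) : BirationalMap X Y := by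
  have hU := hφ.isOpen_preimage V hψ.isOpen
  have hV := hψ.isOpen_preimage U hφ.isOpen
  have hUV : ∀ x ∈ U ∩ φ ⁻¹' V, φ x ∈ V ∩ ψ ⁻¹' U := by
    rintro x ⟨hx, hx'⟩
    refine ⟨hx', ?_⟩
    change ψ (φ x) ∈ U
    rwa [hl x hx hx']
  have hVU : ∀ y ∈ V ∩ ψ ⁻¹' U, ψ y ∈ U ∩ φ ⁻¹' V := by
    rintro y ⟨hy, hy'⟩
    refine ⟨hy', ?_⟩
    change φ (ψ y) ∈ V
    rwa [hr y hy hy']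
  have hne' : (U ∩ φ ⁻¹' V).Nonempty := hne
  have hne'' : (V ∩ ψ ⁻¹' U).Nonempty := by
    obtain ⟨x, hx⟩ := hne'
    exact ⟨_, hUV x hx⟩
  refine
    { DominantMap.ofMorphism (hφ.mono hU Set.inter_subset_left) hne' ?_ with
      inverse := DominantMap.ofMorphism (hψ.mono hV Set.inter_subset_left) hne'' ?_
      left_inv := ?_
      right_inv := ?_ }
  · intro W hW hWne
    obtain ⟨y, hy, hyW⟩ := nonempty_preirreducible_inter hV hW hne'' hWne
    exact ⟨ψ y, hVU y hy, by rwa [hr y hy.1 hy.2]⟩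
  · intro W hW hWne
    obtain ⟨x, hx, hxW⟩ := nonempty_preirreducible_inter hU hW hne' hWne
    exact ⟨φ x, hUV x hx, by rwa [hl x hx.1 hx.2]⟩
  · filter_upwards [mem_generic_of_isOpen hU hne'] with x hx
    exact hl x hx.1 hx.2
  · filter_upwards [mem_generic_of_isOpen hV hne''] with y hy
    exact hr y hy.1 hy.2

end BirationalMap

/-! ### Rational functions on subsets of affine space -/

/-- Polynomials as rational functions. -/
noncomputable def polyHom {ι : Type} (C : Set (ι → ℂ)) :
    MvPolynomial ι ℂ →ₐ[ℂ] (affine C).ratFun :=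
  AlgHom.mk'
    { toFun := polyFun C
      map_one' := Subtype.ext (Filter.Germ.coe_eq.2 (Filter.Eventually.of_forall fun v => by
        simp [polyVal]))
      map_zero' := Subtype.ext (Filter.Germ.coe_eq.2 (Filter.Eventually.of_forall fun v => by
        simp [polyVal]))
      map_add' := fun P Q => Subtype.ext (Filter.Germ.coe_eq.2 (Filter.Eventually.of_forall
        fun v => by simp [polyVal]))
      map_mul' := fun P Q => Subtype.ext (Filter.Germ.coe_eq.2 (Filter.Eventually.of_forall
        fun v => by simp [polyVal])) }
    (fun c P => Subtype.ext (Filter.Germ.coe_eq.2 (Filter.Eventually.of_forall fun v => by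
      simp [polyVal])))

section

variable {ι : Type} {C : Set (ι → ℂ)}

theorem coe_polyFun (P : MvPolynomial ι ℂ) :
    (polyFun C P : (affine C).generic.Germ ℂ) = (polyVal C P : (affine C).generic.Germ ℂ) := rfl

theorem polyHom_ne_zero [IrreducibleSpace (affine C).carrier] {P : MvPolynomial ι ℂ} {v : ι → ℂ}
    (hv : v ∈ C) (hP : eval v P ≠ 0) : polyHom C P ≠ 0 := by
  intro h
  have h' : (polyVal C P : (affine C).generic.Germ ℂ) =
      ((fun _ => 0 : (affine C).carrier → ℂ) : (affine C).generic.Germ ℂ) := congrArg Subtype.val h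
  rw [Filter.Germ.coe_eq] at h'
  obtain ⟨w, hw, hw'⟩ :=
    (h'.and (mem_generic_of_isOpen (isOpen_polyVal_ne_zero C P) ⟨⟨v, hv⟩, hP⟩)).exists
  exact hw' hw

/-- A local expression near a single point already determines the germ, because its domain of
validity is a nonempty open set and hence dense. -/
theorem exists_eq_div [IrreducibleSpace (affine C).carrier] (g : (affine C).ratFun) :
    ∃ P Q : MvPolynomial ι ℂ, polyHom C Q ≠ 0 ∧ g = polyHom C P / polyHom C Q := by
  obtain ⟨_, U, f, h1, h2, h3, rfl⟩ := g
  obtain ⟨x, hx⟩ := h2.nonempty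
  obtain ⟨P, Q, hQ, hf⟩ := h3 x hx
  refine ⟨P, Q, polyHom_ne_zero x.2 hQ, Subtype.ext ?_⟩
  rw [div_eq_mul_inv]
  refine (Filter.Germ.coe_eq (g := fun v : (affine C).carrier =>
    eval v.1 P * (eval v.1 Q)⁻¹)).2 ?_
  filter_upwards [(⟨U, h1, h2, subset_rfl⟩ : U ∈ (affine C).generic),
    mem_generic_of_isOpen (isOpen_polyVal_ne_zero C Q) ⟨x, hQ⟩] with y hy hy'
  rw [hf y hy hy', div_eq_mul_inv]

/-- Compatibility of derivations with a homomorphism can be checked on coordinates. -/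
theorem map_derivation_eq [IrreducibleSpace (affine C).carrier] {A : Type} [CommRing A]
    [Algebra ℂ A] (h : (affine C).ratFun →ₐ[ℂ] A) (δ : VectorField (affine C))
    (δ' : Derivation ℂ A A) (H : ∀ i, h (δ (polyHom C (X i))) = δ' (h (polyHom C (X i))))
    (g : (affine C).ratFun) : h (δ g) = δ' (h g) := by
  have hP : ∀ P : MvPolynomial ι ℂ, h (δ (polyHom C P)) = δ' (h (polyHom C P)) := by
    intro P
    induction P using MvPolynomial.induction_on with
    | C a =>
      have e : polyHom C (MvPolynomial.C a) = algebraMap ℂ _ a := (polyHom C).commutes a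
      rw [e, AlgHom.commutes, Derivation.map_algebraMap, Derivation.map_algebraMap, map_zero]
    | add p q hp hq => simp only [map_add, hp, hq]
    | mul_X p i hp => simp only [map_mul, Derivation.leibniz, smul_eq_mul, map_add, hp, H]
  obtain ⟨P, Q, hQ, rfl⟩ := exists_eq_div g
  set g := polyHom C P / polyHom C Q with hg
  have e : g * polyHom C Q = polyHom C P := div_mul_cancel₀ _ hQ
  -- The ring `A` need not be a field, but `Q` is invertible in the source field and so has
  -- invertible image. Hence `Q` can be cancelled after differentiating `g * Q = P`.
  have hu : IsUnit (h (polyHom C Q)) := (IsUnit.mk0 _ hQ).map h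
  have e1 := hP P
  rw [← e] at e1
  simp only [map_mul, Derivation.leibniz, smul_eq_mul, map_add, hP] at e1
  exact hu.mul_left_cancel (add_left_cancel e1)

theorem vectorField_ext [IrreducibleSpace (affine C).carrier] {δ δ' : VectorField (affine C)}
    (H : ∀ i, δ (polyHom C (X i)) = δ' (polyHom C (X i))) : δ = δ' :=
  Derivation.ext fun g => map_derivation_eq (AlgHom.id ℂ _) δ δ' H g

theorem derivation_polyHom {δ : VectorField (affine C)} {V : ι → MvPolynomial ι ℂ}
    (H : ∀ i, δ (polyHom C (X i)) = polyHom C (V i)) (P : MvPolynomial ι ℂ) :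
    δ (polyHom C P) = polyHom C (mkDerivation ℂ V P) := by
  induction P using MvPolynomial.induction_on with
  | C a =>
    have e : polyHom C (MvPolynomial.C a) = algebraMap ℂ _ a := (polyHom C).commutes a
    rw [e, Derivation.map_algebraMap, ← algebraMap_eq, Derivation.map_algebraMap, map_zero]
  | add p q hp hq => simp only [map_add, hp, hq]
  | mul_X p i hp => simp only [map_mul, Derivation.leibniz, smul_eq_mul, map_add, hp, H,
      mkDerivation_X]

/-- Existence of vector fields with given components on subsets on which no nonzero polynomial
vanishes. -/
theorem exists_vectorField [IrreducibleSpace (affine C).carrier]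
    (hC : ∀ P : MvPolynomial ι ℂ, (∀ v ∈ C, eval v P = 0) → P = 0) (V : ι → (affine C).ratFun) :
    ∃ δ : VectorField (affine C), ∀ i, δ (polyHom C (X i)) = V i := by
  let K := (affine C).ratFun
  have hne : ∀ P : MvPolynomial ι ℂ, P ≠ 0 → polyHom C P ≠ 0 := by
    intro P hP
    by_contra h
    refine hP (hC P fun v hv => ?_)
    by_contra hv'
    exact polyHom_ne_zero hv hv' h
  let _ : Algebra (MvPolynomial ι ℂ) K := (polyHom C).toRingHom.toAlgebra
  have hmap : ∀ P, algebraMap (MvPolynomial ι ℂ) K P = polyHom C P := fun _ => rfl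
  -- Since no nonzero polynomial vanishes on `C`, the field of rational functions is the fraction
  -- field of the polynomial ring.
  have hloc : IsLocalization (nonZeroDivisors (MvPolynomial ι ℂ)) K := by
    refine ⟨⟨fun y => ?_, fun g => ?_, fun {P Q} h => ⟨1, ?_⟩⟩⟩
    · exact IsUnit.mk0 _ (hne _ (nonZeroDivisors.ne_zero y.2))
    · obtain ⟨P, Q, hQ, rfl⟩ := exists_eq_div g
      have hQ0 : Q ≠ 0 := by
        rintro rfl
        exact hQ (map_zero _)
      exact ⟨(P, ⟨Q, mem_nonZeroDivisors_of_ne_zero hQ0⟩), div_mul_cancel₀ _ hQ⟩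
    · have : P - Q = 0 := by
        by_contra h0
        refine hne _ h0 ?_
        rw [map_sub, sub_eq_zero]
        exact h
      rw [sub_eq_zero.1 this]
  -- A derivation δ is the same as a homomorphism g ↦ g + ε δ(g) to the dual numbers lifting the
  -- identity. It can be prescribed on the variables, and it extends to fractions because a dual
  -- number is invertible as soon as its first component is.
  let Φ : MvPolynomial ι ℂ →ₐ[ℂ] TrivSqZeroExt K K :=
    aeval fun i => TrivSqZeroExt.inl (polyHom C (X i)) + TrivSqZeroExt.inr (V i)
  have hfst : ∀ P, (Φ P).fst = polyHom C P := by
    intro P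
    have : (TrivSqZeroExt.fstHom ℂ K K).comp Φ = polyHom C := by
      ext i
      simp [Φ]
    exact DFunLike.congr_fun this P
  have hunit : ∀ y : nonZeroDivisors (MvPolynomial ι ℂ), IsUnit (Φ.toRingHom y) := by
    intro y
    rw [TrivSqZeroExt.isUnit_iff_isUnit_fst]
    change IsUnit (Φ y).fst
    rw [hfst]
    exact IsUnit.mk0 _ (hne _ (nonZeroDivisors.ne_zero y.2))
  let Ψ : K →+* TrivSqZeroExt K K := IsLocalization.lift hunit
  have hΨ : ∀ P, Ψ (polyHom C P) = Φ P := fun P => IsLocalization.lift_eq hunit P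
  have hΨfst : ∀ g, (Ψ g).fst = g := by
    intro g
    have : ((TrivSqZeroExt.fstHom ℂ K K).toRingHom.comp Ψ) = RingHom.id K := by
      refine IsLocalization.ringHom_ext (nonZeroDivisors (MvPolynomial ι ℂ)) ?_
      refine RingHom.ext fun P => ?_
      change (Ψ (polyHom C P)).fst = polyHom C P
      rw [hΨ, hfst]
    exact DFunLike.congr_fun this g
  have hsmul : ∀ (c : ℂ) (g : K), Ψ (c • g) = c • Ψ g := by
    intro c g
    have h1 : (algebraMap ℂ K c) = polyHom C (MvPolynomial.C c) := ((polyHom C).commutes c).symm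
    rw [Algebra.smul_def, map_mul, h1, hΨ]
    have : Φ (MvPolynomial.C c) = algebraMap ℂ _ c := Φ.commutes c
    rw [this, ← Algebra.smul_def]
  refine ⟨Derivation.mk'
    { toFun := fun g => (Ψ g).snd
      map_add' := fun a b => congrArg TrivSqZeroExt.snd (Ψ.map_add a b)
      map_smul' := fun c g => by simp [hsmul] } ?_, ?_⟩
  · intro a b
    change (Ψ (a * b)).snd = a * (Ψ b).snd + b * (Ψ a).snd
    rw [map_mul, TrivSqZeroExt.snd_mul, hΨfst, hΨfst, smul_eq_mul, MulOpposite.smul_eq_mul_unop,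
      MulOpposite.unop_op, mul_comm (Ψ a).snd]
  · intro i
    change (Ψ (polyHom C (X i))).snd = V i
    rw [hΨ]
    simp [Φ]

end

/-! ### Foliations given by a vector field -/

/-- The foliation given by a vector field. -/
def line {X : FunSpace} (δ : VectorField X) : Set (VectorField X) :=
  {δ' | ∃ h : X.ratFun, δ' = h • δ}

theorem isFoliation_line {X : FunSpace} {δ : VectorField X} (h : δ ≠ 0) : IsFoliation (line δ) :=
  ⟨δ, h, rfl⟩

/-- The image of a foliation by a dominant map, when one generator descends. -/
theorem push_eq_line {X Y : FunSpace} [IrreducibleSpace X.carrier] [IrreducibleSpace Y.carrier]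
    (φ : DominantMap X Y) {F : Set (VectorField X)} {δ₁ : VectorField X} {δ : VectorField Y}
    (hδ : δ ≠ 0) (hrel : ∀ g, φ.pullback (δ g) = δ₁ (φ.pullback g))
    (hF : ∀ k : X.ratFun, k • δ₁ ∈ F)
    (hF' : ∀ δ' ∈ F, ∃ k, ∀ g, δ' (φ.pullback g) = k * δ₁ (φ.pullback g)) :
    push φ.toFun F = line δ := by
  ext ε
  constructor
  · rintro ⟨δ', hδ', hr⟩
    rw [DominantMap.related_iff] at hr
    obtain ⟨k, hk⟩ := hF' δ' hδ'
    -- The multiplier `k` lives on `X` and is not known to be a pull-back. Evaluation at one `g₀`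
    -- with `δ g₀ ≠ 0` identifies it with the pull-back of `ε g₀ / δ g₀`; injectivity of the
    -- pull-back then gives the relation on `Y`.
    obtain ⟨g₀, hg₀⟩ : ∃ g, δ g ≠ 0 := by
      by_contra! h
      exact hδ (Derivation.ext h)
    have hg₀' : φ.pullback (δ g₀) ≠ 0 := (map_ne_zero φ.pullback).2 hg₀
    refine ⟨ε g₀ / δ g₀, Derivation.ext fun g => φ.pullback.toRingHom.injective ?_⟩
    change φ.pullback (ε g) = φ.pullback (ε g₀ / δ g₀ * δ g)
    rw [map_mul, map_div₀, hr, hr, hk, hk, ← hrel, ← hrel]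
    field_simp
  · rintro ⟨h, rfl⟩
    refine ⟨φ.pullback h • δ₁, hF _, ?_⟩
    rw [DominantMap.related_iff]
    intro g
    simp [hrel]

theorem push_line {X Y : FunSpace} [IrreducibleSpace X.carrier] [IrreducibleSpace Y.carrier]
    (φ : DominantMap X Y) {δ₁ : VectorField X} {δ : VectorField Y}
    (hδ : δ ≠ 0) (hrel : ∀ g, φ.pullback (δ g) = δ₁ (φ.pullback g)) :
    push φ.toFun (line δ₁) = line δ := by
  refine push_eq_line φ hδ hrel (fun k => ⟨k, rfl⟩) ?_
  rintro _ ⟨k, rfl⟩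
  exact ⟨k, fun g => rfl⟩

theorem line_smul {X : FunSpace} [IrreducibleSpace X.carrier] (δ : VectorField X) {k : X.ratFun}
    (hk : k ≠ 0) : line (k • δ) = line δ := by
  ext ε
  constructor
  · rintro ⟨h, rfl⟩
    exact ⟨h * k, Derivation.ext fun g => (mul_assoc h k (δ g)).symm⟩
  · rintro ⟨h, rfl⟩
    refine ⟨h * k⁻¹, Derivation.ext fun g => ?_⟩
    change h * δ g = h * k⁻¹ * (k * δ g)
    field_simp

namespace BirationalMap

variable {X Y : FunSpace}

/-- The image of a vector field by a birational map. -/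
noncomputable def transport (β : BirationalMap X Y) (δ : VectorField X) : VectorField Y :=
  Derivation.mk' (β.inverse.pullback.toLinearMap ∘ₗ δ.toLinearMap ∘ₗ β.pullback.toLinearMap)
    fun a b => by
      change β.inverse.pullback (δ (β.pullback (a * b))) =
        a * β.inverse.pullback (δ (β.pullback b)) + b * β.inverse.pullback (δ (β.pullback a))
      rw [map_mul, Derivation.leibniz, map_add, smul_eq_mul, smul_eq_mul, map_mul, map_mul,
        pullback_inverse_pullback, pullback_inverse_pullback]

theorem transport_apply (β : BirationalMap X Y) (δ : VectorField X) (g : Y.ratFun) :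
    β.transport δ g = β.inverse.pullback (δ (β.pullback g)) := rfl

theorem pullback_transport (β : BirationalMap X Y) (δ : VectorField X) (g : Y.ratFun) :
    β.pullback (β.transport δ g) = δ (β.pullback g) := by
  rw [transport_apply, pullback_pullback_inverse]

theorem transport_inverse_pullback (β : BirationalMap X Y) (δ : VectorField X) (g : X.ratFun) :
    β.transport δ (β.inverse.pullback g) = β.inverse.pullback (δ g) := by
  rw [transport_apply, pullback_pullback_inverse]

theorem transport_ne_zero (β : BirationalMap X Y) {δ : VectorField X} (h : δ ≠ 0) :
    β.transport δ ≠ 0 := by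
  intro h0
  refine h (Derivation.ext fun g => ?_)
  have := β.pullback_transport δ (β.inverse.pullback g)
  rw [h0, pullback_pullback_inverse] at this
  rw [← this]
  exact map_zero _

theorem push_line (φ : BirationalMap X Y) (δ : VectorField X) :
    push φ.toFun (line δ) = line (φ.transport δ) := by
  ext ε
  constructor
  · rintro ⟨_, ⟨k, rfl⟩, hr⟩
    rw [DominantMap.related_iff] at hr
    refine ⟨φ.inverse.pullback k, Derivation.ext fun g => ?_⟩
    rw [← φ.pullback_inverse_pullback (ε g), hr]
    simp [transport_apply]
  · rintro ⟨h, rfl⟩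
    refine ⟨φ.pullback h • δ, ⟨_, rfl⟩, ?_⟩
    rw [DominantMap.related_iff]
    intro g
    simp [pullback_transport]

theorem pull_line (φ : BirationalMap X Y) (δ : VectorField Y) :
    pull φ.toFun (line δ) = line (φ.symm.transport δ) := by
  have key : ∀ g, φ.pullback (δ g) = φ.symm.transport δ (φ.pullback g) :=
    fun g => (φ.symm.transport_inverse_pullback δ g).symm
  ext ε
  constructor
  · rintro ⟨_, ⟨k, rfl⟩, hr⟩
    rw [DominantMap.related_iff] at hr
    refine ⟨φ.pullback k, Derivation.ext fun g => ?_⟩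
    have := hr (φ.inverse.pullback g)
    rw [pullback_pullback_inverse] at this
    rw [← this]
    simp [key, pullback_pullback_inverse]
  · rintro ⟨h, rfl⟩
    refine ⟨φ.inverse.pullback h • δ, ⟨_, rfl⟩, ?_⟩
    rw [DominantMap.related_iff]
    intro g
    simp [key, pullback_pullback_inverse]

end BirationalMap

/-- A vector field which generates the image of a foliation by a birational map. -/
theorem birationallyEquivalent_pull {X Y M : FunSpace} (Ψ : BirationalMap X Y)
    (ρ : BirationalMap M X) {δ : VectorField X} (hδ : δ ≠ 0) :
    BirationallyEquivalent (push Ψ.toFun (line δ)) (pull ρ.toFun (line δ)) := by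
  rw [Ψ.push_line, ρ.pull_line]
  refine ⟨isFoliation_line (Ψ.transport_ne_zero hδ), isFoliation_line (ρ.symm.transport_ne_zero hδ),
    Ψ.symm.trans ρ.symm, ?_⟩
  rw [BirationalMap.push_line]
  refine congrArg line (Derivation.ext fun g => ?_)
  rw [BirationalMap.transport_apply, BirationalMap.transport_apply]
  change (ρ.toDominantMap.comp Ψ.toDominantMap).pullback
    (Ψ.transport δ ((Ψ.inverse.comp ρ.inverse).pullback g)) =
    ρ.pullback (δ (ρ.inverse.pullback g))
  rw [DominantMap.pullback_comp, DominantMap.pullback_comp, Ψ.pullback_transport,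
    Ψ.pullback_pullback_inverse]

/-- The affine plane. -/
abbrev A2 : FunSpace := affine (Set.univ : Set (Fin 2 → ℂ))

/-- Companion of `map_derivation_eq` for two derivations of the target ring. They are compared only
on the image of `h`, which neither has to preserve. -/
theorem derivation_congr_of_coords {ι : Type} {C : Set (ι → ℂ)}
    [IrreducibleSpace (affine C).carrier]
    {A : Type} [CommRing A] [Algebra ℂ A] (h : (affine C).ratFun →ₐ[ℂ] A) {d₁ d₂ : Derivation ℂ A A}
    (H : ∀ i, d₁ (h (polyHom C (X i))) = d₂ (h (polyHom C (X i)))) (g : (affine C).ratFun) :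
    d₁ (h g) = d₂ (h g) := by
  have hP : ∀ P : MvPolynomial ι ℂ, d₁ (h (polyHom C P)) = d₂ (h (polyHom C P)) := by
    intro P
    induction P using MvPolynomial.induction_on with
    | C a =>
      have e : polyHom C (MvPolynomial.C a) = algebraMap ℂ _ a := (polyHom C).commutes a
      rw [e, AlgHom.commutes, Derivation.map_algebraMap, Derivation.map_algebraMap]
    | add p q hp hq => simp only [map_add, hp, hq]
    | mul_X p i hp => simp only [map_mul, Derivation.leibniz, smul_eq_mul, hp, H]
  obtain ⟨P, Q, hQ, rfl⟩ := exists_eq_div g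
  set g := polyHom C P / polyHom C Q with hg
  have e : g * polyHom C Q = polyHom C P := div_mul_cancel₀ _ hQ
  have hu : IsUnit (h (polyHom C Q)) := (IsUnit.mk0 _ hQ).map h
  have e1 := hP P
  rw [← e] at e1
  simp only [map_mul, Derivation.leibniz, smul_eq_mul, hP] at e1
  exact hu.mul_left_cancel (add_left_cancel e1)

/-- The image of a foliation by a dominant map to a rational variety with coordinates given by the
inverse of `β`. -/
theorem push_eq_line_transport {X Y : FunSpace} [IrreducibleSpace X.carrier]
    [IrreducibleSpace Y.carrier] {ι : Type} {C : Set (ι → ℂ)} [IrreducibleSpace (affine C).carrier]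
    (φ : DominantMap X Y) (β : BirationalMap (affine C) Y) {F : Set (VectorField X)}
    {δ₁ : VectorField X} {D : VectorField (affine C)} (hD : D ≠ 0)
    (hrel : ∀ i, (φ.comp β.inverse).pullback (D (polyHom C (MvPolynomial.X i))) =
      δ₁ ((φ.comp β.inverse).pullback (polyHom C (MvPolynomial.X i))))
    (hF : ∀ k : X.ratFun, k • δ₁ ∈ F)
    (hF' : ∀ δ' ∈ F, ∃ k, ∀ i, δ' ((φ.comp β.inverse).pullback (polyHom C (MvPolynomial.X i))) =
      k * δ₁ ((φ.comp β.inverse).pullback (polyHom C (MvPolynomial.X i)))) :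
    push φ.toFun F = line (β.transport D) := by
  have e : ∀ g, φ.pullback g = (φ.comp β.inverse).pullback (β.pullback g) := fun g => by
    rw [DominantMap.pullback_comp, β.pullback_inverse_pullback]
  refine push_eq_line φ (β.transport_ne_zero hD) (δ₁ := δ₁) (fun g => ?_) hF fun δ' hδ' => ?_
  · rw [e, e g, β.pullback_transport]
    exact map_derivation_eq _ D δ₁ hrel _
  · obtain ⟨k, hk⟩ := hF' δ' hδ'
    refine ⟨k, fun g => ?_⟩
    rw [e]
    exact derivation_congr_of_coords (d₂ := k • δ₁) _ hk _

/-! ### Quotients by cyclic groups -/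

/-- Invariance under `T` makes `G` saturated, so the restriction of `φ` to `G` descends. Outside `G`
the descended map is given an arbitrary constant value. -/
theorem exists_quot_morphism {X Y : FunSpace} [Nonempty Y.carrier] {T : X.carrier → X.carrier}
    {T' : Y.carrier → Y.carrier} {G : Set X.carrier} {φ : X.carrier → Y.carrier}
    (hφ : IsMorphismOn G φ) (hG : ∀ p, p ∈ G ↔ T p ∈ G) (hT : ∀ p ∈ G, φ (T p) = T' (φ p)) :
    ∃ (G' : Set (cyclicQuot X T).carrier) (φ' : (cyclicQuot X T).carrier →
      (cyclicQuot Y T').carrier), (∀ p, cyclicQuot.mk X T p ∈ G' ↔ p ∈ G) ∧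
      (∀ p ∈ G, φ' (cyclicQuot.mk X T p) = cyclicQuot.mk Y T' (φ p)) ∧ IsMorphismOn G' φ' := by
  classical
  let G' : Set (cyclicQuot X T).carrier := {q | Quot.lift (fun p => p ∈ G)
    (fun a b h => by rw [h]; exact propext (hG a)) q}
  have y₀ : Y.carrier := Classical.arbitrary _
  let φ' : (cyclicQuot X T).carrier → (cyclicQuot Y T').carrier :=
    Quot.lift (fun p => if p ∈ G then cyclicQuot.mk Y T' (φ p) else cyclicQuot.mk Y T' y₀)
      (fun a b h => by
        rw [h]
        by_cases ha : a ∈ G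
        · rw [if_pos ha, if_pos ((hG a).1 ha), hT a ha]
          exact Quot.sound rfl
        · rw [if_neg ha, if_neg (fun hb => ha ((hG a).2 hb))])
  have hφ' : ∀ p ∈ G, φ' (cyclicQuot.mk X T p) = cyclicQuot.mk Y T' (φ p) := fun p hp => if_pos hp
  refine ⟨G', φ', fun p => Iff.rfl, hφ', isMorphismOn_quot_desc ?_⟩
  exact (hφ.comp_of_univ (isMorphismOn_quot_mk Y fun a b => b = T' a)).congr
    fun p hp => (hφ' p hp).symm

/-- `Φ` is known to be regular, invertible and equivariant only on some dense open set, which `T`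
may not preserve. Since `T` has finite order, intersecting finitely many preimages of that set under
powers of `T` gives an invariant nonempty open set. -/
theorem exists_quot_birational {X Y : FunSpace} [IrreducibleSpace X.carrier]
    [IrreducibleSpace Y.carrier] (Φ : BirationalMap X Y) {T : X.carrier → X.carrier}
    {T' : Y.carrier → Y.carrier} (hT : Continuous T) {n : ℕ} (hn : 0 < n)
    (hTn : ∀ p, T^[n] p = p) (hTn' : ∀ p, T'^[n] p = p)
    (heq : ∀ᶠ p in X.generic, Φ.toFun (T p) = T' (Φ.toFun p)) :
    ∃ Ψ : BirationalMap (cyclicQuot X T) (cyclicQuot Y T'), ∀ᶠ p in X.generic,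
      Ψ.toFun (cyclicQuot.mk X T p) = cyclicQuot.mk Y T' (Φ.toFun p) := by
  obtain ⟨m, rfl⟩ : ∃ m, n = m + 1 := ⟨n - 1, by omega⟩
  obtain ⟨U₁, hU₁, hU₁d, hU₁'⟩ := heq
  obtain ⟨U₂, hU₂, hU₂d, hU₂'⟩ := Φ.left_inv
  obtain ⟨H₁, hH₁, hH₁d, hH₁'⟩ := Φ.right_inv
  have hHo : IsOpen (Φ.inverse.dom ∩ H₁) := Φ.inverse.isOpen_dom.inter hH₁
  have hHd : Dense (Φ.inverse.dom ∩ H₁) :=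
    hH₁d.inter_of_isOpen_left Φ.inverse.dense_dom hH₁ |> fun h => by rwa [Set.inter_comm] at h
  let G₀ : Set X.carrier := (U₁ ∩ U₂) ∩ (Φ.dom ∩ Φ.toFun ⁻¹' (Φ.inverse.dom ∩ H₁))
  have hG₀ : IsOpen G₀ := (hU₁.inter hU₂).inter (Φ.isOpen_preimage _ hHo)
  have hG₀ne : G₀.Nonempty := by
    have h1 := (hU₁d.inter_of_isOpen_left hU₂d hU₁)
    exact (h1.inter_of_isOpen_left (Φ.dominant _ hHo hHd) (hU₁.inter hU₂)).nonempty
  let G : Set X.carrier := ⋂ k ∈ Finset.range (m + 1), T^[k] ⁻¹' G₀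
  have hGo : IsOpen G := isOpen_biInter_finset fun k _ => hG₀.preimage (hT.iterate k)
  have hGmem : ∀ p, p ∈ G ↔ ∀ k < m + 1, T^[k] p ∈ G₀ := fun p => by simp [G]
  have hGne : G.Nonempty := by
    refine Filter.nonempty_of_mem (f := X.generic) ?_
    refine (Filter.biInter_finset_mem _).2 fun k hk => ?_
    refine mem_generic_of_isOpen (hG₀.preimage (hT.iterate k)) ?_
    obtain ⟨p, hp⟩ := hG₀ne
    refine ⟨T^[m + 1 - k] p, ?_⟩
    rw [Finset.mem_range] at hk
    rw [Set.mem_preimage, ← Function.iterate_add_apply, Nat.add_sub_cancel' hk.le, hTn]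
    exact hp
  have hGG₀ : ∀ p ∈ G, p ∈ G₀ := fun p hp => (hGmem p).1 hp 0 (Nat.succ_pos _)
  have hGT : ∀ p, p ∈ G ↔ T p ∈ G := by
    intro p
    rw [hGmem, hGmem]
    constructor
    · intro h k hk
      rw [← Function.iterate_succ_apply]
      by_cases hk' : k + 1 < m + 1
      · exact h _ hk'
      · obtain rfl : k = m := by omega
        rw [hTn]
        exact h 0 (Nat.succ_pos _)
    · intro h k hk
      cases k with
      | zero =>
        have := h m (Nat.lt_succ_self m)
        rwa [← Function.iterate_succ_apply, hTn] at this
      | succ k =>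
        rw [Function.iterate_succ_apply]
        exact h k (by omega)
  have hmor := Φ.isMorphismOn.mono hGo fun p hp => (hGG₀ p hp).2.1
  have hmor' : IsMorphismOn ((Φ.inverse.dom ∩ H₁) ∩ Φ.inverse.toFun ⁻¹' G) Φ.inverse.toFun := by
    have h1 := Φ.inverse.isMorphismOn.mono hHo Set.inter_subset_left
    exact h1.mono (h1.isOpen_preimage G hGo) Set.inter_subset_left
  set H : Set Y.carrier := (Φ.inverse.dom ∩ H₁) ∩ Φ.inverse.toFun ⁻¹' G with hH
  have hl : ∀ p ∈ G, Φ.inverse.toFun (Φ.toFun p) = p := fun p hp => hU₂' (hGG₀ p hp).1.2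
  have hr : ∀ v ∈ H, Φ.toFun (Φ.inverse.toFun v) = v := fun v hv => hH₁' hv.1.2
  have heq : ∀ p ∈ G, Φ.toFun (T p) = T' (Φ.toFun p) := fun p hp => hU₁' (hGG₀ p hp).1.1
  have hGH : ∀ p ∈ G, Φ.toFun p ∈ H := fun p hp => by
    refine ⟨(hGG₀ p hp).2.2, ?_⟩
    rw [Set.mem_preimage, hl p hp]
    exact hp
  have hHG : ∀ v ∈ H, Φ.inverse.toFun v ∈ G := fun v hv => hv.2
  have heq' : ∀ v ∈ H, Φ.inverse.toFun (T' v) = T (Φ.inverse.toFun v) := fun v hv => by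
    rw [← hl _ ((hGT _).1 (hHG v hv)), heq _ (hHG v hv), hr v hv]
  have hHT₁ : ∀ v ∈ H, T' v ∈ H := fun v hv => by
    rw [← hr v hv, ← heq _ (hHG v hv)]
    exact hGH _ ((hGT _).1 (hHG v hv))
  -- No continuity of `T'` is needed: stability of `H` is carried over from `G` by equivariance, and
  -- the reverse implication uses that `T'` has finite order.
  have hHT : ∀ v, v ∈ H ↔ T' v ∈ H := by
    refine fun v => ⟨hHT₁ v, fun hv => ?_⟩
    have hit : ∀ k, T'^[k] (T' v) ∈ H := by
      intro k
      induction k with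
      | zero => exact hv
      | succ k ih =>
        rw [Function.iterate_succ_apply']
        exact hHT₁ _ ih
    have := hit m
    rwa [← Function.iterate_succ_apply, hTn'] at this
  obtain ⟨G', φ', h1, h2, h3⟩ := exists_quot_morphism (T' := T') hmor hGT heq
  obtain ⟨H', ψ', k1, k2, k3⟩ := exists_quot_morphism (T' := T) hmor' hHT heq'
  have : IrreducibleSpace (cyclicQuot X T).carrier := quot_irreducibleSpace X _
  have : IrreducibleSpace (cyclicQuot Y T').carrier := quot_irreducibleSpace Y _
  refine ⟨BirationalMap.ofMorphisms h3 k3 ?_ ?_ ?_, ?_⟩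
  · intro q
    obtain ⟨p, rfl⟩ := Quot.exists_rep q
    intro hp _
    have hp' := (h1 p).1 hp
    exact (congrArg ψ' (h2 p hp')).trans ((k2 _ (hGH p hp')).trans
      (congrArg (cyclicQuot.mk X T) (hl p hp')))
  · intro q
    obtain ⟨p, rfl⟩ := Quot.exists_rep q
    intro hp _
    have hp' := (k1 p).1 hp
    exact (congrArg φ' (k2 p hp')).trans ((h2 _ (hHG p hp')).trans
      (congrArg (cyclicQuot.mk Y T') (hr p hp')))
  · obtain ⟨p, hp⟩ := hGne
    refine ⟨cyclicQuot.mk X T p, (h1 p).2 hp, ?_⟩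
    rw [h2 p hp, k1]
    exact hGH p hp
  · filter_upwards [mem_generic_of_isOpen hGo hGne] with p hp
    exact h2 p hp

/-! ### Level sets of weighted homogeneous polynomials -/

theorem eval_wscale_monomial {d : ℕ} (w : Fin d → ℕ) (t : ℂ) (v : Fin d → ℂ) (m : Fin d →₀ ℕ)
    (c : ℂ) : eval (wscale w t v) (monomial m c) =
      t ^ Finsupp.weight w m * eval v (monomial m c) := by
  simp only [eval_monomial, wscale, Finsupp.weight_apply, Finsupp.prod, Finsupp.sum]
  rw [← Finset.prod_pow_eq_pow_sum, mul_left_comm, ← Finset.prod_mul_distrib]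
  congr 1
  refine Finset.prod_congr rfl fun i _ => ?_
  rw [mul_pow, ← pow_mul, smul_eq_mul, mul_comm (w i)]

/-- `H' j` collects the monomials of weight j + ne. If t^n B(v) = 1, scaling by t multiplies such a
monomial by t^j B(v)^(-e). With `M` the largest e, the factor B^M clears all denominators, leaving
t^j times a polynomial `R j` in v. So each component on the level set is controlled by a polynomial
on the whole space, whichever root t is chosen. -/
theorem exists_weight_decomposition {d : ℕ} (w : Fin d → ℕ) {n : ℕ} (hn : 0 < n)
    (B H : MvPolynomial (Fin d) ℂ) :
    ∃ (H' R : Fin n → MvPolynomial (Fin d) ℂ) (M : ℕ),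
      (∀ t v, t ^ n = 1 → eval (wscale w t v) H =
        ∑ j : Fin n, t ^ (j : ℕ) * eval v (H' j)) ∧
      ∀ (j : Fin n) t v, t ^ n * eval v B = 1 →
        eval (wscale w t v) (H' j) * eval v B ^ M = t ^ (j : ℕ) * eval v (R j) := by
  classical
  let r : (Fin d →₀ ℕ) → Fin n := fun m => ⟨Finsupp.weight w m % n, Nat.mod_lt _ hn⟩
  let e : (Fin d →₀ ℕ) → ℕ := fun m => Finsupp.weight w m / n
  let M := H.support.sup e
  have hw : ∀ m, Finsupp.weight w m = (r m : ℕ) + n * e m := fun m => (Nat.mod_add_div _ _).symm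
  refine ⟨fun j => ∑ m ∈ H.support with r m = j, monomial m (H.coeff m),
    fun j => ∑ m ∈ H.support with r m = j, monomial m (H.coeff m) * B ^ (M - e m), M, ?_, ?_⟩
  · intro t v ht
    have h1 : eval (wscale w t v) H =
        ∑ m ∈ H.support, t ^ ((r m : Fin n) : ℕ) * eval v (monomial m (H.coeff m)) := by
      conv_lhs => rw [H.as_sum]
      rw [map_sum]
      refine Finset.sum_congr rfl fun m _ => ?_
      rw [eval_wscale_monomial, hw m, pow_add, pow_mul, ht, one_pow, mul_one]
    rw [h1, ← Finset.sum_fiberwise H.support r]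
    refine Finset.sum_congr rfl fun j _ => ?_
    rw [map_sum, Finset.mul_sum]
    refine Finset.sum_congr rfl fun m hm => ?_
    rw [(Finset.mem_filter.1 hm).2]
  · intro j t v ht
    rw [map_sum, map_sum, Finset.sum_mul, Finset.mul_sum]
    refine Finset.sum_congr rfl fun m hm => ?_
    obtain ⟨hm1, hm2⟩ := Finset.mem_filter.1 hm
    have hle : e m ≤ M := Finset.le_sup hm1
    have h2 : (t ^ n) ^ e m * eval v B ^ M = eval v B ^ (M - e m) := by
      conv_lhs => rw [← Nat.add_sub_cancel' hle, pow_add, ← mul_assoc, ← mul_pow, ht, one_pow,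
        one_mul]
    rw [eval_wscale_monomial, hw m, hm2, pow_add, pow_mul, map_mul, map_pow, ← h2]
    ring

/-- The Vandermonde matrix of the distinct powers of ζ is invertible. This separates the weight
components of an identity that holds at all translates by roots of unity. -/
theorem eq_zero_of_sum_root_pow {n : ℕ} {ζ : ℂ} (hζ : IsPrimitiveRoot ζ n) (a : Fin n → ℂ)
    (h : ∀ k : Fin n, ∑ j : Fin n, (ζ ^ (k : ℕ)) ^ (j : ℕ) * a j = 0) : a = 0 := by
  refine Matrix.eq_zero_of_forall_index_sum_pow_mul_eq_zero (f := fun k : Fin n => ζ ^ (k : ℕ))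
    ?_ ?_
  · intro i j hij
    exact Fin.ext (hζ.pow_inj i.2 j.2 hij)
  · exact h

theorem wscale_wscale {d : ℕ} (w : Fin d → ℕ) (s t : ℂ) (v : Fin d → ℂ) :
    wscale w s (wscale w t v) = wscale w (s * t) v := by
  funext i
  simp [wscale, mul_pow, mul_assoc]

theorem wscale_one {d : ℕ} (w : Fin d → ℕ) (v : Fin d → ℂ) : wscale w 1 v = v := by
  funext i
  simp [wscale]

section Level

variable {B : MvPolynomial (Fin 3) ℂ} {w : Fin 3 → ℕ} {n : ℕ}

/-- The weighted homothety of ratio `ζ`, with `ζ ^ n = 1`, on the level set of a weighted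
homogeneous polynomial of degree `n`. -/
def levelScale (hB : ∀ t v, eval (wscale w t v) B = t ^ n * eval v B) {ζ : ℂ} (hζ : ζ ^ n = 1)
    (v : (affine (level B)).carrier) : (affine (level B)).carrier :=
  ⟨wscale w ζ v.1, by
    change eval _ B = 1
    rw [hB, hζ, one_mul]
    exact v.2⟩

theorem level_ne_zero (hB : ∀ t v, eval (wscale w t v) B = t ^ n * eval v B) (hn : 0 < n)
    {v : Fin 3 → ℂ} (hv : v ∈ level B) : v ≠ 0 := by
  rintro rfl
  have h1 : eval 0 B = 1 := hv
  have h2 := hB 0 0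
  have h3 : wscale w 0 0 = 0 := by
    funext i
    simp [wscale]
  rw [h3, h1, zero_pow hn.ne'] at h2
  simp at h2

variable (hB : ∀ t v, eval (wscale w t v) B = t ^ n * eval v B)

theorem iterate_levelScale {ζ : ℂ} (hζ : ζ ^ n = 1) (k : ℕ) (v : (affine (level B)).carrier) :
    (((levelScale hB hζ)^[k] v).1 : Fin 3 → ℂ) = wscale w (ζ ^ k) v.1 := by
  induction k with
  | zero => exact (wscale_one w v.1).symm.trans (by rw [pow_zero])
  | succ k ih =>
    rw [Function.iterate_succ_apply', pow_succ', ← wscale_wscale, ← ih]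
    rfl

theorem quot_mk_eq_of_wscale {ζ : ℂ} (hn : 0 < n) (hζ : IsPrimitiveRoot ζ n)
    {v v' : (affine (level B)).carrier} {t : ℂ} (h : v'.1 = wscale w t v.1) (ht : t ^ n = 1) :
    cyclicQuot.mk (affine (level B)) (levelScale hB hζ.pow_eq_one) v' =
      cyclicQuot.mk _ (levelScale hB hζ.pow_eq_one) v := by
  have : NeZero n := ⟨hn.ne'⟩
  obtain ⟨k, -, rfl⟩ := hζ.eq_pow_of_pow_eq_one ht
  have hk : ∀ k : ℕ, cyclicQuot.mk (affine (level B)) (levelScale hB hζ.pow_eq_one)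
      ((levelScale hB hζ.pow_eq_one)^[k] v) = cyclicQuot.mk _ (levelScale hB hζ.pow_eq_one) v := by
    intro k
    induction k with
    | zero => rfl
    | succ k ih =>
      rw [← ih, Function.iterate_succ_apply']
      exact (Quot.sound (r := fun a b => b = levelScale hB hζ.pow_eq_one a) rfl).symm
  rw [← hk k]
  refine congrArg _ (Subtype.ext ?_)
  rw [iterate_levelScale]
  exact h

/-- Normalization to the level set, followed by the projection to the quotient by the roots of
unity, is a morphism. -/
theorem isMorphismOn_normalize {ζ : ℂ} (hn : 0 < n) (hζ : IsPrimitiveRoot ζ n)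
    {U : Set (affine (punctured 3)).carrier} (hU : U = {v | eval v.1 B ≠ 0})
    {s : (affine (punctured 3)).carrier → (affine (level B)).carrier}
    (hs : ∀ v ∈ U, ∃ t : ℂ, t ^ n * eval v.1 B = 1 ∧ (s v).1 = wscale w t v.1) :
    IsMorphismOn U (fun v => cyclicQuot.mk (affine (level B)) (levelScale hB hζ.pow_eq_one)
      (s v)) := by
  have hUo : IsOpen U := hU ▸ isOpen_polyVal_ne_zero _ B
  have hne : ∀ v ∈ U, eval v.1 B ≠ 0 := fun v hv => by
    rw [hU] at hv
    exact hv
  have hstable : ∀ (W : Set (cyclicQuot (affine (level B))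
      (levelScale hB hζ.pow_eq_one)).carrier) (v : (affine (level B)).carrier) (k : ℕ),
      cyclicQuot.mk _ (levelScale hB hζ.pow_eq_one) v ∈ W →
        cyclicQuot.mk _ (levelScale hB hζ.pow_eq_one)
          ((levelScale hB hζ.pow_eq_one)^[k] v) ∈ W := by
    intro W v k hv
    rwa [quot_mk_eq_of_wscale hB hn hζ (iterate_levelScale hB _ k v)
      (by rw [← pow_mul, mul_comm, pow_mul, hζ.pow_eq_one, one_pow])]
  have hopen : ∀ W : Set (cyclicQuot (affine (level B)) (levelScale hB hζ.pow_eq_one)).carrier,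
      IsOpen W → IsOpen (U ∩ (fun v => cyclicQuot.mk (affine (level B))
        (levelScale hB hζ.pow_eq_one) (s v)) ⁻¹' W) := by
    intro W hW
    rw [isOpen_iff_forall_mem_open]
    rintro v₀ ⟨hv₀, hv₀W⟩
    have hW' : IsOpen (cyclicQuot.mk (affine (level B)) (levelScale hB hζ.pow_eq_one) ⁻¹' W) := hW
    obtain ⟨H, hH, hHW⟩ := exists_basicOpen hW' (x := s v₀) hv₀W
    obtain ⟨H', R, M, h1, h2⟩ := exists_weight_decomposition w hn B H
    -- The section `s` involves a choice of n-th roots and need not be continuous. Some weight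
    -- component of `H` is nonzero at `s v₀`, and nonvanishing of that component at `s v` amounts to
    -- nonvanishing of the polynomial `R j` at `v`, an open condition.
    have hex : ∃ j, eval (s v₀).1 (H' j) ≠ 0 := by
      by_contra! hcon
      refine hH ?_
      have := h1 1 (s v₀).1 (one_pow n)
      rw [wscale_one] at this
      rw [this]
      simp [hcon]
    obtain ⟨j, hj⟩ := hex
    have hR : ∀ v ∈ U, (eval (s v).1 (H' j) ≠ 0 ↔ eval v.1 (R j) ≠ 0) := by
      intro v hv
      obtain ⟨t, ht, hst⟩ := hs v hv
      have h3 := h2 j t v.1 ht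
      have ht0 : t ≠ 0 := by
        rintro rfl
        rw [zero_pow hn.ne', zero_mul] at ht
        exact zero_ne_one ht
      rw [← hst] at h3
      have h4 : eval (s v).1 (H' j) = 0 ↔ eval v.1 (R j) = 0 := by
        constructor
        · intro h
          rw [h, zero_mul] at h3
          exact (mul_eq_zero.1 h3.symm).resolve_left (pow_ne_zero _ ht0)
        · intro h
          rw [h, mul_zero] at h3
          exact (mul_eq_zero.1 h3).resolve_right (pow_ne_zero _ (hne v hv))
      exact not_congr h4
    refine ⟨U ∩ {v | eval v.1 (R j) ≠ 0}, ?_, hUo.inter (isOpen_polyVal_ne_zero _ _), hv₀,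
      (hR v₀ hv₀).1 hj⟩
    rintro v ⟨hv, hvR⟩
    refine ⟨hv, ?_⟩
    have hvj := (hR v hv).2 hvR
    -- A nonzero component forces `H` to be nonzero at some translate of `s v` by a power of ζ, and
    -- this translate has the same image in the quotient.
    obtain ⟨k, hk⟩ : ∃ k : Fin n, eval (wscale w (ζ ^ (k : ℕ)) (s v).1) H ≠ 0 := by
      by_contra! hcon
      refine hvj (congrFun (eq_zero_of_sum_root_pow hζ (fun j => eval (s v).1 (H' j)) ?_) j)
      intro k
      rw [← h1 _ _ (by rw [← pow_mul, mul_comm, pow_mul, hζ.pow_eq_one, one_pow])]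
      exact hcon k
    have hkW : (levelScale hB hζ.pow_eq_one)^[k] (s v) ∈ basicOpen (level B) H := by
      change eval _ H ≠ 0
      rwa [iterate_levelScale]
    have := hHW hkW
    have h5 : cyclicQuot.mk _ (levelScale hB hζ.pow_eq_one)
        ((levelScale hB hζ.pow_eq_one)^[k] (s v)) ∈ W := this
    rwa [quot_mk_eq_of_wscale hB hn hζ (iterate_levelScale hB _ k (s v))
      (by rw [← pow_mul, mul_comm, pow_mul, hζ.pow_eq_one, one_pow])] at h5
  refine ⟨hUo, hopen, fun W f hW hf => ?_⟩
  rintro v₀ ⟨hv₀, hv₀W⟩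
  obtain ⟨P, Q, hQ, hPQ⟩ := hf (s v₀) hv₀W
  -- From f = P/Q one passes to f Q² = PQ, which holds also where Q vanishes. This matters because
  -- the identity is used at all translates by powers of ζ, some of which may lie on Q = 0.
  obtain ⟨P', R, M, h1, h2⟩ := exists_weight_decomposition w hn B (P * Q)
  obtain ⟨Q', S, N, k1, k2⟩ := exists_weight_decomposition w hn B (Q * Q)
  obtain ⟨j, hj⟩ : ∃ j, eval (s v₀).1 (Q' j) ≠ 0 := by
    by_contra! hcon
    have := k1 1 (s v₀).1 (one_pow n)
    rw [wscale_one] at this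
    simp [hcon] at this
    exact hQ this
  have hfQ : ∀ v : (affine (level B)).carrier,
      cyclicQuot.mk _ (levelScale hB hζ.pow_eq_one) v ∈ W →
      f (cyclicQuot.mk _ (levelScale hB hζ.pow_eq_one) v) * eval v.1 (Q * Q) =
        eval v.1 (P * Q) := by
    intro v hv
    rw [map_mul, map_mul]
    by_cases h0 : eval v.1 Q = 0
    · simp [h0]
    · have : f (cyclicQuot.mk _ (levelScale hB hζ.pow_eq_one) v) = eval v.1 P / eval v.1 Q :=
        hPQ v hv h0
      rw [this]
      field_simp
  -- The function `f` takes the same value at all translates, so the identity splits into weight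
  -- components.
  have hfj : ∀ v : (affine (level B)).carrier,
      cyclicQuot.mk _ (levelScale hB hζ.pow_eq_one) v ∈ W →
      f (cyclicQuot.mk _ (levelScale hB hζ.pow_eq_one) v) * eval v.1 (Q' j) =
        eval v.1 (P' j) := by
    intro v hv
    have := congrFun (eq_zero_of_sum_root_pow hζ
      (fun j => f (cyclicQuot.mk _ (levelScale hB hζ.pow_eq_one) v) * eval v.1 (Q' j) -
        eval v.1 (P' j)) ?_) j
    · exact sub_eq_zero.1 this
    intro k
    have hk1 : (ζ ^ (k : ℕ)) ^ n = 1 := by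
      rw [← pow_mul, mul_comm, pow_mul, hζ.pow_eq_one, one_pow]
    have h6 := hfQ ((levelScale hB hζ.pow_eq_one)^[k] v) (hstable W v k hv)
    rw [quot_mk_eq_of_wscale hB hn hζ (iterate_levelScale hB _ k v) hk1, iterate_levelScale,
      k1 _ _ hk1, h1 _ _ hk1, Finset.mul_sum, ← sub_eq_zero, ← Finset.sum_sub_distrib] at h6
    rw [← h6]
    refine Finset.sum_congr rfl fun j _ => ?_
    ring
  -- For `s v` = t·v both sides of the component of index j carry the factor t^j. Once it is
  -- cancelled, t has disappeared and a quotient of polynomials in `v` remains.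
  have key : ∀ v ∈ U, cyclicQuot.mk _ (levelScale hB hζ.pow_eq_one) (s v) ∈ W →
      f (cyclicQuot.mk _ (levelScale hB hζ.pow_eq_one) (s v)) * eval v.1 (S j * B ^ M) =
        eval v.1 (R j * B ^ N) := by
    intro v hv hvW
    obtain ⟨t, ht, hst⟩ := hs v hv
    have ht0 : t ≠ 0 := by
      rintro rfl
      rw [zero_pow hn.ne', zero_mul] at ht
      exact zero_ne_one ht
    have h7 := hfj (s v) hvW
    have e1 := h2 j t v.1 ht
    have e2 := k2 j t v.1 ht
    rw [← hst] at e1 e2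
    refine mul_left_cancel₀ (pow_ne_zero (j : ℕ) ht0) ?_
    simp only [map_mul, map_pow]
    linear_combination eval v.1 B ^ N * e1 -
      f (cyclicQuot.mk _ (levelScale hB hζ.pow_eq_one) (s v)) * eval v.1 B ^ M * e2 +
      eval v.1 B ^ N * eval v.1 B ^ M * h7
  refine ⟨R j * B ^ N, S j * B ^ M, ?_, ?_⟩
  · obtain ⟨t, ht, hst⟩ := hs v₀ hv₀
    have e2 := k2 j t v₀.1 ht
    rw [← hst] at e2
    rw [map_mul, map_pow]
    refine mul_ne_zero ?_ (pow_ne_zero _ (hne v₀ hv₀))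
    intro h0
    rw [h0, mul_zero] at e2
    exact mul_ne_zero hj (pow_ne_zero _ (hne v₀ hv₀)) e2
  · rintro v ⟨hv, hvW⟩ hvS
    rw [eq_div_iff hvS]
    exact key v hv hvW

/-- The quotient of the level set `B = 1` of a weighted homogeneous polynomial of degree `n` by the
`n`-th roots of unity is birational to the weighted projective plane. -/
theorem exists_level_quot_birational [IrreducibleSpace (affine (level B)).carrier]
    [IrreducibleSpace (affine (punctured 3)).carrier] {ζ : ℂ} (hn : 0 < n)
    (hζ : IsPrimitiveRoot ζ n) :
    ∃ Ψ : BirationalMap (cyclicQuot (affine (level B)) (levelScale hB hζ.pow_eq_one)) (wproj w),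
      ∀ v : (affine (level B)).carrier, Ψ.toFun (cyclicQuot.mk _ _ v) =
        wproj.mk w ⟨v.1, level_ne_zero hB hn v.2⟩ := by
  classical
  have : IrreducibleSpace (cyclicQuot (affine (level B)) (levelScale hB hζ.pow_eq_one)).carrier :=
    quot_irreducibleSpace _ _
  have : IrreducibleSpace (wproj w).carrier := quot_irreducibleSpace _ _
  let φ : (cyclicQuot (affine (level B)) (levelScale hB hζ.pow_eq_one)).carrier →
      (wproj w).carrier :=
    Quot.lift (fun v => wproj.mk w ⟨v.1, level_ne_zero hB hn v.2⟩) (by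
      rintro a b rfl
      exact Quot.sound ⟨ζ, hζ.ne_zero hn.ne', rfl⟩)
  have hφ : IsMorphismOn Set.univ φ := by
    refine isMorphismOn_quot_desc (IsMorphismOn.comp_of_univ (X := affine (level B))
      (Y := affine (punctured 3)) (φ := fun v => ⟨v.1, level_ne_zero hB hn v.2⟩) ?_
      (isMorphismOn_quot_mk (affine (punctured 3)) _))
    refine isMorphismOn_affine isOpen_univ fun i => ?_
    exact regularOn_div (X i) 1 fun x _ => by simp
  have v₁ : (affine (level B)).carrier := Classical.arbitrary _
  have hex : ∀ v : (affine (punctured 3)).carrier, ∃ u : (affine (level B)).carrier,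
      eval v.1 B ≠ 0 → ∃ t : ℂ, t ^ n * eval v.1 B = 1 ∧ u.1 = wscale w t v.1 := by
    intro v
    by_cases hv : eval v.1 B ≠ 0
    · obtain ⟨t, ht⟩ := IsAlgClosed.exists_pow_nat_eq (eval v.1 B)⁻¹ hn
      have ht' : t ^ n * eval v.1 B = 1 := by rw [ht, inv_mul_cancel₀ hv]
      exact ⟨⟨wscale w t v.1, (hB _ _).trans ht'⟩, fun _ => ⟨t, ht', rfl⟩⟩
    · exact ⟨v₁, fun h => absurd h hv⟩
  choose s hs using hex
  have hsr : ∀ a b : (affine (punctured 3)).carrier, (∃ t : ℂ, t ≠ 0 ∧ b.1 = wscale w t a.1) →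
      (eval a.1 B ≠ 0 ↔ eval b.1 B ≠ 0) := by
    rintro a b ⟨t, ht, h⟩
    rw [h, hB]
    simp [ht]
  let ψ : (wproj w).carrier →
      (cyclicQuot (affine (level B)) (levelScale hB hζ.pow_eq_one)).carrier :=
    Quot.lift (fun v => if eval v.1 B ≠ 0 then cyclicQuot.mk _ (levelScale hB hζ.pow_eq_one) (s v)
      else cyclicQuot.mk _ (levelScale hB hζ.pow_eq_one) v₁) (by
      intro a b hab
      by_cases ha : eval a.1 B ≠ 0
      · have hb := (hsr a b hab).1 ha
        refine (if_pos ha).trans (Eq.trans ?_ (if_pos hb).symm)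
        obtain ⟨t, ht, h⟩ := hab
        obtain ⟨x, hx, hx'⟩ := hs a ha
        obtain ⟨y, hy, hy'⟩ := hs b hb
        have hx0 : x ≠ 0 := by
          rintro rfl
          rw [zero_pow hn.ne', zero_mul] at hx
          exact zero_ne_one hx
        -- Normalizing to B = 1 requires an n-th root of 1/B. Two normalizations of proportional
        -- vectors differ by this ratio, whose n-th power is 1 by homogeneity of B, so they agree in
        -- the quotient.
        refine (quot_mk_eq_of_wscale hB hn hζ (t := y * t / x) ?_ ?_).symm
        · rw [hy', hx', h, wscale_wscale, wscale_wscale, div_mul_cancel₀ _ hx0]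
        · rw [h, hB] at hy
          rw [div_pow, mul_pow, div_eq_one_iff_eq (pow_ne_zero _ hx0)]
          exact mul_right_cancel₀ ha (by rw [hx, ← hy]; ring)
      · exact (if_neg ha).trans (if_neg fun hb => ha ((hsr a b hab).2 hb)).symm)
  let V : Set (wproj w).carrier :=
    {q | Quot.lift (fun v : (affine (punctured 3)).carrier => eval v.1 B ≠ 0)
      (fun a b h => propext (hsr a b h)) q}
  have hψ : IsMorphismOn V ψ := by
    refine isMorphismOn_quot_desc ?_
    refine (isMorphismOn_normalize hB hn hζ (s := s) (U := Quot.mk _ ⁻¹' V) rfl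
      fun v hv => hs v hv).congr fun v hv => ?_
    exact (if_pos hv).symm
  refine ⟨BirationalMap.ofMorphisms hφ hψ ?_ ?_ ?_, fun v => rfl⟩
  · intro p
    obtain ⟨v, rfl⟩ := Quot.exists_rep p
    intro _ hv
    have hv1 : eval v.1 B = 1 := v.2
    have hv' : eval v.1 B ≠ 0 := by rw [hv1]; exact one_ne_zero
    refine (if_pos hv').trans ?_
    obtain ⟨t, ht, ht'⟩ := hs ⟨v.1, level_ne_zero hB hn v.2⟩ hv'
    have ht1 : t ^ n * eval v.1 B = 1 := ht
    rw [hv1, mul_one] at ht1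
    exact quot_mk_eq_of_wscale hB hn hζ ht' ht1
  · intro p
    obtain ⟨v, rfl⟩ := Quot.exists_rep p
    intro hv _
    have hv' : eval v.1 B ≠ 0 := hv
    have e : ψ (Quot.mk _ v) = cyclicQuot.mk _ (levelScale hB hζ.pow_eq_one) (s v) := if_pos hv'
    obtain ⟨t, ht, ht'⟩ := hs v hv'
    have ht0 : t ≠ 0 := by
      rintro rfl
      rw [zero_pow hn.ne', zero_mul] at ht
      exact zero_ne_one ht
    rw [e]
    exact (Quot.sound ⟨t, ht0, ht'⟩).symm
  · refine ⟨cyclicQuot.mk _ _ v₁, Set.mem_univ _, ?_⟩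
    change eval v₁.1 B ≠ 0
    have : eval v₁.1 B = 1 := v₁.2
    rw [this]
    exact one_ne_zero

end Level

/-! ### Charts -/

theorem eq_zero_of_eval_eq_zero {ι : Type} {C : Set (ι → ℂ)} {H : MvPolynomial ι ℂ}
    (hH : H ≠ 0) (hC : ∀ v, eval v H ≠ 0 → v ∈ C) (P : MvPolynomial ι ℂ)
    (hP : ∀ v ∈ C, eval v P = 0) : P = 0 := by
  refine (mul_eq_zero.1 (MvPolynomial.funext fun v => ?_ : P * H = 0)).resolve_right hH
  rw [map_mul, map_zero]
  by_cases hv : eval v H = 0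
  · rw [hv, mul_zero]
  · rw [hP v (hC v hv), zero_mul]

theorem eq_zero_of_eval_punctured (P : MvPolynomial (Fin 3) ℂ)
    (hP : ∀ v ∈ punctured 3, eval v P = 0) : P = 0 := by
  refine eq_zero_of_eval_eq_zero (H := X 0) (X_ne_zero _) (fun v hv => ?_) P hP
  rintro rfl
  simp at hv

instance {ι : Type} : IrreducibleSpace (affine (Set.univ : Set (ι → ℂ))).carrier :=
  irreducibleSpace_of_eval_eq_zero ⟨0, trivial⟩
    (eq_zero_of_eval_eq_zero one_ne_zero fun _ _ => trivial)

instance : IrreducibleSpace (affine (punctured 3)).carrier :=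
  irreducibleSpace_of_eval_eq_zero ⟨fun _ => 1, fun h => one_ne_zero (congrFun h 0)⟩
    eq_zero_of_eval_punctured

instance (w : Fin 3 → ℕ) : IrreducibleSpace (wproj w).carrier := quot_irreducibleSpace _ _

/-- The quotient map as a dominant map. -/
def quotMap (X : FunSpace) [IrreducibleSpace X.carrier] (r : X.carrier → X.carrier → Prop) :
    DominantMap X (X.quot r) :=
  DominantMap.ofMorphism (isMorphismOn_quot_mk X r) Set.univ_nonempty fun V _ hV => by
    obtain ⟨q, hq⟩ := hV
    obtain ⟨x, rfl⟩ := Quot.exists_rep q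
    exact ⟨x, trivial, hq⟩

theorem pullback_polyHom {X : FunSpace} {κ : Type} {C' : Set (κ → ℂ)}
    (φ : DominantMap X (affine C')) (P : MvPolynomial κ ℂ) :
    (φ.pullback (polyHom C' P) : X.generic.Germ ℂ) =
      ((fun x => eval (φ.toFun x).1 P : X.carrier → ℂ) : X.generic.Germ ℂ) :=
  φ.coe_pullback (coe_polyFun P)

theorem pullback_eq_div {ι κ : Type} {C : Set (ι → ℂ)} [IrreducibleSpace (affine C).carrier]
    {C' : Set (κ → ℂ)} (φ : DominantMap (affine C) (affine C')) {R : MvPolynomial κ ℂ}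
    (P Q : MvPolynomial ι ℂ) (h : ∀ᶠ v in (affine C).generic,
      eval (φ.toFun v).1 R = eval v.1 P / eval v.1 Q) :
    φ.pullback (polyHom C' R) = polyHom C P / polyHom C Q := by
  refine Subtype.ext ?_
  rw [pullback_polyHom, div_eq_mul_inv]
  refine (Filter.Germ.coe_eq (g := fun v : (affine C).carrier =>
    eval v.1 P * (eval v.1 Q)⁻¹)).2 ?_
  filter_upwards [h] with v hv
  rw [hv, div_eq_mul_inv]

theorem eval_aeval {ι κ : Type} (g : ι → MvPolynomial κ ℂ) (v : κ → ℂ) (P : MvPolynomial ι ℂ) :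
    eval v (aeval g P) = eval (fun i => eval v (g i)) P := by
  induction P using MvPolynomial.induction_on with
  | C a => simp [algebraMap_eq]
  | add p q hp hq => simp only [map_add, hp, hq]
  | mul_X p i hp => simp only [map_mul, hp, aeval_X, eval_X]

/-! ### The Chazy foliations -/

/-- The affine chart `(u, v) ↦ (1 : u : v)` of `ℙ(1,2,3)`. -/
noncomputable def chartP123 : BirationalMap A2 P123 :=
  BirationalMap.ofMorphisms (U := Set.univ)
    (V := {q | Quot.lift (fun v : (affine (punctured 3)).carrier => v.1 0 ≠ 0) (by
      rintro a b ⟨t, ht, h⟩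
      simp [h, wscale, ht]) q})
    (φ := fun u => wproj.mk _ ⟨![1, u.1 0, u.1 1], fun h => one_ne_zero (congrFun h 0)⟩)
    (ψ := Quot.lift (fun v => ⟨![v.1 1 / v.1 0 ^ 2, v.1 2 / v.1 0 ^ 3], trivial⟩) (by
      rintro a b ⟨t, ht, h⟩
      have h2 : t ^ 2 ≠ 0 := pow_ne_zero _ ht
      have h3 : t ^ 3 ≠ 0 := pow_ne_zero _ ht
      refine Subtype.ext ?_
      simp [h, wscale, mul_pow, mul_div_mul_left _ _ h2, mul_div_mul_left _ _ h3]))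
    (by
      refine IsMorphismOn.comp_of_univ (Y := affine (punctured 3))
        (φ := fun u : A2.carrier =>
          ⟨![1, u.1 0, u.1 1], fun h => one_ne_zero (congrFun h 0)⟩) ?_ (isMorphismOn_quot_mk _ _)
      refine isMorphismOn_affine isOpen_univ fun i => ?_
      refine regularOn_div (![1, X 0, X 1] i) 1 fun x _ => ?_
      fin_cases i <;> simp)
    (by
      refine isMorphismOn_quot_desc (isMorphismOn_affine ?_ fun i => ?_)
      · have h := isOpen_polyVal_ne_zero (punctured 3) (X 0)
        simp only [eval_X] at h
        exact h
      · refine regularOn_div (![X 1, X 2] i) (![X 0 ^ 2, X 0 ^ 3] i) fun x hx => ?_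
        have hx' : x.1 0 ≠ 0 := hx
        fin_cases i <;> simp [hx'])
    (by
      intro u _ _
      refine Subtype.ext (_root_.funext fun i => ?_)
      fin_cases i <;> simp [wproj.mk])
    (by
      intro q
      obtain ⟨v, rfl⟩ := Quot.exists_rep q
      intro hv _
      have hv' : v.1 0 ≠ 0 := hv
      refine (Quot.sound ⟨(v.1 0)⁻¹, inv_ne_zero hv', ?_⟩).symm
      funext i
      fin_cases i
      · simp [wscale, hv']
      · simp [wscale, div_eq_inv_mul]
      · simp [wscale, div_eq_inv_mul])
    ⟨⟨0, trivial⟩, trivial, one_ne_zero⟩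

theorem chartP123_inverse_mk (v : (affine (punctured 3)).carrier) :
    (chartP123.inverse.toFun (wproj.mk _ v)).1 = ![v.1 1 / v.1 0 ^ 2, v.1 2 / v.1 0 ^ 3] := rfl

/-- The components of the vector field induced on `ℙ(1,2,3)` by `x⁻¹ W`, in the chart `x = 1`. -/
noncomputable def chartField (P : MvPolynomial (Fin 3) ℂ) : Fin 2 → MvPolynomial (Fin 2) ℂ :=
  ![X 1 - 2 * X 0 ^ 2, aeval ![1, X 0, X 1] P - 3 * X 0 * X 1]

/-- The projection of `W / x` to the chart `x = 1` of `ℙ(1,2,3)`. -/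
theorem pullback_chartField {C : Set (Fin 3 → ℂ)} [IrreducibleSpace (affine C).carrier]
    {P : MvPolynomial (Fin 3) ℂ} (hP : ∀ t v, eval (wscale ![1, 2, 3] t v) P = t ^ 4 * eval v P)
    {W : VectorField (affine C)} (hW : ∀ i, W (polyHom C (X i)) = polyHom C (odeField P i))
    {D : VectorField A2} (hD : ∀ i, D (polyHom _ (X i)) = polyHom _ (chartField P i))
    (hx : polyHom C (X 0) ≠ 0) (γ : DominantMap (affine C) A2)
    (hγ : ∀ᶠ v in (affine C).generic,
      (γ.toFun v).1 = ![v.1 1 / v.1 0 ^ 2, v.1 2 / v.1 0 ^ 3] ∧ v.1 0 ≠ 0) (i : Fin 2) :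
    γ.pullback (D (polyHom _ (X i))) =
      (polyHom C (X 0))⁻¹ * W (γ.pullback (polyHom _ (X i))) := by
  have h0 : γ.pullback (polyHom _ (X 0)) = polyHom C (X 1) / polyHom C (X 0) ^ 2 := by
    rw [← map_pow]
    refine pullback_eq_div γ _ _ ?_
    filter_upwards [hγ] with v hv
    simp [hv.1]
  have h1 : γ.pullback (polyHom _ (X 1)) = polyHom C (X 2) / polyHom C (X 0) ^ 3 := by
    rw [← map_pow]
    refine pullback_eq_div γ _ _ ?_
    filter_upwards [hγ] with v hv
    simp [hv.1]
  have hp : γ.pullback (polyHom _ (aeval ![1, X 0, X 1] P)) =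
      polyHom C P / polyHom C (X 0) ^ 4 := by
    rw [← map_pow]
    refine pullback_eq_div γ _ _ ?_
    filter_upwards [hγ] with v hv
    have e1 : eval (γ.toFun v).1 (aeval ![1, X 0, X 1] P) =
        eval (wscale ![1, 2, 3] (v.1 0)⁻¹ v.1) P := by
      rw [eval_aeval]
      congr 1
      congr 1
      funext j
      rw [hv.1]
      fin_cases j
      · simp [wscale, hv.2]
      · simp [wscale, div_eq_inv_mul]
      · simp [wscale, div_eq_inv_mul]
    rw [e1, hP]
    simp [div_eq_inv_mul]
  have hW0 : W (polyHom C (X 0)) = polyHom C (X 1) := hW 0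
  have hW1 : W (polyHom C (X 1)) = polyHom C (X 2) := hW 1
  have hW2 : W (polyHom C (X 2)) = polyHom C P := hW 2
  rw [hD]
  fin_cases i
  · simp only [Fin.zero_eta, chartField, Matrix.cons_val_zero, map_sub, map_mul, map_pow,
      map_ofNat, h0, h1, Derivation.leibniz_div, Derivation.leibniz_pow, hW0, hW1, smul_eq_mul,
      nsmul_eq_mul]
    field_simp
    push_cast
    ring
  · simp only [Fin.mk_one, chartField, Matrix.cons_val_one, map_sub, map_mul, map_ofNat,
      h0, h1, hp, Derivation.leibniz_div, Derivation.leibniz_pow, hW0, hW2, smul_eq_mul,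
      nsmul_eq_mul, Matrix.cons_val_fin_one]
    field_simp
    push_cast
    ring

theorem exists_chartField (P : MvPolynomial (Fin 3) ℂ) :
    ∃ D : VectorField A2, D ≠ 0 ∧ ∀ i, D (polyHom _ (X i)) = polyHom _ (chartField P i) := by
  obtain ⟨D, hD⟩ := exists_vectorField (C := (Set.univ : Set (Fin 2 → ℂ)))
    (eq_zero_of_eval_eq_zero one_ne_zero fun _ _ => trivial)
    (fun i => polyHom _ (chartField P i))
  refine ⟨D, ?_, hD⟩
  rintro rfl
  refine polyHom_ne_zero (C := (Set.univ : Set (Fin 2 → ℂ))) (P := chartField P 0) (v := ![0, 1])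
    trivial ?_ (hD 0).symm
  simp [chartField]

theorem generic_X_ne_zero {ι : Type} {C : Set (ι → ℂ)} [IrreducibleSpace (affine C).carrier]
    {i : ι} (h : ∃ v ∈ C, v i ≠ 0) : ∀ᶠ v in (affine C).generic, v.1 i ≠ 0 := by
  obtain ⟨v, hv, hvi⟩ := h
  have := isOpen_polyVal_ne_zero C (X i)
  simp only [eval_X] at this
  exact mem_generic_of_isOpen this ⟨⟨v, hv⟩, hvi⟩

/-- The Chazy foliation in the chart `x = 1`. -/
theorem chazyFoliation_eq_line {P : MvPolynomial (Fin 3) ℂ}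
    (hP : ∀ t v, eval (wscale ![1, 2, 3] t v) P = t ^ 4 * eval v P) {D : VectorField A2}
    (hD0 : D ≠ 0) (hD : ∀ i, D (polyHom _ (X i)) = polyHom _ (chartField P i)) :
    chazyFoliation P = line (chartP123.transport D) := by
  obtain ⟨W, hW⟩ := exists_vectorField eq_zero_of_eval_punctured
    (fun i => polyHom _ (odeField P i))
  have hx : ∃ v ∈ punctured 3, v 0 ≠ 0 :=
    ⟨fun _ => 1, fun h => one_ne_zero (congrFun h 0), one_ne_zero⟩
  have hx0 : polyHom (punctured 3) (X 0) ≠ 0 := by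
    obtain ⟨v, hv, hv0⟩ := hx
    exact polyHom_ne_zero hv (by simpa using hv0)
  have key := pullback_chartField hP hW hD hx0
    ((quotMap (affine (punctured 3)) _).comp chartP123.inverse) (by
      filter_upwards [generic_X_ne_zero hx] with v hv
      exact ⟨rfl, hv⟩)
  -- `W` raises weights by one and so is not projectable itself; the multiple `x⁻¹ W`, of weight
  -- zero, spans the same line and is.
  refine push_eq_line_transport (quotMap (affine (punctured 3)) _) chartP123
    (δ₁ := (polyHom (punctured 3) (X 0))⁻¹ • W) hD0 key ?_ ?_
  · intro k
    refine ⟨k * (polyHom (punctured 3) (X 0))⁻¹, fun i => ?_⟩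
    change k * ((polyHom (punctured 3) (X 0))⁻¹ * W (polyHom _ (X i))) = _
    rw [hW, mul_assoc]
    rfl
  · rintro δ ⟨h, hδ⟩
    refine ⟨h * polyHom (punctured 3) (X 0), fun i => ?_⟩
    have : δ = h • W := vectorField_ext fun i => (hδ i).trans (congrArg (h * ·) (hW i)).symm
    rw [this]
    change h * W _ = h * polyHom (punctured 3) (X 0) * ((polyHom (punctured 3) (X 0))⁻¹ * W _)
    field_simp

/-! ### The main reduction -/

/-- An equivariant birational map to a level set of a first integral, compatible with the vector
fields, induces an equivalence of foliations. -/
theorem inducesEquivalence {S : FunSpace} [IrreducibleSpace S.carrier] {T : S.carrier → S.carrier}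
    {P B : MvPolynomial (Fin 3) ℂ} [IrreducibleSpace (affine (level B)).carrier] {n : ℕ} {ζ : ℂ}
    (hP : ∀ t v, eval (wscale ![1, 2, 3] t v) P = t ^ 4 * eval v P)
    (hB : ∀ t v, eval (wscale ![1, 2, 3] t v) B = t ^ n * eval v B) (hn : 0 < n)
    (hζ : IsPrimitiveRoot ζ n) (hx : ∃ v ∈ level B, v 0 ≠ 0)
    (hT : Continuous T) (hTn : ∀ p, T^[n] p = p) (Φ : BirationalMap S (affine (level B)))
    {δ : VectorField S}
    (hδ : ∀ i, Φ.pullback (polyHom _ (odeField P i)) = δ (Φ.pullback (polyHom _ (X i))))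
    (heq : ∀ᶠ p in S.generic, (Φ.toFun (T p)).1 = wscale ![1, 2, 3] ζ (Φ.toFun p).1) :
    (∀ (M : FunSpace) (ρ : BirationalMap M (cyclicQuot S T)),
      BirationallyEquivalent (chazyFoliation P)
        (pull ρ.toFun (push (cyclicQuot.mk S T) (line δ)))) ∧
    InducesEquivalence T (line δ) P B ζ Φ := by
  have hW : ∀ i, Φ.transport δ (polyHom _ (X i)) = polyHom _ (odeField P i) := by
    intro i
    rw [BirationalMap.transport_apply, ← hδ, Φ.pullback_inverse_pullback]
  have hline : lineField (level B) (odeField P) = line (Φ.transport δ) := by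
    ext ε
    constructor
    · rintro ⟨h, hε⟩
      exact ⟨h, vectorField_ext fun i => (hε i).trans (congrArg (h * ·) (hW i)).symm⟩
    · rintro ⟨h, rfl⟩
      exact ⟨h, fun i => congrArg (h * ·) (hW i)⟩
  obtain ⟨D, hD0, hD⟩ := exists_chartField P
  have hch := chazyFoliation_eq_line hP hD0 hD
  have hx0 : polyHom (level B) (X 0) ≠ 0 := by
    obtain ⟨v, hv, hv0⟩ := hx
    exact polyHom_ne_zero hv (by simpa using hv0)
  obtain ⟨Ψ₂, hΨ₂⟩ := exists_level_quot_birational hB hn hζ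
  obtain ⟨Ψ₁, hΨ₁⟩ := exists_quot_birational Φ (T' := levelScale hB hζ.pow_eq_one) hT hn hTn
    (fun v => Subtype.ext (by rw [iterate_levelScale, hζ.pow_eq_one, wscale_one]))
    (heq.mono fun p hp => Subtype.ext hp)
  let γ : DominantMap (affine (level B)) A2 :=
    ((quotMap (affine (level B)) _).comp Ψ₂.toDominantMap).comp chartP123.inverse
  have key := pullback_chartField hP hW hD hx0 γ (by
      filter_upwards [generic_X_ne_zero hx] with v hv
      refine ⟨?_, hv⟩
      have : γ.toFun v = chartP123.inverse.toFun (wproj.mk _ ⟨v.1, level_ne_zero hB hn v.2⟩) :=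
        congrArg chartP123.inverse.toFun (hΨ₂ v)
      exact (congrArg Subtype.val this).trans (chartP123_inverse_mk _))
  have key' : ∀ G, γ.pullback (D G) = (polyHom (level B) (X 0))⁻¹ * Φ.transport δ (γ.pullback G) :=
    map_derivation_eq γ.pullback D ((polyHom (level B) (X 0))⁻¹ • Φ.transport δ) key
  let Ψ := Ψ₁.trans Ψ₂
  -- Rather than descending a field from `S`, the generator on `S/T` is brought back from the chart
  -- of ℙ(1,2,3); that it is the image of a multiple of `δ` is then checked on functions pulled back
  -- from the chart.
  let δT := Ψ.symm.transport (chartP123.transport D)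
  have hδT : δT ≠ 0 := BirationalMap.transport_ne_zero _ (BirationalMap.transport_ne_zero _ hD0)
  have hΨΦ : ∀ᶠ p in S.generic, Ψ.toFun (cyclicQuot.mk S T p) =
      wproj.mk ![1, 2, 3] ⟨(Φ.toFun p).1, level_ne_zero hB hn (Φ.toFun p).2⟩ := by
    filter_upwards [hΨ₁] with p hp
    exact (congrArg Ψ₂.toFun hp).trans (hΨ₂ _)
  -- The routes from S to the chart through S/T and through Σ agree generically.
  have hπ : ((quotMap S _).comp (Ψ.toDominantMap.comp chartP123.inverse)).pullback =
      (Φ.toDominantMap.comp γ).pullback := by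
    refine DominantMap.pullback_congr _ _ ?_
    filter_upwards [hΨ₁] with p hp
    exact congrArg (fun q => chartP123.inverse.toFun (Ψ₂.toFun q)) hp
  have hF0 : (Φ.pullback (polyHom (level B) (X 0)))⁻¹ ≠ 0 :=
    inv_ne_zero ((map_ne_zero Φ.pullback).2 hx0)
  have hpush : push (cyclicQuot.mk S T) (line δ) = line δT := by
    -- `δ` corresponds to `W`, while only `x⁻¹ W` comes from the quotient. The generator is rescaled
    -- by the inverse of the pull-back of x, which does not change its line.
    rw [← line_smul δ hF0]
    refine push_line (quotMap S _) hδT fun g => ?_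
    obtain ⟨h, rfl⟩ : ∃ h, g = Ψ.pullback h := ⟨_, (Ψ.pullback_pullback_inverse g).symm⟩
    obtain ⟨G, rfl⟩ : ∃ G, h = chartP123.inverse.pullback G :=
      ⟨_, (chartP123.pullback_inverse_pullback h).symm⟩
    have e : ∀ G, (quotMap S _).pullback (Ψ.pullback (chartP123.inverse.pullback G)) =
        Φ.pullback (γ.pullback G) := fun G =>
      calc (quotMap S _).pullback (Ψ.pullback (chartP123.inverse.pullback G))
        _ = (quotMap S _).pullback ((Ψ.toDominantMap.comp chartP123.inverse).pullback G) :=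
          congrArg _ (DominantMap.pullback_comp _ _ G).symm
        _ = ((quotMap S _).comp (Ψ.toDominantMap.comp chartP123.inverse)).pullback G :=
          (DominantMap.pullback_comp _ _ G).symm
        _ = (Φ.toDominantMap.comp γ).pullback G := DFunLike.congr_fun hπ G
        _ = Φ.pullback (γ.pullback G) := DominantMap.pullback_comp _ _ G
    have e1 : δT (Ψ.pullback (chartP123.inverse.pullback G)) =
        Ψ.pullback (chartP123.inverse.pullback (D G)) := by
      rw [← BirationalMap.transport_inverse_pullback]
      exact Ψ.symm.transport_inverse_pullback _ _
    refine (congrArg (quotMap S _).pullback e1).trans ((e _).trans ?_)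
    rw [key', map_mul, map_inv₀, Φ.pullback_transport]
    exact congrArg (fun a => (Φ.pullback (polyHom (level B) (X 0)))⁻¹ * δ a) (e G).symm
  have hchazy : push Ψ.toFun (line δT) = chazyFoliation P := by
    rw [hch, Ψ.push_line]
    refine congrArg line (Derivation.ext fun g => ?_)
    rw [BirationalMap.transport_apply]
    have : δT (Ψ.pullback g) = Ψ.pullback (chartP123.transport D g) :=
      Ψ.symm.transport_inverse_pullback _ _
    rw [this, Ψ.pullback_inverse_pullback]
  refine ⟨fun M ρ => ?_, ?_, heq, Ψ, ?_, ?_⟩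
  · rw [hpush, ← hchazy]
    exact birationallyEquivalent_pull Ψ ρ hδT
  · rw [hline, Φ.push_line]
  · filter_upwards [hΨΦ] with p hp
    exact ⟨_, hp⟩
  · rw [hpush, hchazy]

/-! ### Jets of rational functions of two variables -/

/-- The components of the vector field `c (α x ∂/∂x + b y ∂/∂y)`. -/
noncomputable def torusField (c α b : ℂ) : Fin 2 → MvPolynomial (Fin 2) ℂ :=
  ![C (c * α) * X 0, C (c * b) * X 1]

/-- The derivation `c (α x ∂/∂x + b y ∂/∂y)` of the ring of polynomials. -/
noncomputable def torusDer (c α b : ℂ) :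
    Derivation ℂ (MvPolynomial (Fin 2) ℂ) (MvPolynomial (Fin 2) ℂ) :=
  mkDerivation ℂ (torusField c α b)

theorem torusDer_X_zero (c α b : ℂ) : torusDer c α b (X 0) = C (c * α) * X 0 :=
  mkDerivation_X _ _ _

theorem torusDer_X_one (c α b : ℂ) : torusDer c α b (X 1) = C (c * b) * X 1 :=
  mkDerivation_X _ _ _

theorem torusDer_eq (c α b : ℂ) (N : MvPolynomial (Fin 2) ℂ) :
    torusDer c α b N = C (c * α) * X 0 * pderiv 0 N + C (c * b) * X 1 * pderiv 1 N := by
  have : torusDer c α b = (C (c * α) * X 0 : MvPolynomial (Fin 2) ℂ) • pderiv 0 +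
      (C (c * b) * X 1 : MvPolynomial (Fin 2) ℂ) • pderiv 1 := by
    refine derivation_ext fun i => ?_
    fin_cases i
    · simp [torusDer_X_zero]
    · simp [torusDer_X_one]
  rw [this]
  rfl

theorem hasDerivAt_eval_fst (P : MvPolynomial (Fin 2) ℂ) (x y : ℂ) :
    HasDerivAt (fun s => eval ![s, y] P) (eval ![x, y] (pderiv 0 P)) x := by
  induction P using MvPolynomial.induction_on with
  | C a => simpa using hasDerivAt_const x a
  | add p q hp hq =>
    exact ((hp.add hq).congr_deriv (by simp)).congr_of_eventuallyEq
      (Filter.Eventually.of_forall fun s => by simp)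
  | mul_X p i hp =>
    fin_cases i
    · exact ((hp.mul (hasDerivAt_id x)).congr_deriv
        (by simp [add_comm, mul_comm])).congr_of_eventuallyEq
        (Filter.Eventually.of_forall fun s => by simp)
    · exact ((hp.mul (hasDerivAt_const x y)).congr_deriv
        (by simp [add_comm, mul_comm])).congr_of_eventuallyEq
        (Filter.Eventually.of_forall fun s => by simp)

theorem hasDerivAt_eval_snd (P : MvPolynomial (Fin 2) ℂ) (x y : ℂ) :
    HasDerivAt (fun s => eval ![x, s] P) (eval ![x, y] (pderiv 1 P)) y := by
  induction P using MvPolynomial.induction_on with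
  | C a => simpa using hasDerivAt_const y a
  | add p q hp hq =>
    exact ((hp.add hq).congr_deriv (by simp)).congr_of_eventuallyEq
      (Filter.Eventually.of_forall fun s => by simp)
  | mul_X p i hp =>
    fin_cases i
    · exact ((hp.mul (hasDerivAt_const y x)).congr_deriv
        (by simp [add_comm, mul_comm])).congr_of_eventuallyEq
        (Filter.Eventually.of_forall fun s => by simp)
    · exact ((hp.mul (hasDerivAt_id y)).congr_deriv
        (by simp [add_comm, mul_comm])).congr_of_eventuallyEq
        (Filter.Eventually.of_forall fun s => by simp)

/-- The quotient rule for N/Δ^(k+1), with the common factor Δ^k cancelled. The formula for `F` is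
only assumed where Δ ≠ 0, which suffices because this condition persists near the point on both
coordinate lines; hence the lemma can be iterated. -/
theorem linD_div {c α b : ℂ} {F : ℂ → ℂ → ℂ} {N Δ : MvPolynomial (Fin 2) ℂ} (k : ℕ)
    (hF : ∀ x y, eval ![x, y] Δ ≠ 0 → F x y = eval ![x, y] N / eval ![x, y] Δ ^ (k + 1)) {x y : ℂ}
    (h : eval ![x, y] Δ ≠ 0) :
    linD c α b F x y = eval ![x, y] (torusDer c α b N * Δ - (k + 1) * N * torusDer c α b Δ) /
      eval ![x, y] Δ ^ (k + 2) := by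
  have h0 : ∀ᶠ s in nhds x, eval ![s, y] Δ ≠ 0 :=
    (hasDerivAt_eval_fst Δ x y).continuousAt.eventually_ne h
  have h1 : ∀ᶠ s in nhds y, eval ![x, s] Δ ≠ 0 :=
    (hasDerivAt_eval_snd Δ x y).continuousAt.eventually_ne h
  have e0 : deriv (fun s => F s y) x = _ :=
    (((hasDerivAt_eval_fst N x y).div ((hasDerivAt_eval_fst Δ x y).pow (k + 1))
      (pow_ne_zero _ h)).congr_of_eventuallyEq (h0.mono fun s hs => hF s y hs)).deriv
  have e1 : deriv (fun s => F x s) y = _ :=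
    (((hasDerivAt_eval_snd N x y).div ((hasDerivAt_eval_snd Δ x y).pow (k + 1))
      (pow_ne_zero _ h)).congr_of_eventuallyEq (h1.mono fun s hs => hF x s hs)).deriv
  rw [linD, e0, e1, torusDer_eq, torusDer_eq]
  simp only [map_sub, map_mul, map_add, eval_C, eval_X, map_natCast, map_one, Nat.add_sub_cancel,
    Matrix.cons_val_zero, Matrix.cons_val_one, Nat.cast_add, Nat.cast_one, Matrix.cons_val_fin_one,
    Pi.pow_apply]
  field_simp
  ring

/-! ### Maps to level sets -/

/-- Polynomials `J₀, J₁, J₂, Δ` such that `f = J₀ / Δ` is a solution of `D³f = P(f, Df, D²f)` with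
`Df = J₁ / Δ²`, `D²f = J₂ / Δ³` and `B(f, Df, D²f) = 1`. -/
structure IsSolution (c α b : ℂ) (P B : MvPolynomial (Fin 3) ℂ) (n : ℕ)
    (J : Fin 3 → MvPolynomial (Fin 2) ℂ) (Δ : MvPolynomial (Fin 2) ℂ) : Prop where
  first : torusDer c α b (J 0) * Δ - J 0 * torusDer c α b Δ = J 1
  second : torusDer c α b (J 1) * Δ - 2 * J 1 * torusDer c α b Δ = J 2
  third : torusDer c α b (J 2) * Δ - 3 * J 2 * torusDer c α b Δ = aeval J P
  integral : aeval J B = Δ ^ n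
  weight_eqn : ∀ t v, eval (wscale ![1, 2, 3] t v) P = t ^ 4 * eval v P
  weight_integral : ∀ t v, eval (wscale ![1, 2, 3] t v) B = t ^ n * eval v B

/-- The point with coordinates `J₀ / Δ`, `J₁ / Δ²`, `J₂ / Δ³`. -/
noncomputable def jetPoint (J : Fin 3 → MvPolynomial (Fin 2) ℂ) (Δ : MvPolynomial (Fin 2) ℂ)
    (u : Fin 2 → ℂ) : Fin 3 → ℂ :=
  wscale ![1, 2, 3] (eval u Δ)⁻¹ fun i => eval u (J i)

namespace IsSolution

variable {c α b : ℂ} {P B : MvPolynomial (Fin 3) ℂ} {n : ℕ} {J : Fin 3 → MvPolynomial (Fin 2) ℂ}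
  {Δ : MvPolynomial (Fin 2) ℂ}

/-- Connects the analytic derivatives in `jet` with the algebraic derivation `torusDer`. -/
theorem jet_eq (hJ : IsSolution c α b P B n J Δ) {f : ℂ → ℂ → ℂ}
    (hf : ∀ x y, f x y = eval ![x, y] (J 0) / eval ![x, y] Δ) {x y : ℂ}
    (h : eval ![x, y] Δ ≠ 0) : jet c α b f x y = jetPoint J Δ ![x, y] := by
  have h1 : ∀ x y, eval ![x, y] Δ ≠ 0 →
      linD c α b f x y = eval ![x, y] (J 1) / eval ![x, y] Δ ^ (1 + 1) := by
    intro x y h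
    rw [linD_div 0 (fun x y _ => by rw [hf, zero_add, pow_one]) h, ← hJ.first]
    simp
  have h2 : linD c α b (linD c α b f) x y = eval ![x, y] (J 2) / eval ![x, y] Δ ^ 3 := by
    rw [linD_div 1 h1 h, ← hJ.second]
    norm_num
  rw [jet, h1 x y h, h2, hf]
  funext i
  fin_cases i <;> simp [jetPoint, wscale, div_eq_inv_mul]

theorem jetPoint_mem (hJ : IsSolution c α b P B n J Δ) {u : Fin 2 → ℂ} (h : eval u Δ ≠ 0) :
    jetPoint J Δ u ∈ level B := by
  change eval _ B = 1
  rw [jetPoint, hJ.weight_integral, ← eval_aeval, hJ.integral, map_pow, ← mul_pow,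
    inv_mul_cancel₀ h, one_pow]

open Classical in
/-- The map `J₀ / Δ, J₁ / Δ², J₂ / Δ³` to the level set, with an arbitrary value on `Δ = 0`. -/
noncomputable def toLevel (hJ : IsSolution c α b P B n J Δ) (v₁ : (affine (level B)).carrier)
    (u : A2.carrier) : (affine (level B)).carrier :=
  if h : eval u.1 Δ ≠ 0 then ⟨jetPoint J Δ u.1, hJ.jetPoint_mem h⟩ else v₁

theorem toLevel_of_ne (hJ : IsSolution c α b P B n J Δ) (v₁ : (affine (level B)).carrier)
    {u : A2.carrier} (h : eval u.1 Δ ≠ 0) : (hJ.toLevel v₁ u).1 = jetPoint J Δ u.1 := by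
  exact congrArg Subtype.val (dif_pos h)

/-- A single point where the inverse formulas make sense shows that the open sets Δ ≠ 0 and H ≠ 0
correspond somewhere; by irreducibility this is enough for birationality. -/
theorem exists_toLevel_mem (hJ : IsSolution c α b P B n J Δ) (v₁ : (affine (level B)).carrier)
    {p m : Fin 2 → MvPolynomial (Fin 3) ℂ} {H : MvPolynomial (Fin 3) ℂ}
    (hr : ∀ v ∈ level B, eval v H ≠ 0 → eval (fun i => eval v (p i) / eval v (m i)) Δ ≠ 0 →
      jetPoint J Δ (fun i => eval v (p i) / eval v (m i)) = v)
    (hne : ∃ v ∈ level B, eval v H ≠ 0 ∧ eval (fun i => eval v (p i) / eval v (m i)) Δ ≠ 0) :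
    ∃ u : A2.carrier, u ∈ {u : A2.carrier | eval u.1 Δ ≠ 0} ∧
      hJ.toLevel v₁ u ∈ {v : (affine (level B)).carrier | eval v.1 H ≠ 0} := by
  obtain ⟨v, hvB, hv, hu⟩ := hne
  let u : A2.carrier := ⟨fun i => eval v (p i) / eval v (m i), trivial⟩
  have hu' : eval u.1 Δ ≠ 0 := hu
  have e : (hJ.toLevel v₁ u).1 = v := (hJ.toLevel_of_ne v₁ hu').trans (hr v hvB hv hu)
  refine ⟨u, hu', ?_⟩
  change eval (hJ.toLevel v₁ u).1 H ≠ 0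
  rw [e]
  exact hv

/-- The birational map to the level set, given its inverse. -/
noncomputable def birationalMap [IrreducibleSpace (affine (level B)).carrier]
    (hJ : IsSolution c α b P B n J Δ)
    {p m : Fin 2 → MvPolynomial (Fin 3) ℂ} {H : MvPolynomial (Fin 3) ℂ}
    (hl : ∀ u i, eval u Δ ≠ 0 →
      eval (jetPoint J Δ u) (p i) = u i * eval (jetPoint J Δ u) (m i))
    (hm : ∀ v i, eval v H ≠ 0 → eval v (m i) ≠ 0)
    (hr : ∀ v ∈ level B, eval v H ≠ 0 → eval (fun i => eval v (p i) / eval v (m i)) Δ ≠ 0 →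
      jetPoint J Δ (fun i => eval v (p i) / eval v (m i)) = v)
    (hne : ∃ v ∈ level B, eval v H ≠ 0 ∧ eval (fun i => eval v (p i) / eval v (m i)) Δ ≠ 0)
    (v₁ : (affine (level B)).carrier) : BirationalMap A2 (affine (level B)) :=
  BirationalMap.ofMorphisms (U := {u | eval u.1 Δ ≠ 0}) (V := {v | eval v.1 H ≠ 0})
    (φ := hJ.toLevel v₁) (ψ := fun v => ⟨fun i => eval v.1 (p i) / eval v.1 (m i), trivial⟩)
    (isMorphismOn_affine (isOpen_polyVal_ne_zero _ Δ) fun i =>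
      regularOn_div (J i) (Δ ^ (![1, 2, 3] i : ℕ)) fun u hu => by
        have hu' : eval u.1 Δ ≠ 0 := hu
        rw [hJ.toLevel_of_ne v₁ hu', map_pow]
        exact ⟨pow_ne_zero _ hu', by simp [jetPoint, wscale, div_eq_inv_mul]⟩)
    (isMorphismOn_affine (isOpen_polyVal_ne_zero _ H) fun i =>
      regularOn_div (p i) (m i) fun v hv => ⟨hm _ _ hv, rfl⟩)
    (by
      intro u hu hv
      have hu' : eval u.1 Δ ≠ 0 := hu
      have hv' : eval (hJ.toLevel v₁ u).1 H ≠ 0 := hv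
      rw [hJ.toLevel_of_ne v₁ hu'] at hv'
      refine Subtype.ext (_root_.funext fun i => ?_)
      change eval (hJ.toLevel v₁ u).1 (p i) / eval (hJ.toLevel v₁ u).1 (m i) = u.1 i
      rw [hJ.toLevel_of_ne v₁ hu', hl _ i hu', mul_div_cancel_right₀ _ (hm _ i hv')])
    (by
      intro v hv hu
      refine Subtype.ext ?_
      rw [hJ.toLevel_of_ne v₁ hu]
      exact hr v.1 v.2 hv hu)
    (hJ.exists_toLevel_mem v₁ hr hne)

end IsSolution

/-- The vector field `c (α x ∂/∂x + b y ∂/∂y)` on the affine plane. -/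
theorem exists_torusField (c α b : ℂ) :
    ∃ D : VectorField A2, ∀ N, D (polyHom _ N) = polyHom _ (torusDer c α b N) := by
  obtain ⟨D, hD⟩ := exists_vectorField (C := (Set.univ : Set (Fin 2 → ℂ)))
    (eq_zero_of_eval_eq_zero one_ne_zero fun _ _ => trivial)
    (fun i => polyHom _ (torusField c α b i))
  exact ⟨D, derivation_polyHom hD⟩

namespace IsSolution

variable {c α b : ℂ} {P B : MvPolynomial (Fin 3) ℂ} {n : ℕ} {J : Fin 3 → MvPolynomial (Fin 2) ℂ}
  {Δ : MvPolynomial (Fin 2) ℂ}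

/-- A weighted homogeneous R of degree k pulls back to R(J)/Δ^k. The differential equations of
`IsSolution` are then the quotient rule for J₀/Δ, J₁/Δ² and J₂/Δ³, so `D` corresponds to `W`. -/
theorem pullback_odeField (hJ : IsSolution c α b P B n J Δ)
    (Φ : BirationalMap A2 (affine (level B)))
    (hΦ : ∀ u : A2.carrier, eval u.1 Δ ≠ 0 → (Φ.toFun u).1 = jetPoint J Δ u.1)
    (hΔ : ∃ u, eval u Δ ≠ 0) {D : VectorField A2}
    (hD : ∀ N, D (polyHom _ N) = polyHom _ (torusDer c α b N)) (i : Fin 3) :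
    Φ.pullback (polyHom _ (odeField P i)) = D (Φ.pullback (polyHom _ (X i))) := by
  obtain ⟨u₀, hu₀⟩ := hΔ
  have hgen : ∀ᶠ u in A2.generic, eval u.1 Δ ≠ 0 :=
    mem_generic_of_isOpen (isOpen_polyVal_ne_zero _ Δ) ⟨⟨u₀, trivial⟩, hu₀⟩
  have hΔ0 : polyHom (Set.univ : Set (Fin 2 → ℂ)) Δ ≠ 0 := polyHom_ne_zero trivial hu₀
  have key : ∀ (R : MvPolynomial (Fin 3) ℂ) (k : ℕ),
      (∀ t v, eval (wscale ![1, 2, 3] t v) R = t ^ k * eval v R) →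
      Φ.pullback (polyHom _ R) =
        polyHom (Set.univ : Set (Fin 2 → ℂ)) (aeval J R) / polyHom _ Δ ^ k := by
    intro R k hR
    rw [← map_pow]
    refine pullback_eq_div Φ.toDominantMap _ _ ?_
    filter_upwards [hgen] with u hu
    rw [hΦ u hu, jetPoint, hR, eval_aeval, map_pow, inv_pow, div_eq_inv_mul]
  have h0 := key (X 0) 1 fun t v => by simp [wscale]
  have h1 := key (X 1) 2 fun t v => by simp [wscale]
  have h2 := key (X 2) 3 fun t v => by simp [wscale]
  have h3 := key P 4 hJ.weight_eqn
  rw [aeval_X] at h0 h1 h2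
  rw [← hJ.first] at h1
  rw [← hJ.second] at h2
  rw [← hJ.third] at h3
  simp only [map_sub, map_mul, map_ofNat] at h1 h2 h3
  fin_cases i
  · change Φ.pullback (polyHom _ (X 1)) = D (Φ.pullback (polyHom _ (X 0)))
    rw [h0, h1, pow_one, Derivation.leibniz_div, hD, hD]
    simp only [smul_eq_mul]
    field_simp
  · change Φ.pullback (polyHom _ (X 2)) = D (Φ.pullback (polyHom _ (X 1)))
    have h1' := key (X 1) 2 fun t v => by simp [wscale]
    rw [aeval_X] at h1'
    rw [h1', h2, Derivation.leibniz_div, Derivation.leibniz_pow, hD, hD]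
    simp only [smul_eq_mul, nsmul_eq_mul]
    field_simp
    push_cast
    ring
  · change Φ.pullback (polyHom _ P) = D (Φ.pullback (polyHom _ (X 2)))
    have h2' := key (X 2) 3 fun t v => by simp [wscale]
    rw [aeval_X] at h2'
    rw [h2', h3, Derivation.leibniz_div, Derivation.leibniz_pow, hD, hD]
    simp only [smul_eq_mul, nsmul_eq_mul]
    field_simp
    push_cast
    ring

/-- The equivalence of foliations induced by a solution. -/
theorem exists_equivalence (hJ : IsSolution c α b P B n J Δ) {S : FunSpace}
    [IrreducibleSpace S.carrier] [IrreducibleSpace (affine (level B)).carrier]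
    {T : S.carrier → S.carrier} {ζ : ℂ} (hn : 0 < n)
    (hζ : IsPrimitiveRoot ζ n) (hx : ∃ v ∈ level B, v 0 ≠ 0) (hT : Continuous T)
    (hTn : ∀ p, T^[n] p = p) (β : BirationalMap A2 S) {E : Set (VectorField S)}
    {D : VectorField A2} (hD : ∀ N, D (polyHom _ N) = polyHom _ (torusDer c α b N))
    (hE : E = line (β.transport D))
    (Φ : BirationalMap A2 (affine (level B)))
    (hΦ : ∀ u : A2.carrier, eval u.1 Δ ≠ 0 → (Φ.toFun u).1 = jetPoint J Δ u.1)
    (hΔ : ∃ u, eval u Δ ≠ 0)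
    (heq : ∀ᶠ p in S.generic, ∃ μ : ℂ, μ ≠ 0 ∧
      eval (β.inverse.toFun (T p)).1 Δ = μ * eval (β.inverse.toFun p).1 Δ ∧
      ∀ i, eval (β.inverse.toFun (T p)).1 (J i) =
        (ζ * μ) ^ (![1, 2, 3] i : ℕ) * eval (β.inverse.toFun p).1 (J i)) :
    (∀ (M : FunSpace) (ρ : BirationalMap M (cyclicQuot S T)),
      BirationallyEquivalent (chazyFoliation P) (pull ρ.toFun (push (cyclicQuot.mk S T) E))) ∧
    ∃ Φ' : BirationalMap S (affine (level B)),
      (∀ p, eval (β.inverse.toFun p).1 Δ ≠ 0 →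
        (Φ'.toFun p).1 = jetPoint J Δ (β.inverse.toFun p).1) ∧
      InducesEquivalence T E P B ζ Φ' := by
  subst hE
  have hgen : ∀ᶠ p in S.generic, eval (β.inverse.toFun p).1 Δ ≠ 0 := by
    obtain ⟨u₀, hu₀⟩ := hΔ
    exact β.inverse.tendsto.eventually
      (mem_generic_of_isOpen (isOpen_polyVal_ne_zero _ Δ) ⟨⟨u₀, trivial⟩, hu₀⟩)
  have key := inducesEquivalence hJ.weight_eqn hJ.weight_integral hn hζ hx hT hTn (β.symm.trans Φ)
    (δ := β.transport D) ?_ ?_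
  · exact ⟨key.1, β.symm.trans Φ, fun p hp => hΦ _ hp, key.2⟩
  · intro i
    have h1 : (β.symm.trans Φ).pullback (polyHom _ (odeField P i)) =
        β.inverse.pullback (Φ.pullback (polyHom _ (odeField P i))) :=
      DominantMap.pullback_comp _ _ _
    have h2 : (β.symm.trans Φ).pullback (polyHom _ (X i)) =
        β.inverse.pullback (Φ.pullback (polyHom _ (X i))) :=
      DominantMap.pullback_comp _ _ _
    rw [h1, h2, hJ.pullback_odeField Φ hΦ hΔ hD, β.transport_inverse_pullback]
  · filter_upwards [hgen, heq] with p hp ⟨μ, hμ, h1, h2⟩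
    have hTp : eval (β.inverse.toFun (T p)).1 Δ ≠ 0 := by
      rw [h1]
      exact mul_ne_zero hμ hp
    refine (hΦ _ hTp).trans (Eq.trans ?_ (congrArg (wscale ![1, 2, 3] ζ) (hΦ _ hp)).symm)
    funext i
    change ((eval (β.inverse.toFun (T p)).1 Δ)⁻¹) ^ _ * eval (β.inverse.toFun (T p)).1 (J i) =
      ζ ^ _ * ((eval (β.inverse.toFun p).1 Δ)⁻¹ ^ _ * eval (β.inverse.toFun p).1 (J i))
    rw [h1, h2, mul_inv, mul_pow, mul_pow]
    have : (μ⁻¹) ^ (![1, 2, 3] i : ℕ) * μ ^ (![1, 2, 3] i : ℕ) = 1 := by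
      rw [← mul_pow, inv_mul_cancel₀ hμ, one_pow]
    linear_combination (ζ ^ (![1, 2, 3] i : ℕ) * (eval (β.inverse.toFun p).1 Δ)⁻¹ ^
      (![1, 2, 3] i : ℕ) * eval (β.inverse.toFun p).1 (J i)) * this

end IsSolution

theorem polyHom_C_mul {ι : Type} (C' : Set (ι → ℂ)) (a : ℂ) (P : MvPolynomial ι ℂ) :
    polyHom C' (C a * P) = algebraMap ℂ _ a * polyHom C' P := by
  rw [map_mul]
  exact congrArg (· * _) ((polyHom C').commutes a)

/-! ### The projective plane -/

/-- The affine chart `(x : y : 1)` of the projective plane. -/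
noncomputable def chartP2 : BirationalMap A2 P2 :=
  BirationalMap.ofMorphisms (U := Set.univ)
    (V := {q | Quot.lift (fun v : (affine (punctured 3)).carrier => v.1 2 ≠ 0) (by
      rintro a b ⟨t, ht, h⟩
      simp [h, wscale, ht]) q})
    (φ := fun u => ptP2 (u.1 0) (u.1 1))
    (ψ := Quot.lift (fun v => ⟨![v.1 0 / v.1 2, v.1 1 / v.1 2], trivial⟩) (by
      rintro a b ⟨t, ht, h⟩
      refine Subtype.ext ?_
      simp [h, wscale, mul_div_mul_left _ _ ht]))
    (by
      refine IsMorphismOn.comp_of_univ (Y := affine (punctured 3))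
        (φ := fun u : A2.carrier =>
          ⟨![u.1 0, u.1 1, 1], fun h => one_ne_zero (congrFun h 2)⟩) ?_ (isMorphismOn_quot_mk _ _)
      refine isMorphismOn_affine isOpen_univ fun i => ?_
      refine regularOn_div (![X 0, X 1, 1] i) 1 fun x _ => ?_
      fin_cases i <;> simp)
    (by
      refine isMorphismOn_quot_desc (isMorphismOn_affine ?_ fun i => ?_)
      · have h := isOpen_polyVal_ne_zero (punctured 3) (X 2)
        simp only [eval_X] at h
        exact h
      · refine regularOn_div (![X 0, X 1] i) (X 2) fun x hx => ?_
        have hx' : x.1 2 ≠ 0 := hx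
        fin_cases i <;> simp [hx'])
    (by
      intro u _ _
      refine Subtype.ext (_root_.funext fun i => ?_)
      fin_cases i <;> simp [wproj.mk, ptP2])
    (by
      intro q
      obtain ⟨v, rfl⟩ := Quot.exists_rep q
      intro hv _
      have hv' : v.1 2 ≠ 0 := hv
      refine (Quot.sound ⟨(v.1 2)⁻¹, inv_ne_zero hv', ?_⟩).symm
      funext i
      fin_cases i
      · simp [wscale, div_eq_inv_mul]
      · simp [wscale, div_eq_inv_mul]
      · simp [wscale, hv'])
    ⟨⟨0, trivial⟩, trivial, one_ne_zero⟩

theorem chartP2_inverse_mk (v : (affine (punctured 3)).carrier) :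
    (chartP2.inverse.toFun (wproj.mk _ v)).1 = ![v.1 0 / v.1 2, v.1 1 / v.1 2] := rfl

theorem chartP2_inverse_ptP2 (x y : ℂ) : (chartP2.inverse.toFun (ptP2 x y)).1 = ![x, y] := by
  refine (chartP2_inverse_mk _).trans ?_
  simp

theorem continuous_T3 : Continuous T3 := by
  refine IsMorphismOn.continuous (isMorphismOn_quot_desc
    (IsMorphismOn.comp_of_univ (Y := affine (punctured 3)) (isMorphismOn_affine isOpen_univ
      fun i => ?_) (isMorphismOn_quot_mk _ _)))
  refine regularOn_div (![X 2, X 0, X 1] i) 1 fun x _ => ?_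
  fin_cases i <;> simp

theorem iterate_T3 (p : P2.carrier) : T3^[3] p = p := by
  obtain ⟨v, rfl⟩ := Quot.exists_rep p
  refine congrArg (Quot.mk _) (Subtype.ext (_root_.funext fun i => ?_))
  fin_cases i <;> rfl

/-- A generic property of the points of a quotient can be checked upstairs. -/
theorem generic_quot {X : FunSpace} [IrreducibleSpace X.carrier]
    {r : X.carrier → X.carrier → Prop} {U : Set X.carrier} (hU : IsOpen U) (hne : U.Nonempty)
    (hr : ∀ a b, r a b → (a ∈ U ↔ b ∈ U)) {p : (X.quot r).carrier → Prop}
    (h : ∀ x ∈ U, p (Quot.mk r x)) : ∀ᶠ q in (X.quot r).generic, p q := by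
  let V : Set (X.quot r).carrier := {q | Quot.lift (· ∈ U) (fun a b hab => propext (hr a b hab)) q}
  have hV : IsOpen V := hU
  obtain ⟨x, hx⟩ := hne
  filter_upwards [mem_generic_of_isOpen hV ⟨Quot.mk r x, hx⟩] with q hq
  obtain ⟨x, rfl⟩ := Quot.exists_rep q
  exact h x hq

theorem one_mem_punctured : (fun _ => 1 : Fin 3 → ℂ) ∈ punctured 3 :=
  fun h => one_ne_zero (congrFun h 0)

theorem generic_T3 : ∀ᶠ p in P2.generic, (chartP2.inverse.toFun p).1 0 ≠ 0 ∧
    (chartP2.inverse.toFun p).1 1 ≠ 0 ∧ (chartP2.inverse.toFun (T3 p)).1 =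
      ![((chartP2.inverse.toFun p).1 1)⁻¹,
        (chartP2.inverse.toFun p).1 0 / (chartP2.inverse.toFun p).1 1] := by
  refine generic_quot (isOpen_polyVal_ne_zero _ (X 0 * X 1 * X 2))
    ⟨⟨fun _ => 1, one_mem_punctured⟩,
      (by simp : eval (fun _ => (1 : ℂ)) (X 0 * X 1 * X 2 : MvPolynomial (Fin 3) ℂ) ≠ 0)⟩ ?_ ?_
  · rintro a b ⟨t, ht, h⟩
    simp [h, wscale, ht]
  · rintro v hv
    have hv' : (v.1 0 ≠ 0 ∧ v.1 1 ≠ 0) ∧ v.1 2 ≠ 0 := by simpa using hv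
    obtain ⟨⟨h0, h1⟩, h2⟩ := hv'
    refine ⟨div_ne_zero h0 h2, div_ne_zero h1 h2, ?_⟩
    change ![v.1 2 / v.1 1, v.1 0 / v.1 1] = ![(v.1 1 / v.1 2)⁻¹, v.1 0 / v.1 2 / (v.1 1 / v.1 2)]
    rw [inv_div, div_div_div_cancel_right₀ h2]

theorem torusField_ne_zero {c b : ℂ} (hc : c ≠ 0) {D : VectorField A2}
    (hD : ∀ N, D (polyHom _ N) = polyHom _ (torusDer c 1 b N)) : D ≠ 0 := by
  rintro rfl
  refine polyHom_ne_zero (C := (Set.univ : Set (Fin 2 → ℂ))) (P := torusDer c 1 b (X 0))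
    (v := fun _ => 1) trivial ?_ (hD (X 0)).symm
  simp [torusDer_X_zero, hc]

/-- The form kills the Euler field because ω² + ω + 1 = 0, so its kernel has rank two on the cone
and projects to a line on ℙ². The generator `δ` is the lift of `D` without component along Z; for
any other field in the kernel the multiplier is read off from its action on X/Z. -/
theorem E3_eq_line {ω : ℂ} (hω : ω ^ 2 + ω + 1 = 0) {c : ℂ} (hc : c ≠ 0) {D : VectorField A2}
    (hD : ∀ N, D (polyHom _ N) = polyHom _ (torusDer c 1 (-ω) N)) :
    E3 ω = line (chartP2.transport D) := by
  obtain ⟨δ, hδ⟩ := exists_vectorField eq_zero_of_eval_punctured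
    (fun i => polyHom _ (![C c * X 0, C (c * -ω) * X 1, 0] i))
  have h0 : δ (polyHom _ (X 0)) = _ := hδ 0
  have h1 : δ (polyHom _ (X 1)) = _ := hδ 1
  have h2 : δ (polyHom _ (X 2)) = _ := hδ 2
  simp only [Matrix.cons_val, polyHom_C_mul, map_zero] at h0 h1 h2
  let ρ := (quotMap (affine (punctured 3)) (fun a b => ∃ t : ℂ, t ≠ 0 ∧
    b.1 = wscale ![1, 1, 1] t a.1)).comp chartP2.inverse
  have e0 : ρ.pullback (polyHom _ (X 0)) = polyHom _ (X 0) / polyHom _ (X 2) :=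
    pullback_eq_div ρ _ _ (Filter.Eventually.of_forall fun v => by
      rw [eval_X, eval_X, eval_X]
      rfl)
  have e1 : ρ.pullback (polyHom _ (X 1)) = polyHom _ (X 1) / polyHom _ (X 2) :=
    pullback_eq_div ρ _ _ (Filter.Eventually.of_forall fun v => by
      rw [eval_X, eval_X, eval_X]
      rfl)
  have hmem := one_mem_punctured
  have n0 : polyHom (punctured 3) (X 0) ≠ 0 := polyHom_ne_zero hmem (by simp)
  have n1 : polyHom (punctured 3) (X 1) ≠ 0 := polyHom_ne_zero hmem (by simp)
  have n2 : polyHom (punctured 3) (X 2) ≠ 0 := polyHom_ne_zero hmem (by simp)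
  have hω' : algebraMap ℂ (affine (punctured 3)).ratFun ω ^ 2 + algebraMap ℂ _ ω + 1 = 0 := by
    rw [← map_pow, ← map_add, ← map_one (algebraMap ℂ _), ← map_add, hω, map_zero]
  have nc : algebraMap ℂ (affine (punctured 3)).ratFun c ≠ 0 := (map_ne_zero _).2 hc
  have hker : ∀ δ' : VectorField (affine (punctured 3)),
      δ' ∈ kerForm (punctured 3) ![C (ω ^ 2) * X 1 * X 2, C ω * X 0 * X 2, X 0 * X 1] ↔
      algebraMap ℂ _ ω ^ 2 * polyHom _ (X 1) * polyHom _ (X 2) * δ' (polyHom _ (X 0)) +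
        algebraMap ℂ _ ω * polyHom _ (X 0) * polyHom _ (X 2) * δ' (polyHom _ (X 1)) +
        polyHom _ (X 0) * polyHom _ (X 1) * δ' (polyHom _ (X 2)) = 0 := by
    intro δ'
    change ∑ i, polyHom _ _ * δ' (polyHom _ (X i)) = 0 ↔ _
    rw [Fin.sum_univ_three]
    simp only [Matrix.cons_val, mul_assoc, polyHom_C_mul]
    simp only [map_mul, map_pow, mul_assoc]
  refine push_eq_line_transport (quotMap (affine (punctured 3)) _) chartP2 (δ₁ := δ)
    (torusField_ne_zero hc hD) ?_ ?_ ?_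
  · intro i
    fin_cases i
    · change ρ.pullback (D (polyHom _ (X 0))) = δ (ρ.pullback (polyHom _ (X 0)))
      rw [hD, torusDer_X_zero, polyHom_C_mul, map_mul, AlgHom.commutes, e0,
        Derivation.leibniz_div, h0, h2, mul_one, smul_eq_mul, smul_eq_mul, smul_eq_mul]
      field_simp
      ring
    · change ρ.pullback (D (polyHom _ (X 1))) = δ (ρ.pullback (polyHom _ (X 1)))
      rw [hD, torusDer_X_one, polyHom_C_mul, map_mul, AlgHom.commutes, e1,
        Derivation.leibniz_div, h1, h2, smul_eq_mul, smul_eq_mul, smul_eq_mul]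
      field_simp
      ring
  · intro k
    rw [hker]
    change _ * (k * δ _) + _ * (k * δ _) + _ * (k * δ _) = 0
    rw [h0, h1, h2, map_mul, map_neg]
    ring
  · intro δ' hδ'
    rw [hker] at hδ'
    refine ⟨(δ' (ρ.pullback (polyHom _ (X 0)))) / (algebraMap ℂ _ c * (polyHom _ (X 0) /
      polyHom _ (X 2))), fun i => ?_⟩
    fin_cases i
    · change δ' (ρ.pullback (polyHom _ (X 0))) = _ * δ (ρ.pullback (polyHom _ (X 0)))
      rw [e0, Derivation.leibniz_div δ, h0, h2, smul_eq_mul, smul_eq_mul, smul_eq_mul]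
      field_simp
      ring
    · change δ' (ρ.pullback (polyHom _ (X 1))) = _ * δ (ρ.pullback (polyHom _ (X 1)))
      rw [e0, e1, Derivation.leibniz_div, Derivation.leibniz_div, Derivation.leibniz_div, h1, h2,
        map_mul, map_neg]
      simp only [smul_eq_mul]
      field_simp
      set w := algebraMap ℂ (affine (punctured 3)).ratFun ω
      set x := polyHom (punctured 3) (X 0)
      set y := polyHom (punctured 3) (X 1)
      set z := polyHom (punctured 3) (X 2)
      linear_combination algebraMap ℂ _ c * z * w ^ 2 * hδ' - algebraMap ℂ _ c * z *
        ((w - 1) * (x * z * δ' y + w * y * z * δ' x) + x * y * δ' z) * hω'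

/-! ### The product of two projective lines -/

theorem one_mem_pairs : (fun _ => 1 : Fin 2 × Fin 2 → ℂ) ∈ pairs 2 := fun _ => ⟨0, one_ne_zero⟩

theorem eq_zero_of_eval_pairs (P : MvPolynomial (Fin 2 × Fin 2) ℂ)
    (hP : ∀ v ∈ pairs 2, eval v P = 0) : P = 0 := by
  refine eq_zero_of_eval_eq_zero (H := X (0, 0) * X (1, 0))
    (mul_ne_zero (X_ne_zero _) (X_ne_zero _)) (fun v hv => ?_) P hP
  have hv' : v (0, 0) ≠ 0 ∧ v (1, 0) ≠ 0 := by simpa using hv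
  intro j
  fin_cases j
  · exact ⟨0, hv'.1⟩
  · exact ⟨0, hv'.2⟩

instance : IrreducibleSpace (affine (pairs 2)).carrier :=
  irreducibleSpace_of_eval_eq_zero ⟨_, one_mem_pairs⟩ eq_zero_of_eval_pairs

instance {k : ℕ} (C : Set (Fin 2 × Fin k → ℂ)) [IrreducibleSpace (affine C).carrier] :
    IrreducibleSpace (biproj C).carrier := quot_irreducibleSpace _ _

/-- The affine chart `(x : 1, y : 1)` of the product of two projective lines. -/
noncomputable def chartP1P1 : BirationalMap A2 P1P1 :=
  BirationalMap.ofMorphisms (U := Set.univ)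
    (V := {q | Quot.lift (fun v : (affine (pairs 2)).carrier => v.1 (0, 1) ≠ 0 ∧ v.1 (1, 1) ≠ 0) (by
      rintro a b ⟨t, ht, h⟩
      simp [h, ht]) q})
    (φ := fun u => ptP1P1 (u.1 0) (u.1 1))
    (ψ := Quot.lift (fun v => ⟨![v.1 (0, 0) / v.1 (0, 1), v.1 (1, 0) / v.1 (1, 1)], trivial⟩) (by
      rintro a b ⟨t, ht, h⟩
      refine Subtype.ext ?_
      simp [h, mul_div_mul_left _ _ (ht _)]))
    (by
      refine IsMorphismOn.comp_of_univ (Y := affine (pairs 2))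
        (φ := fun u : A2.carrier =>
          ⟨fun a => if a.2 = 0 then ![u.1 0, u.1 1] a.1 else 1, fun j => ⟨1, by simp⟩⟩)
        ?_ (isMorphismOn_quot_mk _ _)
      refine isMorphismOn_affine isOpen_univ fun i => ?_
      refine regularOn_div (if i.2 = 0 then ![X 0, X 1] i.1 else 1) 1 fun x _ => ?_
      obtain ⟨j, k⟩ := i
      fin_cases j <;> fin_cases k <;> simp)
    (by
      refine isMorphismOn_quot_desc (isMorphismOn_affine ?_ fun i => ?_)
      · have h := isOpen_polyVal_ne_zero (pairs 2) (X (0, 1) * X (1, 1))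
        simp only [eval_X, map_mul, ne_eq, mul_eq_zero, not_or] at h
        exact h
      · refine regularOn_div (![X (0, 0), X (1, 0)] i) (![X (0, 1), X (1, 1)] i) fun x hx => ?_
        have hx' : x.1 (0, 1) ≠ 0 ∧ x.1 (1, 1) ≠ 0 := hx
        fin_cases i <;> simp [hx'])
    (by
      intro u _ _
      refine Subtype.ext (_root_.funext fun i => ?_)
      fin_cases i <;> simp [biproj.mk, ptP1P1])
    (by
      intro q
      obtain ⟨v, rfl⟩ := Quot.exists_rep q
      intro hv _
      have hv' : v.1 (0, 1) ≠ 0 ∧ v.1 (1, 1) ≠ 0 := hv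
      refine (Quot.sound ⟨![(v.1 (0, 1))⁻¹, (v.1 (1, 1))⁻¹], ?_, ?_⟩).symm
      · intro j
        fin_cases j <;> simp [hv']
      · intro j i
        fin_cases j <;> fin_cases i <;> simp [hv', div_eq_inv_mul])
    ⟨⟨0, trivial⟩, trivial, one_ne_zero, one_ne_zero⟩

theorem chartP1P1_inverse_mk (v : (affine (pairs 2)).carrier) :
    (chartP1P1.inverse.toFun (biproj.mk _ v)).1 =
      ![v.1 (0, 0) / v.1 (0, 1), v.1 (1, 0) / v.1 (1, 1)] := rfl

theorem chartP1P1_inverse_pt (x y : ℂ) : (chartP1P1.inverse.toFun (ptP1P1 x y)).1 = ![x, y] := by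
  refine (chartP1P1_inverse_mk _).trans ?_
  simp

theorem continuous_T4 : Continuous T4 := by
  refine IsMorphismOn.continuous (isMorphismOn_quot_desc
    (IsMorphismOn.comp_of_univ (Y := affine (pairs 2)) (isMorphismOn_affine isOpen_univ
      fun i => ?_) (isMorphismOn_quot_mk _ _)))
  refine regularOn_div (if i.1 = 0 then X (1, i.2) else X (0, i.2.rev)) 1 fun x _ => ?_
  obtain ⟨j, k⟩ := i
  fin_cases j <;> simp

theorem iterate_T4 (p : P1P1.carrier) : T4^[4] p = p := by
  obtain ⟨v, rfl⟩ := Quot.exists_rep p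
  refine congrArg (Quot.mk _) (Subtype.ext (_root_.funext fun i => ?_))
  obtain ⟨j, k⟩ := i
  fin_cases j <;> fin_cases k <;> rfl

theorem generic_T4 : ∀ᶠ p in P1P1.generic, (chartP1P1.inverse.toFun p).1 0 ≠ 0 ∧
    (chartP1P1.inverse.toFun p).1 1 ≠ 0 ∧ (chartP1P1.inverse.toFun (T4 p)).1 =
      ![(chartP1P1.inverse.toFun p).1 1, ((chartP1P1.inverse.toFun p).1 0)⁻¹] := by
  refine generic_quot (isOpen_polyVal_ne_zero _ (X (0, 0) * X (0, 1) * X (1, 0) * X (1, 1)))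
    ⟨⟨fun _ => 1, one_mem_pairs⟩, (by simp : eval (fun _ => (1 : ℂ)) (X (0, 0) * X (0, 1) *
      X (1, 0) * X (1, 1) : MvPolynomial (Fin 2 × Fin 2) ℂ) ≠ 0)⟩ ?_ ?_
  · rintro a b ⟨t, ht, h⟩
    simp [h, ht]
  · rintro v hv
    have hv' : ((v.1 (0, 0) ≠ 0 ∧ v.1 (0, 1) ≠ 0) ∧ v.1 (1, 0) ≠ 0) ∧ v.1 (1, 1) ≠ 0 := by
      simpa using hv
    obtain ⟨⟨⟨h0, h1⟩, h2⟩, h3⟩ := hv'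
    refine ⟨div_ne_zero h0 h1, div_ne_zero h2 h3, ?_⟩
    change ![v.1 (1, 0) / v.1 (1, 1), v.1 (0, 1) / v.1 (0, 0)] =
      ![v.1 (1, 0) / v.1 (1, 1), (v.1 (0, 0) / v.1 (0, 1))⁻¹]
    rw [inv_div]

/-- The form kills the Euler fields of both factors, so its kernel of rank three projects to a line.
The generator is the lift of `D` that annihilates both denominators; the multiplier is read off from
the action on the second affine coordinate. -/
theorem E4_eq_line {c : ℂ} (hc : c ≠ 0) {D : VectorField A2}
    (hD : ∀ N, D (polyHom _ N) = polyHom _ (torusDer c Complex.I 1 N)) :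
    E4 = line (chartP1P1.transport D) := by
  obtain ⟨δ, hδ⟩ := exists_vectorField eq_zero_of_eval_pairs
    (fun i => polyHom _ (if i = (0, 0) then C (c * Complex.I) * X (0, 0) else
      if i = (1, 0) then C (c * 1) * X (1, 0) else 0))
  have h00 : δ (polyHom _ (X (0, 0))) = _ := hδ (0, 0)
  have h01 : δ (polyHom _ (X (0, 1))) = _ := hδ (0, 1)
  have h10 : δ (polyHom _ (X (1, 0))) = _ := hδ (1, 0)
  have h11 : δ (polyHom _ (X (1, 1))) = _ := hδ (1, 1)
  simp only [Prod.mk.injEq, reduceIte, zero_ne_one, one_ne_zero, and_true, and_false, and_self,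
    polyHom_C_mul, map_zero] at h00 h01 h10 h11
  let ρ := (quotMap (affine (pairs 2)) (fun a b => ∃ t : Fin 2 → ℂ, (∀ j, t j ≠ 0) ∧
    ∀ j i, b.1 (j, i) = t j * a.1 (j, i))).comp chartP1P1.inverse
  have e0 : ρ.pullback (polyHom _ (X 0)) = polyHom _ (X (0, 0)) / polyHom _ (X (0, 1)) :=
    pullback_eq_div ρ _ _ (Filter.Eventually.of_forall fun v => by
      rw [eval_X, eval_X, eval_X]
      rfl)
  have e1 : ρ.pullback (polyHom _ (X 1)) = polyHom _ (X (1, 0)) / polyHom _ (X (1, 1)) :=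
    pullback_eq_div ρ _ _ (Filter.Eventually.of_forall fun v => by
      rw [eval_X, eval_X, eval_X]
      rfl)
  have hne : ∀ i, polyHom (pairs 2) (X i) ≠ 0 := fun i => polyHom_ne_zero one_mem_pairs (by simp)
  have n00 := hne (0, 0)
  have n01 := hne (0, 1)
  have n10 := hne (1, 0)
  have n11 := hne (1, 1)
  have hI : algebraMap ℂ (affine (pairs 2)).ratFun Complex.I ^ 2 = -1 := by
    rw [← map_pow, Complex.I_sq, map_neg, map_one]
  have nc : algebraMap ℂ (affine (pairs 2)).ratFun c ≠ 0 := (map_ne_zero _).2 hc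
  have nI : algebraMap ℂ (affine (pairs 2)).ratFun Complex.I ≠ 0 :=
    (map_ne_zero _).2 Complex.I_ne_zero
  have hker : ∀ δ' : VectorField (affine (pairs 2)),
      δ' ∈ kerForm (pairs 2) (fun a =>
        if a = (0, 0) then X (1, 0) * X (1, 1) * X (0, 1)
        else if a = (0, 1) then - (X (1, 0) * X (1, 1) * X (0, 0))
        else if a = (1, 0) then - (C Complex.I * X (0, 0) * X (0, 1) * X (1, 1))
        else C Complex.I * X (0, 0) * X (0, 1) * X (1, 0)) ↔
      polyHom _ (X (1, 0)) * polyHom _ (X (1, 1)) *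
        (polyHom _ (X (0, 1)) * δ' (polyHom _ (X (0, 0))) -
          polyHom _ (X (0, 0)) * δ' (polyHom _ (X (0, 1)))) -
      algebraMap ℂ _ Complex.I * polyHom _ (X (0, 0)) * polyHom _ (X (0, 1)) *
        (polyHom _ (X (1, 1)) * δ' (polyHom _ (X (1, 0))) -
          polyHom _ (X (1, 0)) * δ' (polyHom _ (X (1, 1)))) = 0 := by
    intro δ'
    change ∑ i, polyHom _ _ * δ' (polyHom _ (X i)) = 0 ↔ _
    rw [Fintype.sum_prod_type, Fin.sum_univ_two, Fin.sum_univ_two, Fin.sum_univ_two]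
    simp only [Prod.mk.injEq, reduceIte, zero_ne_one, one_ne_zero, and_true, and_false, and_self,
      mul_assoc, polyHom_C_mul, map_neg]
    simp only [map_mul]
    refine Eq.congr ?_ rfl
    ring
  refine push_eq_line_transport (quotMap (affine (pairs 2)) _) chartP1P1 (δ₁ := δ) ?_ ?_ ?_ ?_
  · rintro rfl
    refine polyHom_ne_zero (C := (Set.univ : Set (Fin 2 → ℂ)))
      (P := torusDer c Complex.I 1 (X 0)) (v := fun _ => 1) trivial ?_ (hD (X 0)).symm
    simp [torusDer_X_zero, hc]
  · intro i
    fin_cases i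
    · change ρ.pullback (D (polyHom _ (X 0))) = δ (ρ.pullback (polyHom _ (X 0)))
      rw [hD, torusDer_X_zero, polyHom_C_mul, map_mul, AlgHom.commutes, e0,
        Derivation.leibniz_div, h00, h01, smul_eq_mul, smul_eq_mul, smul_eq_mul]
      field_simp
      ring
    · change ρ.pullback (D (polyHom _ (X 1))) = δ (ρ.pullback (polyHom _ (X 1)))
      rw [hD, torusDer_X_one, polyHom_C_mul, map_mul, AlgHom.commutes, e1,
        Derivation.leibniz_div, h10, h11, smul_eq_mul, smul_eq_mul, smul_eq_mul]
      field_simp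
      ring
  · intro k
    rw [hker]
    change _ * (_ * (k * δ _) - _ * (k * δ _)) - _ * (_ * (k * δ _) - _ * (k * δ _)) = 0
    rw [h00, h01, h10, h11, map_mul, map_mul, map_one]
    ring
  · intro δ' hδ'
    rw [hker] at hδ'
    refine ⟨(δ' (ρ.pullback (polyHom _ (X 1)))) / (algebraMap ℂ _ c * (polyHom _ (X (1, 0)) /
      polyHom _ (X (1, 1)))), fun i => ?_⟩
    fin_cases i
    · change δ' (ρ.pullback (polyHom _ (X 0))) = _ * δ (ρ.pullback (polyHom _ (X 0)))
      rw [e0, e1, Derivation.leibniz_div, Derivation.leibniz_div, Derivation.leibniz_div, h00, h01,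
        map_mul]
      simp only [smul_eq_mul]
      field_simp
      linear_combination algebraMap ℂ _ c * hδ'
    · change δ' (ρ.pullback (polyHom _ (X 1))) = _ * δ (ρ.pullback (polyHom _ (X 1)))
      rw [e1, Derivation.leibniz_div δ, h10, h11, mul_one, smul_eq_mul, smul_eq_mul, smul_eq_mul]
      field_simp
      ring

open Filter Topology

/-! ### The blow-up of the projective plane at three points -/

/-- A polynomial which does not vanish at a point does not vanish nearby on a path. -/
theorem eventually_eval_ne_zero {ι : Type} {γ : ℂ → ι → ℂ} (hγ : ContinuousAt γ 0)
    {P : MvPolynomial ι ℂ} (hP : eval (γ 0) P ≠ 0) : ∀ᶠ ε in 𝓝[≠] (0 : ℂ), eval (γ ε) P ≠ 0 := by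
  have h : ContinuousAt (fun ε => eval (γ ε) P) 0 :=
    ContinuousAt.comp (g := fun v => eval v P) (MvPolynomial.continuous_eval P).continuousAt hγ
  exact (h.eventually_ne hP).filter_mono nhdsWithin_le_nhds

/-- Deforms a zero product to a nonzero one. The value ε² rather than ε allows the symmetric choice
(ε, ε) at a = b = 0, and the common value lets the three pairs of coordinates be deformed together.
-/
theorem exists_continuous_mul_eq_sq {a b : ℂ} (h : a * b = 0) :
    ∃ f g : ℂ → ℂ, Continuous f ∧ Continuous g ∧ f 0 = a ∧ g 0 = b ∧ ∀ ε, f ε * g ε = ε ^ 2 := by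
  by_cases ha : a = 0
  · by_cases hb : b = 0
    · exact ⟨id, id, continuous_id, continuous_id, ha.symm, hb.symm, fun ε => (sq ε).symm⟩
    · exact ⟨fun ε => ε ^ 2 / b, fun _ => b, by fun_prop, by fun_prop, by simp [ha], rfl,
        fun ε => div_mul_cancel₀ _ hb⟩
  · have hb : b = 0 := (mul_eq_zero.1 h).resolve_left ha
    exact ⟨fun _ => a, fun ε => ε ^ 2 / a, by fun_prop, by fun_prop, rfl, by simp [hb],
      fun ε => mul_div_cancel₀ _ ha⟩

/-- The torus is dense in the cone over the blow-up. -/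
theorem exists_torus_blCone {v : Fin 2 × Fin 3 → ℂ} (hv : v ∈ blCone)
    {P : MvPolynomial (Fin 2 × Fin 3) ℂ} (hP : eval v P ≠ 0) :
    ∃ (v' : Fin 2 × Fin 3 → ℂ) (s : ℂ), s ≠ 0 ∧ (∀ i, v' (0, i) * v' (1, i) = s) ∧
      eval v' P ≠ 0 := by
  by_cases hs : v (0, 0) * v (1, 0) = 0
  · have h0 : ∀ i, v (0, i) * v (1, i) = 0 := fun i => (hv.2 i 0).trans hs
    choose f g hf hg hf0 hg0 hfg using fun i => exists_continuous_mul_eq_sq (h0 i)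
    let γ : ℂ → Fin 2 × Fin 3 → ℂ := fun ε a => ![f a.2 ε, g a.2 ε] a.1
    have hγ : Continuous γ := by
      refine continuous_pi fun ⟨j, i⟩ => ?_
      fin_cases j
      · exact hf i
      · exact hg i
    have hγ0 : γ 0 = v := by
      funext ⟨j, i⟩
      fin_cases j
      · exact hf0 i
      · exact hg0 i
    obtain ⟨ε, h1, h2⟩ := ((eventually_eval_ne_zero hγ.continuousAt
      (by rwa [hγ0] : eval (γ 0) P ≠ 0)).and self_mem_nhdsWithin).exists
    exact ⟨γ ε, ε ^ 2, pow_ne_zero _ h2, fun i => hfg i ε, h1⟩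
  · exact ⟨v, _, hs, fun i => hv.2 i 0, hP⟩

theorem mem_blCone_of_mul_eq {v : Fin 2 × Fin 3 → ℂ} {s : ℂ} (hs : s ≠ 0)
    (h : ∀ i, v (0, i) * v (1, i) = s) : v ∈ blCone := by
  refine ⟨fun j => ⟨0, ?_⟩, fun i i' => (h i).trans (h i').symm⟩
  have := h 0
  fin_cases j
  · rintro h0
    exact hs (by rw [← this]; exact mul_eq_zero_of_left h0 _)
  · rintro h0
    exact hs (by rw [← this]; exact mul_eq_zero_of_right _ h0)

theorem one_mem_blCone : (fun _ => 1 : Fin 2 × Fin 3 → ℂ) ∈ blCone :=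
  mem_blCone_of_mul_eq one_ne_zero fun _ => one_mul 1

/-- The part of the cone where the common product s is nonzero is parametrized by (u₀, u₁, u₂, s) ↦
(uᵢ, s/uᵢ), with all entries nonzero, and by `exists_torus_blCone` it is dense. -/
instance : IrreducibleSpace (affine blCone).carrier := by
  classical
  let m : (Fin 4 → ℂ) → Fin 2 × Fin 3 → ℂ := fun u a =>
    ![![u 0, u 1, u 2], ![u 3 / u 0, u 3 / u 1, u 3 / u 2]] a.1 a.2
  let H : MvPolynomial (Fin 4) ℂ := X 0 * X 1 * X 2 * X 3
  have hH : ∀ u, eval u H ≠ 0 ↔ ((u 0 ≠ 0 ∧ u 1 ≠ 0) ∧ u 2 ≠ 0) ∧ u 3 ≠ 0 := fun u => by simp [H]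
  have hm : ∀ u, eval u H ≠ 0 → m u ∈ blCone := fun u hu => by
    obtain ⟨⟨⟨h0, h1⟩, h2⟩, h3⟩ := (hH u).1 hu
    refine mem_blCone_of_mul_eq h3 fun i => ?_
    fin_cases i
    · exact mul_div_cancel₀ _ h0
    · exact mul_div_cancel₀ _ h1
    · exact mul_div_cancel₀ _ h2
  let φ : (affine (Set.univ : Set (Fin 4 → ℂ))).carrier → (affine blCone).carrier := fun u =>
    if h : eval u.1 H ≠ 0 then ⟨m u.1, hm _ h⟩ else ⟨_, one_mem_blCone⟩
  have hφ : ∀ u : (affine (Set.univ : Set (Fin 4 → ℂ))).carrier, eval u.1 H ≠ 0 →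
    (φ u).1 = m u.1 := fun u hu => congrArg Subtype.val (dif_pos hu)
  refine irreducibleSpace_affine (X := affine (Set.univ : Set (Fin 4 → ℂ))) (φ := φ)
    (U := {u : (affine (Set.univ : Set (Fin 4 → ℂ))).carrier | eval u.1 H ≠ 0})
    (isMorphismOn_affine (isOpen_polyVal_ne_zero _ H) fun i => ?_)
    ⟨⟨fun _ => 1, trivial⟩, (by simp [H] : eval (fun _ => (1 : ℂ)) H ≠ 0)⟩ ?_
  · refine regularOn_div (![![X 0, X 1, X 2], ![X 3, X 3, X 3]] i.1 i.2)
      (![![1, 1, 1], ![X 0, X 1, X 2]] i.1 i.2) fun u hu => ?_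
    have hu' : eval u.1 H ≠ 0 := hu
    rw [hφ u hu']
    obtain ⟨⟨⟨h0, h1⟩, h2⟩, h3⟩ := (hH u.1).1 hu'
    obtain ⟨j, i⟩ := i
    fin_cases j <;> fin_cases i <;> simp [m, h0, h1, h2]
  · intro p hp P hP
    obtain ⟨v, s, hs, hv, hvP⟩ := exists_torus_blCone hp hP
    let u : (affine (Set.univ : Set (Fin 4 → ℂ))).carrier :=
      ⟨![v (0, 0), v (0, 1), v (0, 2), s], trivial⟩
    have hne : ∀ i, v (0, i) ≠ 0 := fun i h0 => hs (by rw [← hv i, h0, zero_mul])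
    have hu : eval u.1 H ≠ 0 := (hH _).2 ⟨⟨⟨hne 0, hne 1⟩, hne 2⟩, hs⟩
    refine ⟨u, hu, ?_⟩
    rw [hφ u hu]
    have : m u.1 = v := by
      funext ⟨j, i⟩
      fin_cases j
      · fin_cases i <;> rfl
      · have h1 : v (1, i) = s / v (0, i) := by rw [← hv i, mul_div_cancel_left₀ _ (hne i)]
        rw [show ((⟨1, by decide⟩ : Fin 2), i) = (1, i) from rfl, h1]
        fin_cases i <;> rfl
    rwa [this]

open Classical in
/-- The affine chart of the blow-up above the points `(x : y : 1)` with nonzero `x` and `y`. -/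
noncomputable def ptBl3' (u : A2.carrier) : Bl3.carrier :=
  if h : u.1 0 ≠ 0 ∧ u.1 1 ≠ 0 then ptBl3 (u.1 0) (u.1 1) h.1 h.2
  else biproj.mk _ ⟨_, one_mem_blCone⟩

open Classical in
theorem isMorphismOn_ptBl3' : IsMorphismOn {u : A2.carrier | u.1 0 ≠ 0 ∧ u.1 1 ≠ 0} ptBl3' := by
  have hU : IsOpen {u : A2.carrier | u.1 0 ≠ 0 ∧ u.1 1 ≠ 0} := by
    have h := isOpen_polyVal_ne_zero (Set.univ : Set (Fin 2 → ℂ)) (X 0 * X 1)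
    simp only [eval_X, map_mul, ne_eq, mul_eq_zero, not_or] at h
    exact h
  let φ : A2.carrier → (affine blCone).carrier := fun u =>
    if h : u.1 0 ≠ 0 ∧ u.1 1 ≠ 0 then
      ⟨fun a => ![![u.1 0, u.1 1, 1], ![u.1 1, u.1 0, u.1 0 * u.1 1]] a.1 a.2,
        mem_blCone_of_mul_eq (mul_ne_zero h.1 h.2) fun i => by
          fin_cases i <;> simp [mul_comm]⟩
    else ⟨_, one_mem_blCone⟩
  have hφ : ∀ u : A2.carrier, u.1 0 ≠ 0 ∧ u.1 1 ≠ 0 → (φ u).1 = fun a =>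
      ![![u.1 0, u.1 1, 1], ![u.1 1, u.1 0, u.1 0 * u.1 1]] a.1 a.2 :=
    fun u hu => congrArg Subtype.val (dif_pos hu)
  have hmor : IsMorphismOn {u : A2.carrier | u.1 0 ≠ 0 ∧ u.1 1 ≠ 0} φ := by
    refine isMorphismOn_affine hU fun i => ?_
    refine regularOn_div (![![X 0, X 1, 1], ![X 1, X 0, X 0 * X 1]] i.1 i.2) 1 fun u hu => ?_
    rw [hφ u hu]
    obtain ⟨j, i⟩ := i
    fin_cases j <;> fin_cases i <;> simp
  refine (hmor.comp_of_univ (isMorphismOn_quot_mk (affine blCone) _)).congr fun u hu => ?_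
  have hu' : u.1 0 ≠ 0 ∧ u.1 1 ≠ 0 := hu
  refine Eq.trans ?_ (dif_pos hu').symm
  exact congrArg (Quot.mk _) (Subtype.ext (hφ u hu'))

/-- The affine chart of the blow-up. -/
noncomputable def chartBl3 : BirationalMap A2 Bl3 :=
  BirationalMap.ofMorphisms (U := {u : A2.carrier | u.1 0 ≠ 0 ∧ u.1 1 ≠ 0})
    (V := {q | Quot.lift (fun v : (affine blCone).carrier => v.1 (0, 2) ≠ 0) (by
      rintro a b ⟨t, ht, h⟩
      simp [h, ht]) q})
    (φ := ptBl3')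
    (ψ := Quot.lift (fun v => ⟨![v.1 (0, 0) / v.1 (0, 2), v.1 (0, 1) / v.1 (0, 2)], trivial⟩) (by
      rintro a b ⟨t, ht, h⟩
      refine Subtype.ext ?_
      simp [h, mul_div_mul_left _ _ (ht _)]))
    isMorphismOn_ptBl3'
    (by
      refine isMorphismOn_quot_desc (isMorphismOn_affine ?_ fun i => ?_)
      · have h := isOpen_polyVal_ne_zero blCone (X (0, 2))
        simp only [eval_X] at h
        exact h
      · refine regularOn_div (![X (0, 0), X (0, 1)] i) (X (0, 2)) fun x hx => ?_
        have hx' : x.1 (0, 2) ≠ 0 := hx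
        fin_cases i <;> simp [hx'])
    (by
      intro u hu _
      have e : ptBl3' u = ptBl3 (u.1 0) (u.1 1) hu.1 hu.2 := dif_pos hu
      rw [e]
      refine Subtype.ext (_root_.funext fun i => ?_)
      fin_cases i <;> simp [biproj.mk, ptBl3])
    (by
      intro q
      obtain ⟨v, rfl⟩ := Quot.exists_rep q
      intro hv hu
      have h2 : v.1 (0, 2) ≠ 0 := hv
      have hu' : v.1 (0, 0) / v.1 (0, 2) ≠ 0 ∧ v.1 (0, 1) / v.1 (0, 2) ≠ 0 := hu
      have h0 : v.1 (0, 0) ≠ 0 := (div_ne_zero_iff.1 hu'.1).1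
      have h1 : v.1 (0, 1) ≠ 0 := (div_ne_zero_iff.1 hu'.2).1
      have e02 : v.1 (0, 0) * v.1 (1, 0) = v.1 (0, 2) * v.1 (1, 2) := v.2.2 0 2
      have e12 : v.1 (0, 1) * v.1 (1, 1) = v.1 (0, 2) * v.1 (1, 2) := v.2.2 1 2
      -- If the last coordinate of the second vector vanished, so would the common product, and with
      -- it the whole second vector.
      have h12 : v.1 (1, 2) ≠ 0 := by
        intro h
        rw [h, mul_zero] at e02 e12
        obtain ⟨i, hi⟩ := v.2.1 1
        fin_cases i
        · exact hi ((mul_eq_zero.1 e02).resolve_left h0)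
        · exact hi ((mul_eq_zero.1 e12).resolve_left h1)
        · exact hi h
      -- The two ratios are found by comparing last coordinates: 1 for the first vector of `ptBl3`,
      -- and the product of the affine coordinates for the second.
      refine (dif_pos hu').trans (Quot.sound ⟨![v.1 (0, 2),
        v.1 (1, 2) * v.1 (0, 2) ^ 2 / (v.1 (0, 0) * v.1 (0, 1))], ?_, ?_⟩)
      · intro j
        fin_cases j
        · exact h2
        · exact div_ne_zero (mul_ne_zero h12 (pow_ne_zero _ h2)) (mul_ne_zero h0 h1)
      · intro j i
        fin_cases j
        · fin_cases i
          · exact (mul_div_cancel₀ _ h2).symm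
          · exact (mul_div_cancel₀ _ h2).symm
          · exact (mul_one _).symm
        · fin_cases i
          · change v.1 (1, 0) = v.1 (1, 2) * v.1 (0, 2) ^ 2 / (v.1 (0, 0) * v.1 (0, 1)) *
              (v.1 (0, 1) / v.1 (0, 2))
            field_simp
            linear_combination e02
          · change v.1 (1, 1) = v.1 (1, 2) * v.1 (0, 2) ^ 2 / (v.1 (0, 0) * v.1 (0, 1)) *
              (v.1 (0, 0) / v.1 (0, 2))
            field_simp
            linear_combination e12
          · change v.1 (1, 2) = v.1 (1, 2) * v.1 (0, 2) ^ 2 / (v.1 (0, 0) * v.1 (0, 1)) *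
              (v.1 (0, 0) / v.1 (0, 2) * (v.1 (0, 1) / v.1 (0, 2)))
            field_simp)
    (by
      refine ⟨⟨fun _ => 1, trivial⟩, ⟨one_ne_zero, one_ne_zero⟩, ?_⟩
      have e : ptBl3' ⟨fun _ => 1, trivial⟩ = ptBl3 1 1 one_ne_zero one_ne_zero :=
        dif_pos ⟨one_ne_zero, one_ne_zero⟩
      rw [e]
      exact one_ne_zero)

theorem chartBl3_inverse_mk (v : (affine blCone).carrier) :
    (chartBl3.inverse.toFun (biproj.mk _ v)).1 =
      ![v.1 (0, 0) / v.1 (0, 2), v.1 (0, 1) / v.1 (0, 2)] := rfl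

theorem chartBl3_inverse_pt (x y : ℂ) (hx : x ≠ 0) (hy : y ≠ 0) :
    (chartBl3.inverse.toFun (ptBl3 x y hx hy)).1 = ![x, y] := by
  refine (chartBl3_inverse_mk _).trans ?_
  simp

theorem continuous_T6 : Continuous T6 := by
  refine IsMorphismOn.continuous (isMorphismOn_quot_desc
    (IsMorphismOn.comp_of_univ (Y := affine blCone) (isMorphismOn_affine isOpen_univ
      fun i => ?_) (isMorphismOn_quot_mk _ _)))
  exact regularOn_div (X (1 - i.1, i.2 - 1)) 1 fun x _ => by simp

theorem iterate_T6 (p : Bl3.carrier) : T6^[6] p = p := by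
  obtain ⟨v, rfl⟩ := Quot.exists_rep p
  refine congrArg (Quot.mk _) (Subtype.ext (_root_.funext fun i => ?_))
  obtain ⟨j, k⟩ := i
  fin_cases j <;> fin_cases k <;> rfl

theorem generic_blCone {p : Bl3.carrier → Prop} (h : ∀ v : (affine blCone).carrier,
    (∀ a, v.1 a ≠ 0) → p (biproj.mk _ v)) : ∀ᶠ q in Bl3.generic, p q := by
  refine generic_quot (isOpen_polyVal_ne_zero _ (∏ a, X a)) ⟨⟨fun _ => 1, one_mem_blCone⟩,
    (by simp : eval (fun _ => (1 : ℂ)) (∏ a, X a : MvPolynomial (Fin 2 × Fin 3) ℂ) ≠ 0)⟩ ?_ ?_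
  · rintro a b ⟨t, ht, h⟩
    change eval a.1 _ ≠ 0 ↔ eval b.1 _ ≠ 0
    simp only [map_prod, eval_X, Finset.prod_ne_zero_iff, Finset.mem_univ, true_imp_iff]
    refine forall_congr' fun i => ?_
    rw [h i.1 i.2]
    simp [ht]
  · intro v hv
    have hv' : eval v.1 (∏ a, X a) ≠ 0 := hv
    simp only [map_prod, eval_X, Finset.prod_ne_zero_iff, Finset.mem_univ, true_imp_iff] at hv'
    exact h v hv'

theorem generic_T6 : ∀ᶠ p in Bl3.generic, (chartBl3.inverse.toFun p).1 0 ≠ 0 ∧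
    (chartBl3.inverse.toFun p).1 1 ≠ 0 ∧ (chartBl3.inverse.toFun (T6 p)).1 =
      ![(chartBl3.inverse.toFun p).1 1,
        (chartBl3.inverse.toFun p).1 1 / (chartBl3.inverse.toFun p).1 0] := by
  refine generic_blCone fun v hv => ⟨div_ne_zero (hv _) (hv _), div_ne_zero (hv _) (hv _), ?_⟩
  change ![v.1 (1, 2) / v.1 (1, 1), v.1 (1, 0) / v.1 (1, 1)] = ![v.1 (0, 1) / v.1 (0, 2),
    v.1 (0, 1) / v.1 (0, 2) / (v.1 (0, 0) / v.1 (0, 2))]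
  have e1 := v.2.2 1 2
  have e2 := v.2.2 0 1
  have h1 : v.1 (1, 2) / v.1 (1, 1) = v.1 (0, 1) / v.1 (0, 2) := by
    rw [div_eq_div_iff (hv _) (hv _)]
    linear_combination -e1
  have h2 : v.1 (1, 0) / v.1 (1, 1) = v.1 (0, 1) / v.1 (0, 0) := by
    rw [div_eq_div_iff (hv _) (hv _)]
    linear_combination e2
  rw [div_div_div_cancel_right₀ (hv _), h1, h2]

/-- On the torus the blow-down is the inverse of one chart followed by the other, so the strict
transform is generated by the same field `D` read in the chart of the blow-up. -/
theorem E6_eq_line {ω : ℂ} (hω : ω ^ 2 + ω + 1 = 0) {c : ℂ} (hc : c ≠ 0) {D : VectorField A2}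
    (hD : ∀ N, D (polyHom _ N) = polyHom _ (torusDer c 1 (-ω) N)) :
    E6 ω = line (chartBl3.transport D) := by
  have h : ∀ᶠ p in Bl3.generic, blowDown p = (chartBl3.symm.trans chartP2).toFun p := by
    refine generic_blCone fun v hv => (Quot.sound ⟨v.1 (0, 2), hv _, ?_⟩ :
      (chartBl3.symm.trans chartP2).toFun (biproj.mk _ v) = _).symm
    funext i
    fin_cases i
    · change v.1 (0, 0) = v.1 (0, 2) ^ 1 * (v.1 (0, 0) / v.1 (0, 2))
      rw [pow_one, mul_div_cancel₀ _ (hv _)]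
    · change v.1 (0, 1) = v.1 (0, 2) ^ 1 * (v.1 (0, 1) / v.1 (0, 2))
      rw [pow_one, mul_div_cancel₀ _ (hv _)]
    · change v.1 (0, 2) = v.1 (0, 2) ^ 1 * 1
      rw [pow_one, mul_one]
  rw [E6, E3_eq_line hω hc hD, DominantMap.pull_congr h, BirationalMap.pull_line]
  refine congrArg line (Derivation.ext fun g => ?_)
  rw [BirationalMap.transport_apply, BirationalMap.transport_apply]
  have e1 : (chartBl3.symm.trans chartP2).symm.pullback g =
      chartP2.inverse.pullback (chartBl3.pullback g) := DominantMap.pullback_comp _ _ _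
  have e2 : ∀ G, (chartBl3.symm.trans chartP2).symm.inverse.pullback G =
      chartBl3.inverse.pullback (chartP2.pullback G) := DominantMap.pullback_comp _ _
  rw [e1, e2, BirationalMap.transport_apply, BirationalMap.pullback_pullback_inverse,
    BirationalMap.pullback_pullback_inverse]

/-! ### The level sets of the first integrals -/

/-- The point `(x, y, z)` for which `x`, `y - x²` and `z - 3xy + x³` have given values. For a
function `x` with derivatives `y` and `z`, if `x = N / Δ` where `N` and `Δ` solve a linear equation
these quantities are affine in `N' / Δ` and `N'' / Δ`. -/
def shear (x q a : ℂ) : Fin 3 → ℂ := ![x, q + x ^ 2, a + 3 * x * q + 2 * x ^ 3]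

theorem eq_shear (v : Fin 3 → ℂ) :
    v = shear (v 0) (v 1 - v 0 ^ 2) (v 2 - 3 * v 0 * v 1 + v 0 ^ 3) := by
  funext i
  fin_cases i
  · rfl
  · simp [shear]
  · simp [shear]
    ring

theorem continuousAt_shear {x q a : ℂ → ℂ} {t : ℂ} (hx : ContinuousAt x t) (hq : ContinuousAt q t)
    (ha : ContinuousAt a t) : ContinuousAt (fun s => shear (x s) (q s) (a s)) t := by
  refine continuousAt_pi.2 fun i => ?_
  fin_cases i
  · exact hx
  · exact hq.add (hx.pow 2)
  · exact (ha.add ((continuousAt_const.mul hx).mul hq)).add (continuousAt_const.mul (hx.pow 3))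

theorem shear_mem_integralIV {x q a : ℂ} : shear x q a ∈ level integralIV ↔ a = 1 := by
  change eval _ integralIV = 1 ↔ _
  simp only [integralIV, shear, map_add, map_sub, map_mul, map_pow, eval_X, map_ofNat,
    Matrix.cons_val]
  constructor <;> intro h <;> linear_combination h

theorem shear_mem_integralV {x q a : ℂ} :
    shear x q a ∈ level integralV ↔ 2 * a * x = q ^ 2 + 1 := by
  change eval _ integralV = 1 ↔ _
  simp only [integralV, shear, map_add, map_sub, map_mul, map_pow, eval_X, map_ofNat,
    Matrix.cons_val]
  constructor <;> intro h <;> linear_combination h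

theorem shear_mem_integralVI {x q a : ℂ} :
    shear x q a ∈ level integralVI ↔ 3 * a ^ 2 + 12 * a * x * q + 1 = 8 * q ^ 3 := by
  change eval _ integralVI = 1 ↔ _
  simp only [integralVI, shear, map_add, map_sub, map_mul, map_pow, eval_X, map_ofNat,
    Matrix.cons_val]
  constructor <;> intro h <;> linear_combination -h

theorem sheared_one {n₀ d₀ n₁ d₁ : ℂ} (h0 : d₀ ≠ 0) (h1 : d₁ ≠ 0) :
    n₁ / d₁ + (n₀ / d₀) ^ 2 = (n₁ * d₀ ^ 2 + n₀ ^ 2 * d₁) / (d₁ * d₀ ^ 2) := by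
  field_simp

theorem sheared_two {n₀ d₀ n₁ d₁ n₂ d₂ : ℂ} (h0 : d₀ ≠ 0) (h1 : d₁ ≠ 0) (h2 : d₂ ≠ 0) :
    n₂ / d₂ + 3 * (n₀ / d₀) * (n₁ / d₁) + 2 * (n₀ / d₀) ^ 3 =
      (n₂ * (d₀ ^ 3 * d₁) + 3 * n₀ * n₁ * (d₀ ^ 2 * d₂) + 2 * n₀ ^ 3 * (d₁ * d₂)) /
        (d₂ * (d₀ ^ 3 * d₁)) := by
  field_simp

/-- `C` is shown to be the closure of the image of an open subset of the plane. A polynomial that is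
nonzero at a point stays nonzero nearby in the usual topology, so it suffices to approach every
point of `C` along a path lying in the image for small ε ≠ 0. -/
theorem irreducibleSpace_of_shear {C : Set (Fin 3 → ℂ)}
    (n d : Fin 3 → MvPolynomial (Fin 2) ℂ) (H : MvPolynomial (Fin 2) ℂ) (hne : ∃ u, eval u H ≠ 0)
    (hd : ∀ u i, eval u H ≠ 0 → eval u (d i) ≠ 0)
    (hm : ∀ u, eval u H ≠ 0 → shear (eval u (n 0) / eval u (d 0)) (eval u (n 1) / eval u (d 1))
      (eval u (n 2) / eval u (d 2)) ∈ C)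
    (hpath : ∀ x q a, shear x q a ∈ C → ∃ (γ : Fin 3 → ℂ → ℂ) (u : ℂ → Fin 2 → ℂ),
      (∀ i, ContinuousAt (γ i) 0) ∧ γ 0 0 = x ∧ γ 1 0 = q ∧ γ 2 0 = a ∧
      ∀ᶠ ε in 𝓝[≠] (0 : ℂ), eval (u ε) H ≠ 0 ∧
        ∀ i, eval (u ε) (n i) = γ i ε * eval (u ε) (d i)) :
    IrreducibleSpace (affine C).carrier := by
  classical
  let m : (Fin 2 → ℂ) → Fin 3 → ℂ := fun u =>
    shear (eval u (n 0) / eval u (d 0)) (eval u (n 1) / eval u (d 1)) (eval u (n 2) / eval u (d 2))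
  let p : Fin 3 → MvPolynomial (Fin 2) ℂ := ![n 0, n 1 * d 0 ^ 2 + n 0 ^ 2 * d 1,
    n 2 * (d 0 ^ 3 * d 1) + 3 * n 0 * n 1 * (d 0 ^ 2 * d 2) + 2 * n 0 ^ 3 * (d 1 * d 2)]
  let r : Fin 3 → MvPolynomial (Fin 2) ℂ := ![d 0, d 1 * d 0 ^ 2, d 2 * (d 0 ^ 3 * d 1)]
  have hpr : ∀ u i, eval u (d 0) ≠ 0 → eval u (d 1) ≠ 0 → eval u (d 2) ≠ 0 →
      eval u (r i) ≠ 0 ∧ m u i = eval u (p i) / eval u (r i) := by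
    intro u i h0 h1 h2
    have e1 := sheared_one (n₀ := eval u (n 0)) (n₁ := eval u (n 1)) h0 h1
    have e2 := sheared_two (n₀ := eval u (n 0)) (n₁ := eval u (n 1)) (n₂ := eval u (n 2)) h0 h1 h2
    fin_cases i
    · exact ⟨h0, rfl⟩
    · refine ⟨?_, ?_⟩
      · simp [r, h0, h1]
      · simp [m, p, r, shear, e1]
    · refine ⟨?_, ?_⟩
      · simp [r, h0, h1, h2]
      · simp [m, p, r, shear, e2]
  obtain ⟨u₀, hu₀⟩ := hne
  let φ : A2.carrier → (affine C).carrier := fun u =>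
    if h : eval u.1 H ≠ 0 then ⟨m u.1, hm _ h⟩ else ⟨m u₀, hm _ hu₀⟩
  have hφ : ∀ u : A2.carrier, eval u.1 H ≠ 0 → (φ u).1 = m u.1 :=
    fun u hu => congrArg Subtype.val (dif_pos hu)
  refine irreducibleSpace_affine (X := A2) (φ := φ) (U := {u : A2.carrier | eval u.1 H ≠ 0})
    (isMorphismOn_affine (isOpen_polyVal_ne_zero _ H) fun i => ?_) ⟨⟨u₀, trivial⟩, hu₀⟩ ?_
  · refine regularOn_div (p i) (r i) fun u hu => ?_
    have hu' : eval u.1 H ≠ 0 := hu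
    rw [hφ u hu']
    exact hpr u.1 i (hd _ 0 hu') (hd _ 1 hu') (hd _ 2 hu')
  · intro v hv P hP
    rw [eq_shear v] at hv
    obtain ⟨γ, u, hγ, h0, h1, h2, h⟩ := hpath _ _ _ hv
    have hc := continuousAt_shear (hγ 0) (hγ 1) (hγ 2)
    have h3 : shear (γ 0 0) (γ 1 0) (γ 2 0) = v := by
      rw [h0, h1, h2]
      exact (eq_shear v).symm
    obtain ⟨ε, h4, h5, h6⟩ := ((eventually_eval_ne_zero hc (P := P) (by rwa [h3])).and h).exists
    refine ⟨⟨u ε, trivial⟩, h5, ?_⟩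
    rw [hφ ⟨u ε, trivial⟩ h5]
    have h7 : ∀ i, eval (u ε) (n i) / eval (u ε) (d i) = γ i ε := fun i => by
      rw [h6, mul_div_cancel_right₀ _ (hd _ i h5)]
    simp only [m, h7]
    exact h4

instance : IrreducibleSpace (affine (level integralIV)).carrier := by
  refine irreducibleSpace_of_shear ![X 0, X 1, 1] 1 1 ⟨0, by simp⟩ (by simp)
    (fun u _ => shear_mem_integralIV.2 (by simp)) fun x q a h =>
      ⟨fun i _ => ![x, q, a] i, fun _ => ![x, q], fun _ => continuousAt_const, rfl, rfl, rfl,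
        Eventually.of_forall fun ε => ⟨by simp, fun i => ?_⟩⟩
  have := shear_mem_integralIV.1 h
  fin_cases i <;> simp [this]

/-- Away from x = 0 the quadric is the graph a = (q² + 1)/(2x). -/
instance : IrreducibleSpace (affine (level integralV)).carrier := by
  refine irreducibleSpace_of_shear ![X 0, X 1, X 1 ^ 2 + 1] ![1, 1, 2 * X 0] (X 0)
    ⟨fun _ => 1, by simp⟩ (fun u i h => ?_) (fun u h => shear_mem_integralV.2 ?_) fun x q a h => ?_
  · rw [eval_X] at h
    fin_cases i <;> simp [h]
  · rw [eval_X] at h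
    simp
    field_simp
  · have h := shear_mem_integralV.1 h
    by_cases hx : x = 0
    · subst hx
      -- Here q² = -1. Along x = ε, a slope m of q must satisfy 2qm = 2a, that is m = -aq; the term
      -- -a²ε/2 in the last coordinate then makes the equation exact.
      refine ⟨![fun ε => ε, fun ε => q - a * q * ε, fun ε => a - a ^ 2 * ε / 2],
        fun ε => ![ε, q - a * q * ε], fun i => ?_, rfl, ?_, ?_, ?_⟩
      · fin_cases i <;> simp <;> fun_prop
      · simp
      · simp
      · filter_upwards [self_mem_nhdsWithin] with ε hε
        refine ⟨by simpa using hε, fun i => ?_⟩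
        fin_cases i
        · simp
        · simp
        · simp
          linear_combination (-1 + 2 * a * ε - a ^ 2 * ε ^ 2) * h
    · refine ⟨fun i _ => ![x, q, a] i, fun _ => ![x, q], fun _ => continuousAt_const, rfl, rfl, rfl,
        Eventually.of_forall fun ε => ⟨by simpa using hx, fun i => ?_⟩⟩
      fin_cases i
      · simp
      · simp
      · simp
        linear_combination -h

/-- The equation is linear in x, so x = (8q³ - 1 - 3a²)/(12aq) wherever aq ≠ 0. The curves q = 0 and
a = 0 on the surface are disjoint and are approached separately. -/
instance : IrreducibleSpace (affine (level integralVI)).carrier := by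
  refine irreducibleSpace_of_shear ![8 * X 1 ^ 3 - 1 - 3 * X 0 ^ 2, X 1, X 0]
    ![12 * X 0 * X 1, 1, 1] (X 0 * X 1)
    ⟨fun _ => 1, by simp⟩ (fun u i h => ?_) (fun u h => shear_mem_integralVI.2 ?_) fun x q a h => ?_
  · simp only [map_mul, eval_X, ne_eq, mul_eq_zero, not_or] at h
    fin_cases i <;> simp [h]
  · simp only [map_mul, eval_X, ne_eq, mul_eq_zero, not_or] at h
    obtain ⟨h0, h1⟩ := h
    simp
    field_simp
    ring
  · have h := shear_mem_integralVI.1 h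
    by_cases hq : q = 0
    · subst hq
      have ha : a ≠ 0 := by
        rintro rfl
        simp at h
      -- With q = ε and 3a² = -1, a slope m of a makes the formula for x tend to -m/2, whence m =
      -- -2x.
      have hc : ContinuousAt (fun ε : ℂ => a - 2 * x * ε) 0 := by fun_prop
      refine ⟨![fun ε => (8 * ε ^ 2 + 12 * a * x - 12 * x ^ 2 * ε) / (12 * (a - 2 * x * ε)),
        fun ε => ε, fun ε => a - 2 * x * ε], fun ε => ![a - 2 * x * ε, ε], fun i => ?_, ?_, rfl,
        ?_, ?_⟩
      · fin_cases i
        · exact ContinuousAt.div (by fun_prop) (by fun_prop) (by simpa using ha)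
        · exact continuousAt_id
        · exact hc
      · simp
        field_simp
      · simp
      · filter_upwards [self_mem_nhdsWithin,
          (hc.eventually_ne (by simpa using ha)).filter_mono nhdsWithin_le_nhds] with ε hε ha'
        have hε : ε ≠ 0 := hε
        refine ⟨by simpa using ⟨ha', hε⟩, fun i => ?_⟩
        fin_cases i
        · have e : ∀ m : ℂ, m / (12 * (a - 2 * x * ε)) * (12 * (a - 2 * x * ε) * ε) = m * ε :=
            fun m => by field_simp
          simp [e]
          linear_combination -h
        · simp
        · simp
    · by_cases ha : a = 0
      · subst ha
        -- With a = ε and 8q³ = 1, a slope m of q makes the formula for x tend to 2qm, whence m =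
        -- x/(2q).
        have hc : ContinuousAt (fun ε : ℂ => q + x / (2 * q) * ε) 0 := by fun_prop
        refine ⟨![fun ε => (24 * q ^ 2 * (x / (2 * q)) + 24 * q * (x / (2 * q)) ^ 2 * ε +
          8 * (x / (2 * q)) ^ 3 * ε ^ 2 - 3 * ε) / (12 * (q + x / (2 * q) * ε)),
          fun ε => q + x / (2 * q) * ε, fun ε => ε], fun ε => ![ε, q + x / (2 * q) * ε],
          fun i => ?_, ?_, ?_, rfl, ?_⟩
        · fin_cases i
          · exact ContinuousAt.div (by fun_prop) (by fun_prop) (by simpa using hq)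
          · exact hc
          · exact continuousAt_id
        · simp
          field_simp
          ring
        · simp
        · filter_upwards [self_mem_nhdsWithin,
            (hc.eventually_ne (by simpa using hq)).filter_mono nhdsWithin_le_nhds] with ε hε hq'
          have hε : ε ≠ 0 := hε
          refine ⟨by simpa using ⟨hε, hq'⟩, fun i => ?_⟩
          fin_cases i
          · generalize x / (2 * q) = s at *
            simp
            field_simp
            linear_combination -h
          · simp
          · simp
      · refine ⟨fun i _ => ![x, q, a] i, fun _ => ![a, q], fun _ => continuousAt_const, rfl, rfl,
          rfl, Eventually.of_forall fun ε => ⟨by simpa using ⟨ha, hq⟩, fun i => ?_⟩⟩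
        fin_cases i
        · simp
          linear_combination -h
        · simp
        · simp

/-! ### Solutions with affine inverse -/

/-- If `f = N / Δ`, `Df - f² = Q / Δ` and `D²f - 3fDf + f³ = A / Δ`, then `f`, `Df` and `D²f` are
the quotients of these polynomials by `Δ`, `Δ²` and `Δ³`. -/
noncomputable def shearJet (N Q A Δ : MvPolynomial (Fin 2) ℂ) : Fin 3 → MvPolynomial (Fin 2) ℂ :=
  ![N, Q * Δ + N ^ 2, A * Δ ^ 2 + 3 * N * Q * Δ + 2 * N ^ 3]

/-- The equations `x''' = (3-κ)xz + (3+κ)y² - (3-κ)x²y`, where `y = x'` and `z = x''`. With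
`q = y - x²` and `a = z - 3xy + x³` they become `x' = q + x²`, `q' = a + xq`, `a' = κ(q² - ax)`. -/
noncomputable def chazyPencil (κ : ℂ) : MvPolynomial (Fin 3) ℂ :=
  C (3 - κ) * X 0 * X 2 + C (3 + κ) * X 1 ^ 2 - C (3 - κ) * X 0 ^ 2 * X 1

section ShearJet

variable {c α b κ : ℂ} {N Q A Δ : MvPolynomial (Fin 2) ℂ} {B : MvPolynomial (Fin 3) ℂ} {n : ℕ}

theorem jetPoint_shearJet {u : Fin 2 → ℂ} (h : eval u Δ ≠ 0) :
    jetPoint (shearJet N Q A Δ) Δ u =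
      shear (eval u N / eval u Δ) (eval u Q / eval u Δ) (eval u A / eval u Δ) := by
  funext i
  fin_cases i
  · simp [jetPoint, wscale, shear, shearJet, div_eq_inv_mul]
  · simp [jetPoint, wscale, shear, shearJet]
    field_simp
  · simp [jetPoint, wscale, shear, shearJet]
    field_simp

/-- The hypotheses `hN`, `hQ`, `hA` are the system x' = q + x², q' = a + xq, a' = κ(q² - ax)
multiplied by Δ². The equations for the jet follow from them by the Leibniz rule. -/
theorem isSolution_shearJet
    (hN : torusDer c α b N * Δ - N * torusDer c α b Δ = Q * Δ + N ^ 2)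
    (hQ : torusDer c α b Q * Δ - Q * torusDer c α b Δ = A * Δ + N * Q)
    (hA : torusDer c α b A * Δ - A * torusDer c α b Δ = C κ * (Q ^ 2 - A * N))
    (hB : ∀ t v, eval (wscale ![1, 2, 3] t v) B = t ^ n * eval v B)
    (hint : aeval (shearJet N Q A Δ) B = Δ ^ n) :
    IsSolution c α b (chazyPencil κ) B n (shearJet N Q A Δ) Δ where
  first := hN
  second := by
    simp only [shearJet, Matrix.cons_val, map_add, Derivation.leibniz, Derivation.leibniz_pow,
      smul_eq_mul, nsmul_eq_mul]
    push_cast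
    linear_combination Δ * hQ + 2 * N * hN
  third := by
    have h3 : torusDer c α b (3 : MvPolynomial (Fin 2) ℂ) = 0 :=
      Derivation.map_natCast (torusDer c α b) 3
    have h2 : torusDer c α b (2 : MvPolynomial (Fin 2) ℂ) = 0 :=
      Derivation.map_natCast (torusDer c α b) 2
    simp only [shearJet, Matrix.cons_val, map_add, Derivation.leibniz, Derivation.leibniz_pow,
      smul_eq_mul, nsmul_eq_mul, chazyPencil, map_sub, map_mul, map_pow, aeval_X, aeval_C,
      algebraMap_eq, h2, h3]
    push_cast
    simp only [map_ofNat]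
    linear_combination Δ ^ 2 * hA + 3 * Δ * N * hQ + (3 * Q * Δ + 6 * N ^ 2) * hN
  weight_eqn t v := by
    simp [chazyPencil, wscale]
    ring
  weight_integral := hB
  integral := hint

/-- If T acts on (Δ, N, Q, A) by μ·(1, ζ, ζ², ζ³), then x, q, a are scaled by ζ, ζ², ζ³, and so are
x, y, z since the change of variables is weighted homogeneous. -/
theorem eval_shearJet_smul {u u' : Fin 2 → ℂ} {ζ μ : ℂ} (hΔ : eval u' Δ = μ * eval u Δ)
    (hN : eval u' N = ζ * μ * eval u N) (hQ : eval u' Q = ζ ^ 2 * μ * eval u Q)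
    (hA : eval u' A = ζ ^ 3 * μ * eval u A) (i : Fin 3) :
    eval u' (shearJet N Q A Δ i) =
      (ζ * μ) ^ (![1, 2, 3] i : ℕ) * eval u (shearJet N Q A Δ i) := by
  fin_cases i
  · simp [shearJet, hN]
  · simp [shearJet, hN, hQ, hΔ]
    ring
  · simp [shearJet, hN, hQ, hA, hΔ]
    ring

/-- The value at `(t, x, q, a)` of a linear form. -/
def form (k : Fin 4 → ℂ) (t x q a : ℂ) : ℂ := k 0 * t + k 1 * x + k 2 * q + k 3 * a

/-- The polynomial in `x, y, z` which is the given affine function of `x, q, a`. -/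
noncomputable def formPoly (k : Fin 4 → ℂ) : MvPolynomial (Fin 3) ℂ :=
  C (k 0) + C (k 1) * X 0 + C (k 2) * (X 1 - X 0 ^ 2) + C (k 3) * (X 2 - 3 * X 0 * X 1 + X 0 ^ 3)

theorem eval_formPoly (k : Fin 4 → ℂ) (x q a : ℂ) :
    eval (shear x q a) (formPoly k) = form k 1 x q a := by
  simp only [shear, formPoly, form, map_add, map_sub, map_mul, map_pow, eval_X, eval_C, map_ofNat,
    Matrix.cons_val]
  ring

/-- The affine coordinates of the plane are recovered as quotients of affine forms in x, q, a. `G`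
allows a further locus to be removed, and the explicit point certifies that what remains is
nonempty. -/
theorem exists_birationalMap [IrreducibleSpace (affine (level B)).carrier]
    {P : MvPolynomial (Fin 3) ℂ} (hJ : IsSolution c α b P B n (shearJet N Q A Δ) Δ)
    (k l : Fin 2 → Fin 4 → ℂ) (G : MvPolynomial (Fin 3) ℂ)
    (hl : ∀ u i, form (k i) (eval u Δ) (eval u N) (eval u Q) (eval u A) =
      u i * form (l i) (eval u Δ) (eval u N) (eval u Q) (eval u A))
    (hr : ∀ x q a, shear x q a ∈ level B → eval (shear x q a) G ≠ 0 →
      (∀ i, form (l i) 1 x q a ≠ 0) → ∀ u : Fin 2 → ℂ,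
      (∀ i, form (k i) 1 x q a = u i * form (l i) 1 x q a) →
      eval u N = x * eval u Δ ∧ eval u Q = q * eval u Δ ∧ eval u A = a * eval u Δ)
    {x₀ q₀ a₀ : ℂ} {u₀ : Fin 2 → ℂ} (hB : shear x₀ q₀ a₀ ∈ level B)
    (hG : eval (shear x₀ q₀ a₀) G ≠ 0) (hl₀ : ∀ i, form (l i) 1 x₀ q₀ a₀ ≠ 0)
    (hu₀ : ∀ i, form (k i) 1 x₀ q₀ a₀ = u₀ i * form (l i) 1 x₀ q₀ a₀) (hΔ : eval u₀ Δ ≠ 0) :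
    ∃ Φ : BirationalMap A2 (affine (level B)), ∀ u : A2.carrier, eval u.1 Δ ≠ 0 →
      (Φ.toFun u).1 = jetPoint (shearJet N Q A Δ) Δ u.1 := by
  have hH : ∀ v, eval v (G * formPoly (l 0) * formPoly (l 1)) ≠ 0 →
      eval v G ≠ 0 ∧ ∀ i, eval v (formPoly (l i)) ≠ 0 := fun v hv => by
    simp only [map_mul, ne_eq, mul_eq_zero, not_or] at hv
    refine ⟨hv.1.1, fun i => ?_⟩
    fin_cases i
    · exact hv.1.2
    · exact hv.2
  refine ⟨hJ.birationalMap (p := fun i => formPoly (k i)) (m := fun i => formPoly (l i))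
    (H := G * formPoly (l 0) * formPoly (l 1)) ?_ (fun v i hv => (hH v hv).2 i) ?_
    ⟨shear x₀ q₀ a₀, hB, ?_, ?_⟩ ⟨_, hB⟩, fun u hu => hJ.toLevel_of_ne _ hu⟩
  · intro u i hu
    have e : ∀ k : Fin 4 → ℂ, eval (jetPoint (shearJet N Q A Δ) Δ u) (formPoly k) =
        form k (eval u Δ) (eval u N) (eval u Q) (eval u A) / eval u Δ := fun k => by
      rw [jetPoint_shearJet hu, eval_formPoly, form, form]
      field_simp
    rw [e, e, hl, mul_div_assoc]
  · intro v hv hvH hΔ'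
    obtain ⟨h1, h2⟩ := hH v hvH
    rw [eq_shear v] at hv
    have e : ∀ k, eval v (formPoly k) =
        form k 1 (v 0) (v 1 - v 0 ^ 2) (v 2 - 3 * v 0 * v 1 + v 0 ^ 3) := fun k => by
      rw [← eval_formPoly]
      exact congrArg (fun w => eval w (formPoly k)) (eq_shear v)
    obtain ⟨e1, e2, e3⟩ := hr _ _ _ hv
      (by rw [← eq_shear v]; exact h1) (fun i => by rw [← e]; exact h2 i)
      (fun i => eval v (formPoly (k i)) / eval v (formPoly (l i)))
      (fun i => by rw [← e, ← e, div_mul_cancel₀ _ (h2 i)])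
    rw [jetPoint_shearJet hΔ', e1, e2, e3, mul_div_cancel_right₀ _ hΔ',
      mul_div_cancel_right₀ _ hΔ', mul_div_cancel_right₀ _ hΔ']
    exact (eq_shear v).symm
  · rw [map_mul, map_mul, eval_formPoly, eval_formPoly]
    exact mul_ne_zero (mul_ne_zero hG (hl₀ 0)) (hl₀ 1)
  · have : (fun i => eval (shear x₀ q₀ a₀) (formPoly (k i)) /
        eval (shear x₀ q₀ a₀) (formPoly (l i))) = u₀ := by
      funext i
      rw [eval_formPoly, eval_formPoly, hu₀, mul_div_cancel_right₀ _ (hl₀ i)]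
    rw [this]
    exact hΔ

end ShearJet

/-! ### The Chazy IV equation -/

theorem sq_add_self_add_one {ω : ℂ} (hω : IsPrimitiveRoot ω 3) : ω ^ 2 + ω + 1 = 0 := by
  have h := hω.geom_sum_eq_zero (by norm_num)
  simp only [Finset.sum_range_succ, Finset.sum_range_zero, pow_zero, pow_one] at h
  linear_combination h

theorem chazyIV_eq : chazyIV = chazyPencil 0 := by
  simp [chazyIV, chazyPencil, map_ofNat]

/-- Up to sign, `numIV`, `midIV` and `denIV` are the discrete Fourier transform of (X, Y, 1), which
diagonalizes the cyclic permutation `T3`. The numerator of `f3` is `numIV` because -(ω + 1) = ω². -/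
noncomputable def numIV (ω : ℂ) : MvPolynomial (Fin 2) ℂ := X 0 + C ω * X 1 + C ω ^ 2

noncomputable def denIV (ω : ℂ) : MvPolynomial (Fin 2) ℂ := X 0 + C ω ^ 2 * X 1 + C ω

noncomputable def midIV : MvPolynomial (Fin 2) ℂ := -(X 0 + X 1 + 1)

theorem isSolution_IV {ω : ℂ} (hω : ω ^ 2 + ω + 1 = 0) :
    IsSolution (ω - 1) 1 (-ω) chazyIV integralIV 3
      (shearJet (numIV ω) midIV (denIV ω) (denIV ω)) (denIV ω) := by
  have hC : (C ω ^ 2 + C ω + 1 : MvPolynomial (Fin 2) ℂ) = 0 := by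
    rw [← map_pow, ← map_add, ← C_1, ← map_add, hω, map_zero]
  rw [chazyIV_eq]
  refine isSolution_shearJet ?_ ?_ ?_ (fun t v => ?_) ?_
  · simp only [numIV, midIV, denIV, map_add, map_neg, map_sub, map_mul, map_one,
      Derivation.leibniz, Derivation.leibniz_pow, derivation_C, torusDer_X_zero,
      torusDer_X_one, smul_eq_mul, nsmul_eq_mul, mul_zero]
    grind
  · simp only [numIV, midIV, denIV, map_add, map_neg, map_sub, map_mul, map_one,
      Derivation.leibniz, Derivation.leibniz_pow, derivation_C, torusDer_X_zero,
      torusDer_X_one, smul_eq_mul, nsmul_eq_mul, mul_zero, Derivation.map_one_eq_zero]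
    grind
  · rw [map_zero, zero_mul, mul_comm, sub_self]
  · simp [integralIV, wscale]
    ring
  · simp only [integralIV, shearJet, map_add, map_sub, map_mul, map_pow, aeval_X, map_ofNat,
      Matrix.cons_val]
    ring

theorem exists_birationalMap_IV {ω : ℂ} (hω : ω ^ 2 + ω + 1 = 0) :
    ∃ Φ : BirationalMap A2 (affine (level integralIV)), ∀ u : A2.carrier,
      eval u.1 (denIV ω) ≠ 0 →
      (Φ.toFun u).1 = jetPoint (shearJet (numIV ω) midIV (denIV ω) (denIV ω)) (denIV ω) u.1 := by
  have hω0 : ω ≠ 0 := by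
    rintro rfl
    simp at hω
  -- This is the inverse Fourier transform: evaluated on (Δ, N, Q) the three forms are -3X, -3Y and
  -- -3.
  refine exists_birationalMap (isSolution_IV hω) ![![-1, -1, 1, 0], ![-ω, -ω ^ 2, 1, 0]]
    (fun _ => ![-ω ^ 2, -ω, 1, 0]) 1 (fun u i => ?_) (fun x q a h _ hl u hu => ?_)
    (x₀ := 0) (q₀ := 0) (a₀ := 1) (u₀ := ![ω, ω ^ 2]) (shear_mem_integralIV.2 rfl) (by simp)
    (fun i => ?_) (fun i => ?_) ?_
  · fin_cases i
    · simp [form, numIV, midIV, denIV]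
      grind
    · simp [form, numIV, midIV, denIV]
      grind
  · have ha := shear_mem_integralIV.1 h
    have h0 := hu 0
    have h1 := hu 1
    have hl := hl 0
    simp [form] at h0 h1 hl
    refine ⟨?_, ?_, by rw [ha, one_mul]⟩
    · refine mul_right_cancel₀ hl ?_
      simp [numIV, denIV]
      grind
    · refine mul_right_cancel₀ hl ?_
      simp [midIV, denIV]
      grind
  · simp [form, hω0]
  · fin_cases i
    · simp [form]
      grind
    · simp [form]
      grind
  · have : eval ![ω, ω ^ 2] (denIV ω) = 3 * ω := by
      simp [denIV]
      grind
    rw [this]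
    exact mul_ne_zero three_ne_zero hω0

theorem chazyIV_equivalence {ω : ℂ} (hω : IsPrimitiveRoot ω 3) :
    (∀ (M : FunSpace) (ρ : BirationalMap M (cyclicQuot P2 T3)),
        BirationallyEquivalent (chazyFoliation chazyIV) (pull ρ.toFun (F3 ω))) ∧
      ∃ Φ : BirationalMap P2 (affine (level integralIV)),
        (∀ x y : ℂ, ω ^ 2 * y + x + ω ≠ 0 →
          (Φ.toFun (ptP2 x y)).1 = jet (ω - 1) 1 (-ω) (f3 ω) x y) ∧
        InducesEquivalence T3 (E3 ω) chazyIV integralIV (ω ^ 2) Φ := by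
  have hω' := sq_add_self_add_one hω
  obtain ⟨D, hD⟩ := exists_torusField (ω - 1) 1 (-ω)
  obtain ⟨Φ, hΦ⟩ := exists_birationalMap_IV hω'
  have hJ := isSolution_IV hω'
  have hd : ∀ x y, eval ![x, y] (denIV ω) = ω ^ 2 * y + x + ω := fun x y => by
    simp [denIV]
    ring
  have heq : ∀ᶠ p in P2.generic, ∃ μ : ℂ, μ ≠ 0 ∧
      eval (chartP2.inverse.toFun (T3 p)).1 (denIV ω) =
        μ * eval (chartP2.inverse.toFun p).1 (denIV ω) ∧
      ∀ i, eval (chartP2.inverse.toFun (T3 p)).1 (shearJet (numIV ω) midIV (denIV ω) (denIV ω) i) =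
        (ω ^ 2 * μ) ^ (![1, 2, 3] i : ℕ) * eval (chartP2.inverse.toFun p).1
          (shearJet (numIV ω) midIV (denIV ω) (denIV ω) i) := by
    filter_upwards [generic_T3] with p hp
    obtain ⟨h0, h1, h⟩ := hp
    rw [h]
    generalize (chartP2.inverse.toFun p).1 = u at h0 h1 h
    have hω3 := hω.pow_eq_one
    -- The factor 1/Y brings (1 : X : Y) back to the chart, and ω² is the eigenvalue of `denIV`.
    refine ⟨ω ^ 2 / u 1, div_ne_zero (pow_ne_zero _ (hω.ne_zero (by norm_num))) h1, ?_,
      eval_shearJet_smul (ζ := ω ^ 2) ?_ ?_ ?_ ?_⟩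
    all_goals
      simp [numIV, midIV, denIV]
      grind
  obtain ⟨h1, Φ', h2, h3⟩ := hJ.exists_equivalence (n := 3) (by norm_num)
    (hω.pow_of_coprime 2 (by norm_num))
    ⟨shear 1 0 1, shear_mem_integralIV.2 rfl, by simp [shear]⟩ continuous_T3 iterate_T3 chartP2 hD
    (E3_eq_line hω' (sub_ne_zero.2 (hω.ne_one (by norm_num))) hD) Φ hΦ
    ⟨![-ω + 1, 0], by rw [hd]; simp⟩ heq
  refine ⟨h1, Φ', fun x y h => ?_, h3⟩
  rw [h2 _ (by rwa [chartP2_inverse_ptP2, hd]), chartP2_inverse_ptP2,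
    hJ.jet_eq (fun x y => ?_) (by rwa [hd])]
  rw [f3, hd]
  congr 1
  simp [shearJet, numIV]
  grind

/-! ### The Chazy V equation -/

theorem chazyV_eq : chazyV = chazyPencil 1 := by
  have h1 : (3 - 1 : ℂ) = 2 := by norm_num
  have h2 : (3 + 1 : ℂ) = 4 := by norm_num
  rw [chazyV, chazyPencil, h1, h2, map_ofNat, map_ofNat]

/-- The four polynomials `numV`, `denV`, `midV`, `lastV` are a basis of the forms of bidegree (1,1)
adapted to `T4`. They give the Segre embedding, with image the quadric 2AN = Q² + Δ². -/
noncomputable def numV : MvPolynomial (Fin 2) ℂ := X 0 * X 1 - X 0 - X 1 + 1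

noncomputable def denV : MvPolynomial (Fin 2) ℂ :=
  X 0 * X 1 + C Complex.I * X 0 - C Complex.I * X 1 - 1

noncomputable def midV : MvPolynomial (Fin 2) ℂ :=
  -X 0 * X 1 + C Complex.I * X 0 - C Complex.I * X 1 + 1

noncomputable def lastV : MvPolynomial (Fin 2) ℂ := X 0 * X 1 + X 0 + X 1 + 1

theorem isSolution_V :
    IsSolution (Complex.I - 1) Complex.I 1 chazyV integralV 4 (shearJet numV midV lastV denV)
      denV := by
  have hC : (C Complex.I ^ 2 : MvPolynomial (Fin 2) ℂ) = -1 := by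
    rw [← map_pow, Complex.I_sq, map_neg, C_1]
  rw [chazyV_eq]
  refine isSolution_shearJet ?_ ?_ ?_ (fun t v => ?_) ?_
  · simp only [numV, midV, denV, map_add, map_sub, map_mul, map_one,
      Derivation.leibniz, derivation_C, torusDer_X_zero,
      torusDer_X_one, smul_eq_mul, mul_zero, Derivation.map_one_eq_zero]
    grind
  · simp only [numV, midV, lastV, denV, map_add, map_neg, map_sub, map_mul, map_one,
      Derivation.leibniz, derivation_C, torusDer_X_zero,
      torusDer_X_one, smul_eq_mul, mul_zero, Derivation.map_one_eq_zero]
    grind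
  · simp only [numV, midV, lastV, denV, map_add, map_sub, map_mul, map_one,
      Derivation.leibniz, derivation_C, torusDer_X_zero,
      torusDer_X_one, smul_eq_mul, mul_zero, Derivation.map_one_eq_zero]
    grind
  · simp [integralV, wscale]
    ring
  · simp only [integralV, shearJet, map_add, map_sub, map_mul, map_pow, aeval_X, map_ofNat,
      Matrix.cons_val]
    have h : 2 * lastV * numV - midV ^ 2 = denV ^ 2 := by
      simp only [numV, midV, lastV, denV]
      grind
    linear_combination denV ^ 2 * h

theorem exists_birationalMap_V :
    ∃ Φ : BirationalMap A2 (affine (level integralV)), ∀ u : A2.carrier, eval u.1 denV ≠ 0 →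
      (Φ.toFun u).1 = jetPoint (shearJet numV midV lastV denV) denV u.1 := by
  have hI := Complex.I_sq
  -- The inverse consists of the two rulings of the quadric: X comes from the planes through the
  -- line x = 0, q = i, and Y from those through x = 0, q = -i. The value of a is recovered from the
  -- equation of the quadric after division by x, hence the auxiliary polynomial x.
  refine exists_birationalMap isSolution_V
    ![![-Complex.I, -(1 + Complex.I), 1, 0], ![Complex.I, Complex.I - 1, 1, 0]]
    ![![-Complex.I, 1 + Complex.I, 1, 0], ![Complex.I, 1 - Complex.I, 1, 0]] (X 0)
    (fun u i => ?_) (fun x q a h hx hl u hu => ?_)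
    (x₀ := 1) (q₀ := 0) (a₀ := 1 / 2) (u₀ := ![-1 - 2 * Complex.I, -1 + 2 * Complex.I])
    (shear_mem_integralV.2 (by norm_num)) (by simp [shear])
    (fun i => ?_) (fun i => ?_) ?_
  · fin_cases i
    · simp [form, numV, midV, lastV, denV]
      grind
    · simp [form, numV, midV, lastV, denV]
      grind
  · have ha := shear_mem_integralV.1 h
    have h0 := hu 0
    have h1 := hu 1
    have hx : x ≠ 0 := by simpa [shear] using hx
    have hl0 := hl 0
    have hl1 := hl 1
    simp [form] at h0 h1 hl0 hl1
    refine ⟨?_, ?_, ?_⟩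
    · refine mul_right_cancel₀ (mul_ne_zero hl0 hl1) ?_
      simp [numV, denV]
      grind
    · refine mul_right_cancel₀ (mul_ne_zero hl0 hl1) ?_
      simp [midV, denV]
      grind
    · refine mul_right_cancel₀ (mul_ne_zero hx (mul_ne_zero hl0 hl1)) ?_
      simp [lastV, denV]
      grind
  · fin_cases i <;> simp [form]
  · fin_cases i
    · simp [form]
      grind
    · simp [form]
      grind
  · have : eval ![-1 - 2 * Complex.I, -1 + 2 * Complex.I] denV = 8 := by
      simp [denV]
      grind
    rw [this]
    norm_num

theorem chazyV_equivalence :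
    (∀ (M : FunSpace) (ρ : BirationalMap M (cyclicQuot P1P1 T4)),
        BirationallyEquivalent (chazyFoliation chazyV) (pull ρ.toFun F4)) ∧
      ∃ Φ : BirationalMap P1P1 (affine (level integralV)),
        (∀ x y : ℂ, x * y + Complex.I * x - Complex.I * y - 1 ≠ 0 →
          (Φ.toFun (ptP1P1 x y)).1 =
            jet (Complex.I - 1) Complex.I 1 f4 x y) ∧
        InducesEquivalence T4 E4 chazyV integralV Complex.I Φ := by
  obtain ⟨D, hD⟩ := exists_torusField (Complex.I - 1) Complex.I 1
  obtain ⟨Φ, hΦ⟩ := exists_birationalMap_V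
  have hI := Complex.I_sq
  have hd : ∀ x y, eval ![x, y] denV = x * y + Complex.I * x - Complex.I * y - 1 := fun x y => by
    simp [denV]
  have heq : ∀ᶠ p in P1P1.generic, ∃ μ : ℂ, μ ≠ 0 ∧
      eval (chartP1P1.inverse.toFun (T4 p)).1 denV =
        μ * eval (chartP1P1.inverse.toFun p).1 denV ∧
      ∀ i, eval (chartP1P1.inverse.toFun (T4 p)).1 (shearJet numV midV lastV denV i) =
        (Complex.I * μ) ^ (![1, 2, 3] i : ℕ) * eval (chartP1P1.inverse.toFun p).1
          (shearJet numV midV lastV denV i) := by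
    filter_upwards [generic_T4] with p hp
    obtain ⟨h0, h1, h⟩ := hp
    rw [h]
    generalize (chartP1P1.inverse.toFun p).1 = u at h0 h1 h
    refine ⟨Complex.I / u 0, div_ne_zero Complex.I_ne_zero h0, ?_,
      eval_shearJet_smul (ζ := Complex.I) ?_ ?_ ?_ ?_⟩
    all_goals
      simp [numV, midV, lastV, denV]
      grind
  have hc : Complex.I - 1 ≠ 0 := fun h => by grind
  obtain ⟨h1, Φ', h2, h3⟩ := isSolution_V.exists_equivalence (by norm_num)
    Complex.isPrimitiveRoot_I
    ⟨shear 1 0 (1 / 2), shear_mem_integralV.2 (by norm_num), by simp [shear]⟩ continuous_T4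
    iterate_T4 chartP1P1 hD (E4_eq_line hc hD) Φ hΦ ⟨![0, 0], by rw [hd]; simp⟩ heq
  refine ⟨h1, Φ', fun x y h => ?_, h3⟩
  rw [h2 _ (by rwa [chartP1P1_inverse_pt, hd]), chartP1P1_inverse_pt,
    isSolution_V.jet_eq (fun x y => ?_) (by rwa [hd])]
  rw [f4, hd]
  congr 1
  simp [shearJet, numV]
  ring

/-! ### The Chazy VI equation -/

theorem chazyVI_eq : chazyVI = chazyPencil 2 := by
  have h1 : (3 - 2 : ℂ) = 1 := by norm_num
  have h2 : (3 + 2 : ℂ) = 5 := by norm_num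
  rw [chazyVI, chazyPencil, h1, h2, map_ofNat, C_1, one_mul, one_mul]

/-- `numVI`, `denVI`, `midVI`, `lastVI` homogenize to cubic forms without pure cubes, that is,
vanishing at the vertices of the coordinate triangle. The last one is (X - 1)(Y - 1)(X - Y).
Together they satisfy the cubic equation 8Q³ - 3A²Δ - 12ANQ = Δ³. -/
noncomputable def numVI (ω : ℂ) : MvPolynomial (Fin 2) ℂ :=
  X 0 * (1 - X 1 ^ 2) - C ω ^ 2 * X 1 * (1 - X 0 ^ 2) + C ω * (X 1 ^ 2 - X 0 ^ 2)

noncomputable def denVI : MvPolynomial (Fin 2) ℂ :=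
  X 0 + X 1 + X 0 ^ 2 + X 1 ^ 2 + X 0 ^ 2 * X 1 + X 0 * X 1 ^ 2 - 6 * X 0 * X 1

noncomputable def midVI (ω : ℂ) : MvPolynomial (Fin 2) ℂ :=
  -(X 0 * (1 + X 1 ^ 2) + C ω * X 1 * (1 + X 0 ^ 2) + C ω ^ 2 * (X 0 ^ 2 + X 1 ^ 2))

noncomputable def lastVI : MvPolynomial (Fin 2) ℂ :=
  X 0 ^ 2 * X 1 - X 0 ^ 2 - X 0 * X 1 ^ 2 + X 0 + X 1 ^ 2 - X 1

theorem isSolution_VI {ω : ℂ} (hω : ω ^ 2 + ω + 1 = 0) :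
    IsSolution (-ω ^ 2) 1 (-ω) chazyVI integralVI 6
      (shearJet (numVI ω) (midVI ω) lastVI denVI) denVI := by
  have hC : (C ω ^ 2 + C ω + 1 : MvPolynomial (Fin 2) ℂ) = 0 := by
    rw [← map_pow, ← map_add, ← C_1, ← map_add, hω, map_zero]
  have h6 : torusDer (-ω ^ 2) 1 (-ω) (6 : MvPolynomial (Fin 2) ℂ) = 0 :=
    Derivation.map_natCast (torusDer (-ω ^ 2) 1 (-ω)) 6
  rw [chazyVI_eq]
  refine isSolution_shearJet ?_ ?_ ?_ (fun t v => ?_) ?_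
  · simp only [numVI, midVI, denVI, map_add, map_neg, map_sub, map_mul, map_one, map_pow,
      Derivation.leibniz, Derivation.leibniz_pow, derivation_C, torusDer_X_zero, h6,
      torusDer_X_one, smul_eq_mul, nsmul_eq_mul, mul_zero, Derivation.map_one_eq_zero]
    grind
  · simp only [numVI, midVI, lastVI, denVI, map_add, map_neg, map_sub, map_mul, map_one, map_pow,
      Derivation.leibniz, Derivation.leibniz_pow, derivation_C, torusDer_X_zero, h6,
      torusDer_X_one, smul_eq_mul, nsmul_eq_mul, mul_zero, Derivation.map_one_eq_zero]
    grind
  · simp only [numVI, midVI, lastVI, denVI, map_add, map_neg, map_sub, map_mul, map_one, map_pow,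
      Derivation.leibniz, Derivation.leibniz_pow, torusDer_X_zero, h6, torusDer_X_one,
      smul_eq_mul, nsmul_eq_mul, mul_zero, map_ofNat]
    grind
  · simp [integralVI, wscale]
    ring
  · simp only [integralVI, shearJet, map_add, map_sub, map_mul, map_pow, aeval_X, map_ofNat,
      Matrix.cons_val]
    have h : 8 * midVI ω ^ 3 - 3 * lastVI ^ 2 * denVI - 12 * lastVI * numVI ω * midVI ω =
        denVI ^ 3 := by
      simp only [numVI, midVI, lastVI, denVI]
      grind
    linear_combination denVI ^ 3 * h

/-- This is N = xΔ at the point X = p/m, Y = r/n, cleared of the denominator m²n². -/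
theorem num_eq_mul_den_VI {ω x q a : ℂ} (hω : ω ^ 2 + ω + 1 = 0)
    (ha : 3 * a ^ 2 + 12 * a * x * q + 1 = 8 * q ^ 3) {m p n r : ℂ}
    (hm : m = -1 + 2 * ω * x + 2 * ω ^ 2 * q + a) (hp : p = 1 + 2 * ω * x - 2 * ω ^ 2 * q + a)
    (hn : n = 1 + 2 * x - 2 * q + a) (hr : r = -1 + 2 * x + 2 * q + a) :
    p * m * (n ^ 2 - r ^ 2) - ω ^ 2 * r * n * (m ^ 2 - p ^ 2) +
      ω * (r ^ 2 * m ^ 2 - p ^ 2 * n ^ 2) =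
    x * (p * m * n ^ 2 + r * n * m ^ 2 + p ^ 2 * n ^ 2 + r ^ 2 * m ^ 2 + p ^ 2 * r * n +
      p * m * r ^ 2 - 6 * p * m * r * n) := by
  grind

theorem exists_birationalMap_VI {ω : ℂ} (hω : ω ^ 2 + ω + 1 = 0) :
    ∃ Φ : BirationalMap A2 (affine (level integralVI)), ∀ u : A2.carrier, eval u.1 denVI ≠ 0 →
      (Φ.toFun u).1 = jetPoint (shearJet (numVI ω) (midVI ω) lastVI denVI) denVI u.1 := by
  -- The cubic surface contains the lines 2ω²q = 1, a = -2ωx and 2q = 1, a = -2x; X and Y are the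
  -- pencils of planes through them. The base point has x = q = 0, where 3a² = -1 is solved by means
  -- of (2ω + 1)² = -3.
  refine exists_birationalMap (isSolution_VI hω)
    ![![1, 2 * ω, -2 * ω ^ 2, 1], ![-1, 2, 2, 1]]
    ![![-1, 2 * ω, 2 * ω ^ 2, 1], ![1, 2, -2, 1]] 1
    (fun u i => ?_) (fun x q a h _ hl u hu => ?_)
    (x₀ := 0) (q₀ := 0) (a₀ := (2 * ω + 1) / 3) (u₀ := ![ω ^ 2, ω])
    (shear_mem_integralVI.2 (by grind)) (by simp)
    (fun i => ?_) (fun i => ?_) ?_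
  · fin_cases i
    · simp [form, numVI, midVI, lastVI, denVI]
      grind
    · simp [form, numVI, midVI, lastVI, denVI]
      grind
  · have ha := shear_mem_integralVI.1 h
    have h0 := hu 0
    have h1 := hu 1
    have hl0 := hl 0
    have hl1 := hl 1
    simp [form] at h0 h1 hl0 hl1
    have hm := mul_ne_zero (pow_ne_zero 2 hl0) (pow_ne_zero 2 hl1)
    refine ⟨?_, ?_, ?_⟩
    · have e := num_eq_mul_den_VI hω ha (m := -1 + 2 * ω * x + 2 * ω ^ 2 * q + a)
        (n := 1 + 2 * x + -(2 * q) + a) (p := u 0 * (-1 + 2 * ω * x + 2 * ω ^ 2 * q + a))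
        (r := u 1 * (1 + 2 * x + -(2 * q) + a)) rfl (by linear_combination -h0) (by ring)
        (by linear_combination -h1)
      refine mul_right_cancel₀ hm ?_
      simp only [numVI, denVI, map_add, map_sub, map_mul, map_pow, map_one, eval_X, eval_C,
        map_ofNat]
      linear_combination e
    · refine mul_right_cancel₀ hm ?_
      simp [midVI, denVI]
      grind
    · refine mul_right_cancel₀ hm ?_
      simp [lastVI, denVI]
      grind
  · fin_cases i
    · simp [form]
      grind
    · simp [form]
      grind
  · fin_cases i
    · simp [form]
      grind
    · simp [form]
      grind
  · have : eval ![ω ^ 2, ω] denVI = -9 := by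
      simp [denVI]
      grind
    rw [this]
    norm_num

theorem isPrimitiveRoot_neg_sq {ω : ℂ} (hω : IsPrimitiveRoot ω 3) :
    IsPrimitiveRoot (-ω ^ 2) 6 := by
  have h := sq_add_self_add_one hω
  refine IsPrimitiveRoot.mk_of_lt _ (by norm_num) (by grind) fun l h0 h6 hl => ?_
  interval_cases l <;> grind

theorem chazyVI_equivalence {ω : ℂ} (hω : IsPrimitiveRoot ω 3) :
    (∀ (M : FunSpace) (ρ : BirationalMap M (cyclicQuot Bl3 T6)),
        BirationallyEquivalent (chazyFoliation chazyVI) (pull ρ.toFun (F6 ω))) ∧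
      ∃ Φ : BirationalMap Bl3 (affine (level integralVI)),
        (∀ (x y : ℂ) (hx : x ≠ 0) (hy : y ≠ 0),
          x + y + x ^ 2 + y ^ 2 + x ^ 2 * y + x * y ^ 2 - 6 * x * y ≠ 0 →
          (Φ.toFun (ptBl3 x y hx hy)).1 = jet (-ω ^ 2) 1 (-ω) (f6 ω) x y) ∧
        InducesEquivalence T6 (E6 ω) chazyVI integralVI (-ω ^ 2) Φ := by
  have hω' := sq_add_self_add_one hω
  have hω0 : ω ≠ 0 := hω.ne_zero (by norm_num)
  obtain ⟨D, hD⟩ := exists_torusField (-ω ^ 2) 1 (-ω)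
  obtain ⟨Φ, hΦ⟩ := exists_birationalMap_VI hω'
  have hJ := isSolution_VI hω'
  have hd : ∀ x y, eval ![x, y] denVI =
      x + y + x ^ 2 + y ^ 2 + x ^ 2 * y + x * y ^ 2 - 6 * x * y := fun x y => by
    simp [denVI]
  have heq : ∀ᶠ p in Bl3.generic, ∃ μ : ℂ, μ ≠ 0 ∧
      eval (chartBl3.inverse.toFun (T6 p)).1 denVI =
        μ * eval (chartBl3.inverse.toFun p).1 denVI ∧
      ∀ i, eval (chartBl3.inverse.toFun (T6 p)).1
          (shearJet (numVI ω) (midVI ω) lastVI denVI i) =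
        (-ω ^ 2 * μ) ^ (![1, 2, 3] i : ℕ) * eval (chartBl3.inverse.toFun p).1
          (shearJet (numVI ω) (midVI ω) lastVI denVI i) := by
    filter_upwards [generic_T6] with p hp
    obtain ⟨h0, h1, h⟩ := hp
    rw [h]
    generalize (chartBl3.inverse.toFun p).1 = u at h0 h1 h
    clear h hd hJ hΦ hD
    refine ⟨u 1 / u 0 ^ 2, div_ne_zero h1 (pow_ne_zero _ h0), ?_,
      eval_shearJet_smul (ζ := -ω ^ 2) ?_ ?_ ?_ ?_⟩
    all_goals
      simp [numVI, midVI, lastVI, denVI]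
      field_simp
      grind
  obtain ⟨h1, Φ', h2, h3⟩ := hJ.exists_equivalence (by norm_num) (isPrimitiveRoot_neg_sq hω)
    ⟨shear 1 (1 / 2) 0, shear_mem_integralVI.2 (by norm_num), by simp [shear]⟩ continuous_T6
    iterate_T6 chartBl3 hD (E6_eq_line hω' (neg_ne_zero.2 (pow_ne_zero 2 hω0)) hD) Φ hΦ
    ⟨![1, 0], by rw [hd]; norm_num⟩ heq
  refine ⟨h1, Φ', fun x y hx hy h => ?_, h3⟩
  rw [h2 _ (by rwa [chartBl3_inverse_pt, hd]), chartBl3_inverse_pt,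
    hJ.jet_eq (fun x y => ?_) (by rwa [hd])]
  rw [f6, hd]
  congr 1
  simp [shearJet, numVI]

end ChazyLinks

theorem theorem4 (ω : ℂ) (hω : IsPrimitiveRoot ω 3) :
    -- Chazy IV and Brunella's very special foliation
    ((∀ (M : FunSpace) (ρ : BirationalMap M (cyclicQuot P2 T3)),
        BirationallyEquivalent (chazyFoliation chazyIV) (pull ρ.toFun (F3 ω))) ∧
      ∃ Φ : BirationalMap P2 (affine (level integralIV)),
        (∀ x y : ℂ, ω ^ 2 * y + x + ω ≠ 0 →
          (Φ.toFun (ptP2 x y)).1 = jet (ω - 1) 1 (-ω) (f3 ω) x y) ∧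
        InducesEquivalence T3 (E3 ω) chazyIV integralIV (ω ^ 2) Φ) ∧
    -- Chazy V and Santos's foliation of order four
    ((∀ (M : FunSpace) (ρ : BirationalMap M (cyclicQuot P1P1 T4)),
        BirationallyEquivalent (chazyFoliation chazyV) (pull ρ.toFun F4)) ∧
      ∃ Φ : BirationalMap P1P1 (affine (level integralV)),
        (∀ x y : ℂ, x * y + Complex.I * x - Complex.I * y - 1 ≠ 0 →
          (Φ.toFun (ptP1P1 x y)).1 =
            jet (Complex.I - 1) Complex.I 1 f4 x y) ∧
        InducesEquivalence T4 E4 chazyV integralV Complex.I Φ) ∧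
    -- Chazy VI and Santos's foliation of order six
    ((∀ (M : FunSpace) (ρ : BirationalMap M (cyclicQuot Bl3 T6)),
        BirationallyEquivalent (chazyFoliation chazyVI) (pull ρ.toFun (F6 ω))) ∧
      ∃ Φ : BirationalMap Bl3 (affine (level integralVI)),
        (∀ (x y : ℂ) (hx : x ≠ 0) (hy : y ≠ 0),
          x + y + x ^ 2 + y ^ 2 + x ^ 2 * y + x * y ^ 2 - 6 * x * y ≠ 0 →
          (Φ.toFun (ptBl3 x y hx hy)).1 = jet (-ω ^ 2) 1 (-ω) (f6 ω) x y) ∧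
        InducesEquivalence T6 (E6 ω) chazyVI integralVI (-ω ^ 2) Φ) :=
  ⟨chazyIV_equivalence hω, chazyV_equivalence, chazyVI_equivalence hω⟩
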